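/- **Theorem 1.4.** Let $n\ge 1$, $1\le p\le n$, let $\mathcal U\subseteq\mathbb R^n$ be open, $L\in\mathbb R^{n\times 1}$, and let $f\in C^2(\mathcal U;\mathbb R^n)$, $g\in C^2(\mathcal U;\mathbb R)$. Write $A(u)=Df(u)\in\mathbb R^{n\times n}$, $B(u)=Dg(u)\in\mathbb R^{1\times n}$, and let $a_1(u)\le\dots\le a_n(u)$ be the eigenvalues of $A(u)$ (real by the first assumption below). Assume that for every $u\in\mathcal U$: * there is a symmetric positive definite matrix $A_0$ such that $A_0A(u)$ is symmetric and $A_0LB(u)$ is symmetric, positive semidefinite and of rank one; and the eigenvalue $a_p(u)$ is simple; * no eigenvector of $A(u)$ lies in $\ker LB(u)$; * $\nabla a_p(u)\cdot r_p\ne0$ for every right eigenvector $r_p$ of $A(u)$ for $a_p(u)$. A *radiative shock profile* with end states $u_\pm\in\mathcal U$ and speed $s\in\mathbb R$ is a pair $(U,Q)\in C^1(\mathbb R;\mathcal U)\times C^2(\mathbb R;\mathbb R)$ with $$f(U)_x-sU_x+LQ_x=0,\qquad -Q_{xx}+Q+g(U)_x=0,\qquad U(x)\to u_\pm,\quad Q(x)\to0\quad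 (x\to\pm\infty),$$ (that is, a traveling wave $(U,Q)(x-st)$ of $u_t+f(u)_x+Lq_x=0$, $-q_{xx}+q+g(u)_x=0$), where $(u_-,u_+,s)$ satisfies $$f(u_+)-f(u_-)=s(u_+-u_-),\qquad a_p(u_+)<s<a_{p+1}(u_+),\qquad a_{p-1}(u_-)<s<a_p(u_-)$$ (conditions involving $a_0$ or $a_{n+1}$ being void), and $l_pLB(u_\pm)r_p>0$ for left and right eigenvectors $l_p,r_p$ of $A(u_\pm)$ for $a_p(u_\pm)$ with $l_pr_p=1$. Then small-amplitude radiative shock profiles are spectrally stable: for every $u_*\in\mathcal U$ there are a neighborhood $\mathcal N$ of $u_*$ and $\epsilon_0>0$ such that, for every radiative shock profile $(U,Q)$ with values $U(x)\in\mathcal N$ for all $x$ and amplitude $\epsilon:=|u_+-u_-|<\epsilon_0$, and for every $\lambda\in\mathbb C$ with $\operatorname{Re}\lambda\ge0$, $\lambda\ne0$, the only solution $(u,q)\in L^2(\mathbb R;\mathbb C^n)\times L^2(\mathbb R;\mathbb C)$, in the sense of distributions, of the linearized eigenvalue problem $$\lambda u+\big((A(U)-s)u\big)_x+Lq_x=0,\qquad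 -q_{xx}+q+(B(U)u)_x=0$$ is $(u,q)=(0,0)$ almost everywhere. -/

import Mathlib

open MeasureTheory Filter Topology

noncomputable section

namespace RadiativeShock

/-- The Jacobian matrix `A(u) = Df(u)` of the flux `f`. -/
def jac {n : ℕ} (f : (Fin n → ℝ) → (Fin n → ℝ)) (u : Fin n → ℝ) : Matrix (Fin n) (Fin n) ℝ :=
  Matrix.of fun i j => fderiv ℝ f u (Pi.single j 1) i

/-- The row vector `B(u) = Dg(u)`. -/
def grad {n : ℕ} (g : (Fin n → ℝ) → ℝ) (u : Fin n → ℝ) : Fin n → ℝ :=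
  fun j => fderiv ℝ g u (Pi.single j 1)

/-- The `n × n` matrix `L B(u)`. -/
def coupling {n : ℕ} (L : Fin n → ℝ) (g : (Fin n → ℝ) → ℝ) (u : Fin n → ℝ) :
    Matrix (Fin n) (Fin n) ℝ :=
  Matrix.vecMulVec L (grad g u)

/-- The real eigenvalues of a real matrix, repeated with algebraic multiplicity and listed in
nondecreasing order.  When all eigenvalues are real these are `a_1 ≤ ⋯ ≤ a_n`
(indexed from `0`); the default value `0` is only used beyond the end of the list. -/
def orderedEig {n : ℕ} (M : Matrix (Fin n) (Fin n) ℝ) (j : Fin n) : ℝ :=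
  (M.charpoly.roots.sort (· ≤ ·)).getD j 0

/-- The `j`-th characteristic speed `a_j(u)`, the `j`-th ordered eigenvalue of `A(u)`. -/
def charSpeed {n : ℕ} (f : (Fin n → ℝ) → (Fin n → ℝ)) (j : Fin n) (u : Fin n → ℝ) : ℝ :=
  orderedEig (jac f u) j

/-- Standing structural assumptions on the hyperbolic-elliptic system
`u_t + f(u)_x + L q_x = 0`, `-q_xx + q + g(u)_x = 0` on the state space `𝒰`,
with principal characteristic field `p`. -/
structure StructuralAssumptions {n : ℕ} (𝒰 : Set (Fin n → ℝ))
    (f : (Fin n → ℝ) → (Fin n → ℝ)) (g : (Fin n → ℝ) → ℝ) (L : Fin n → ℝ) (p : Fin n) :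
    Prop where
  isOpen : IsOpen 𝒰
  /-- regularity -/
  contDiff_f : ContDiffOn ℝ 2 f 𝒰
  contDiff_g : ContDiffOn ℝ 2 g 𝒰
  /-- symmetric dissipativity: a symmetric positive definite `A₀` symmetrizes `A`, and
  `A₀ L B` is symmetric, positive semidefinite, of rank one -/
  symmetrizer : ∀ u ∈ 𝒰, ∃ A₀ : Matrix (Fin n) (Fin n) ℝ, A₀.PosDef ∧
    (A₀ * jac f u).IsSymm ∧ (A₀ * coupling L g u).PosSemidef ∧ (A₀ * coupling L g u).rank = 1
  /-- the principal eigenvalue `a_p` is simple -/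
  simple : ∀ u ∈ 𝒰, (jac f u).charpoly.roots.count (charSpeed f p u) = 1
  /-- genuine coupling: no eigenvector of `A` lies in `ker (L B)` -/
  genuineCoupling : ∀ u ∈ 𝒰, ∀ (μ : ℝ) (r : Fin n → ℝ), r ≠ 0 →
    (jac f u).mulVec r = μ • r → (coupling L g u).mulVec r ≠ 0
  /-- genuine nonlinearity of the principal field: `∇a_p · r_p ≠ 0` -/
  genuineNonlinearity : ∀ u ∈ 𝒰, ∀ r : Fin n → ℝ, r ≠ 0 →
    (jac f u).mulVec r = charSpeed f p u • r → fderiv ℝ (charSpeed f p) u r ≠ 0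

/-- Positive diffusion at the state `u`: `l_p L B(u) r_p > 0`, where `l_p`, `r_p` are left and
right eigenvectors for `a_p(u)`, normalized by `l_p r_p = 1`. -/
def PositiveDiffusion {n : ℕ} (f : (Fin n → ℝ) → (Fin n → ℝ)) (g : (Fin n → ℝ) → ℝ)
    (L : Fin n → ℝ) (p : Fin n) (u : Fin n → ℝ) : Prop :=
  ∀ l r : Fin n → ℝ, (jac f u).vecMul l = charSpeed f p u • l →
    (jac f u).mulVec r = charSpeed f p u • r → l ⬝ᵥ r = 1 →
    0 < l ⬝ᵥ (coupling L g u).mulVec r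

/-- `(um, up, s)` (left state, right state, speed) is a Lax `p`-shock of `u_t + f(u)_x = 0`
with positive diffusion at both end states. In the entropy conditions the inequality
`s < a_{p+1}(up)` is written for all `j > p`, and `a_{p-1}(um) < s` for all `j < p`; by the
ordering this is the same, and it is void when `p` is the last, respectively first, field. -/
structure IsLaxShock {n : ℕ} (𝒰 : Set (Fin n → ℝ))
    (f : (Fin n → ℝ) → (Fin n → ℝ)) (g : (Fin n → ℝ) → ℝ) (L : Fin n → ℝ) (p : Fin n)
    (um up : Fin n → ℝ) (s : ℝ) : Prop where
  um_mem : um ∈ 𝒰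
  up_mem : up ∈ 𝒰
  rankineHugoniot : f up - f um = s • (up - um)
  lax_right : charSpeed f p up < s
  lax_right_succ : ∀ j, p < j → s < charSpeed f j up
  lax_left : s < charSpeed f p um
  lax_left_pred : ∀ j, j < p → charSpeed f j um < s
  diffusion_left : PositiveDiffusion f g L p um
  diffusion_right : PositiveDiffusion f g L p up

/-- `(U, Q)` is a radiative shock profile for the Lax shock `(um, up, s)`: `(U, Q)(x - s t)`
is a traveling wave with `U → um, up` and `Q → 0` as `x → -∞, +∞`. -/
structure IsRadiativeShockProfile {n : ℕ} (𝒰 : Set (Fin n → ℝ))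
    (f : (Fin n → ℝ) → (Fin n → ℝ)) (g : (Fin n → ℝ) → ℝ) (L : Fin n → ℝ) (p : Fin n)
    (um up : Fin n → ℝ) (s : ℝ) (U : ℝ → (Fin n → ℝ)) (Q : ℝ → ℝ) : Prop where
  shock : IsLaxShock 𝒰 f g L p um up s
  mem : ∀ x, U x ∈ 𝒰
  contDiff_U : ContDiff ℝ 1 U
  contDiff_Q : ContDiff ℝ 2 Q
  profile_u : ∀ x, deriv (fun y => f (U y)) x - s • deriv U x + deriv Q x • L = 0
  profile_q : ∀ x, -deriv (deriv Q) x + Q x + deriv (fun y => g (U y)) x = 0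
  tendsto_U_left : Tendsto U atBot (𝓝 um)
  tendsto_U_right : Tendsto U atTop (𝓝 up)
  tendsto_Q_left : Tendsto Q atBot (𝓝 0)
  tendsto_Q_right : Tendsto Q atTop (𝓝 0)

/-- `(u, q)` is an `L²` solution, in the sense of distributions on `ℝ`, of the eigenvalue
problem linearized about `(U, Q)` in the frame moving with speed `s`:
`lam u + ((A(U) - s) u)_x + L q_x = 0`, `-q_xx + q + (B(U) u)_x = 0`. -/
structure IsL2EigenSolution {n : ℕ}
    (f : (Fin n → ℝ) → (Fin n → ℝ)) (g : (Fin n → ℝ) → ℝ) (L : Fin n → ℝ)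
    (s : ℝ) (U : ℝ → (Fin n → ℝ)) (lam : ℂ) (u : ℝ → (Fin n → ℂ)) (q : ℝ → ℂ) : Prop where
  memLp_u : MemLp u 2 volume
  memLp_q : MemLp q 2 volume
  eq_u : ∀ φ : ℝ → ℝ, ContDiff ℝ (⊤ : ℕ∞) φ → HasCompactSupport φ → ∀ i : Fin n,
    ∫ x, (lam * u x i * ((φ x : ℝ) : ℂ)
      - ((∑ j, ((jac f (U x) i j : ℝ) : ℂ) * u x j) - (s : ℂ) * u x i) * ((deriv φ x : ℝ) : ℂ)
      - ((L i : ℝ) : ℂ) * q x * ((deriv φ x : ℝ) : ℂ)) = 0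
  eq_q : ∀ φ : ℝ → ℝ, ContDiff ℝ (⊤ : ℕ∞) φ → HasCompactSupport φ →
    ∫ x, (-(q x * ((deriv (deriv φ) x : ℝ) : ℂ)) + q x * ((φ x : ℝ) : ℂ)
      - (∑ j, ((grad g (U x) j : ℝ) : ℂ) * u x j) * ((deriv φ x : ℝ) : ℂ)) = 0

/-- Spectral stability: for `Re lam ≥ 0`, `lam ≠ 0`, the eigenvalue problem has no nontrivial
`L²` solution. -/
def SpectrallyStable {n : ℕ}
    (f : (Fin n → ℝ) → (Fin n → ℝ)) (g : (Fin n → ℝ) → ℝ) (L : Fin n → ℝ)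
    (s : ℝ) (U : ℝ → (Fin n → ℝ)) : Prop :=
  ∀ lam : ℂ, 0 ≤ lam.re → lam ≠ 0 → ∀ (u : ℝ → (Fin n → ℂ)) (q : ℝ → ℂ),
    IsL2EigenSolution f g L s U lam u q → u =ᵐ[volume] 0 ∧ q =ᵐ[volume] 0

end RadiativeShock

end

/-!
# Spectral stability of small-amplitude radiative shock profiles

Fix a state `u₀` and put `y₀ = (u₀, a_p(u₀))`, a point of the sonic surface `s = a_p(u)`.  By the Lax
conditions a small profile near `u₀` has a speed close to `a_p(u₀)`, so that `(U(x), s)` stays near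
`y₀`, and everything below is a perturbation argument around `y₀`.

**Structure.**  Symmetry and rank one make the symmetrizer unique once it is normalized by
`A₀ L = B` (`SymmCoupled.symmetrizer_unique`); it therefore solves an injective linear system and is
`C¹` in `u` (`StructuralAssumptions.exists_smooth_symmetrizer`).  Similarly the system
`(A - s) ρ = α L`, `l · ρ = 1` is uniquely solvable near `y₀`, including the sonic surface, where the
coupling condition replaces invertibility of `A - s` (`SymmCoupled.direction_unique`,
`exists_directionField`).

**The profile.**  Since `(A(U) - s) U' = -Q' L`, every profile satisfies `U' = z ρ(U, s)`,
`Q' = -z α(U, s)` with a scalar `z`, and `α` vanishes exactly on the sonic surface, with nonzero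
derivative along `ρ` by genuine nonlinearity (`IsDirectionField.fderiv_charSpeed`).  The resulting
scalar system is singular at sonic points, where `z` is merely continuous.  The minimum principle
for `Q` and barrier arguments that only use the product `α z` show nevertheless that `z` has the sign
for which `a_p(U)` decreases, and that it is small (`IsScalarProfile.z_nonpos`,
`IsScalarProfile.neg_le_z`).  Thus all coefficients along the profile vary slowly, and
monotonically in the direction `ρ`.

**The eigenvalue problem.**  For `λ ≠ 0` the unknowns can be integrated: `u = W'`, `q = v'` with
`W ∈ H¹`, `v ∈ H²` and `λ W + (A - s) W' + L v' = 0`, `v'' - v = B · W'`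
(`IsL2EigenSolution.exists_modes`).  Three estimates are added up in `EnergyData.eq_zero`.

* Goodman's estimate: `W` is tested with `Aw W`, where `Aw = A₀ - η A₀ (A - s)` is a second
  symmetrizer with a scalar function `η` that vanishes at `u₀`.  By Finsler's lemma `η` can be chosen
  so that `Aw (A - s)` is strictly monotone along `ρ` in every direction of the state space, not
  only in the genuinely nonlinear one (`SymmCoupled.exists_coercive_add`).  This controls
  `v`, `v'` and `(Re λ) W` by a small multiple of `u`.
* The standard estimate with `A₀`, which would control `v''` and `(Re λ) u`, but which requires
  testing with the derivative of `u`.  As `u` is only square integrable, it is applied to the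
  increments `W(· + h) - W` instead (`IsForcedMode.increment_estimate`); dividing by `h²` and letting
  `h → 0` gives the same bounds.
* Kawashima's estimate: by the coupling condition there is a skew matrix `K` for which the
  symmetric part of `Kᵀ A` plus a multiple of `B Bᵀ` is positive definite
  (`SymmCoupled.exists_compensator`), so `u` is controlled by `v`, `v'`, `v''` and `(Re λ) W`.

Together they bound `‖u‖²` by a small multiple of itself, hence `u = 0` and `q = 0`.
-/

noncomputable section

namespace RadiativeShock

open Matrix

/-! ### Absolutely continuous and `H¹` functions on the line -/

/-- `w` is locally absolutely continuous on `ℝ`, with (a representative of the) derivative `w'`. -/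
structure IsAC (w w' : ℝ → ℝ) : Prop where
  locInt : LocallyIntegrable w' volume
  sub_eq : ∀ x y, w y - w x = ∫ t in x..y, w' t

/-- `w` belongs to `H¹(ℝ)`, with derivative `w'`. -/
structure IsH1 (w w' : ℝ → ℝ) : Prop where
  ac : IsAC w w'
  memLp : MemLp w 2 volume
  memLp' : MemLp w' 2 volume

theorem _root_.MeasureTheory.MemLp.locallyIntegrable_two {E : Type*} [NormedAddCommGroup E]
    {w : ℝ → E} (h : MemLp w 2 volume) :
    LocallyIntegrable w volume := h.locallyIntegrable (by norm_num)

namespace IsAC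

variable {w w' a a' b b' : ℝ → ℝ}

theorem intervalIntegrable (h : IsAC w w') (x y : ℝ) : IntervalIntegrable w' volume x y :=
  (h.locInt.integrableOn_isCompact isCompact_uIcc).intervalIntegrable

theorem eq_add (h : IsAC w w') (x y : ℝ) : w y = w x + ∫ t in x..y, w' t := by
  have := h.sub_eq x y; linarith

theorem continuous (h : IsAC w w') : Continuous w := by
  have : w = fun y => w 0 + ∫ t in (0:ℝ)..y, w' t := funext fun y => h.eq_add 0 y
  rw [this]
  exact continuous_const.add (intervalIntegral.continuous_primitive h.intervalIntegrable 0)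

theorem ae_hasDerivAt (h : IsAC w w') : ∀ᵐ x, HasDerivAt w (w' x) x := by
  filter_upwards [_root_.LocallyIntegrable.ae_hasDerivAt_integral h.locInt] with x hx
  have : w = fun y => w 0 + ∫ t in (0:ℝ)..y, w' t := funext fun y => h.eq_add 0 y
  rw [this]
  exact (hx 0).const_add _

theorem absolutelyContinuousOnInterval (h : IsAC w w') (x y : ℝ) :
    AbsolutelyContinuousOnInterval w x y := by
  have e : w = fun z => (∫ t in x..z, w' t) - (-(w x)) := by
    funext z; rw [h.eq_add x z]; ring
  rw [e]
  exact ((h.intervalIntegrable x y).absolutelyContinuousOnInterval_intervalIntegral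
    (by simp)).sub
      (contDiffOn_const (n := 1) (c := -(w x))).absolutelyContinuousOnInterval

theorem mul (ha : IsAC a a') (hb : IsAC b b') :
    IsAC (fun x => a x * b x) (fun x => a' x * b x + a x * b' x) where
  locInt := by
    have h1 : LocallyIntegrable (fun x => a' x * b x) volume := by
      rw [locallyIntegrable_iff]
      intro k hk
      exact (ha.locInt.integrableOn_isCompact hk).mul_continuousOn hb.continuous.continuousOn hk
    have h2 : LocallyIntegrable (fun x => a x * b' x) volume := by
      rw [locallyIntegrable_iff]
      intro k hk
      exact (hb.locInt.integrableOn_isCompact hk).continuousOn_mul ha.continuous.continuousOn hk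
    exact h1.add h2
  sub_eq x y := by
    rw [← AbsolutelyContinuousOnInterval.integral_deriv_mul_eq_sub
      (ha.absolutelyContinuousOnInterval x y) (hb.absolutelyContinuousOnInterval x y)]
    apply intervalIntegral.integral_congr_ae
    filter_upwards [ha.ae_hasDerivAt, hb.ae_hasDerivAt] with t h1 h2 _
    rw [h1.deriv, h2.deriv]

theorem add (ha : IsAC a a') (hb : IsAC b b') :
    IsAC (fun x => a x + b x) (fun x => a' x + b' x) where
  locInt := ha.locInt.add hb.locInt
  sub_eq x y := by
    rw [intervalIntegral.integral_add (ha.intervalIntegrable x y) (hb.intervalIntegrable x y),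
      ← ha.sub_eq, ← hb.sub_eq]; ring

theorem sub (ha : IsAC a a') (hb : IsAC b b') :
    IsAC (fun x => a x - b x) (fun x => a' x - b' x) where
  locInt := ha.locInt.sub hb.locInt
  sub_eq x y := by
    rw [intervalIntegral.integral_sub (ha.intervalIntegrable x y) (hb.intervalIntegrable x y),
      ← ha.sub_eq, ← hb.sub_eq]; ring

theorem of_hasDerivAt {m m' : ℝ → ℝ} (hm : ∀ x, HasDerivAt m (m' x) x) (hc : Continuous m') :
    IsAC m m' where
  locInt := hc.locallyIntegrable
  sub_eq x y := (intervalIntegral.integral_eq_sub_of_hasDerivAt (fun t _ => hm t)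
    (hc.intervalIntegrable x y)).symm

theorem comp_add_right (ha : IsAC a a') (h : ℝ) :
    IsAC (fun x => a (x + h)) (fun x => a' (x + h)) where
  locInt := by
    have := locallyIntegrable_map_homeomorph (Homeomorph.addRight h) (f := a') (μ := volume)
    rw [Homeomorph.coe_addRight, map_add_right_eq_self] at this
    exact this.1 ha.locInt
  sub_eq x y := by
    rw [ha.sub_eq, intervalIntegral.integral_comp_add_right]

/-- An integrable locally absolutely continuous function with integrable derivative vanishes at
both ends of the line, so its derivative has zero mean. -/
theorem integral_eq_zero (h : IsAC w w') (hw : Integrable w) (hw' : Integrable w') :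
    ∫ x, w' x = 0 := by
  have hR : Tendsto w atTop (𝓝 (w 0 + ∫ t in Set.Ioi 0, w' t)) := by
    have := intervalIntegral_tendsto_integral_Ioi 0 hw'.integrableOn tendsto_id
    refine (this.const_add (w 0)).congr fun y => ?_
    rw [h.eq_add 0 y]; rfl
  have hL : Tendsto w atBot (𝓝 (w 0 - ∫ t in Set.Iic 0, w' t)) := by
    have := intervalIntegral_tendsto_integral_Iic 0 hw'.integrableOn tendsto_id
    refine (this.const_sub (w 0)).congr fun y => ?_
    rw [h.eq_add y 0]; simp
  have e1 := IntegrableAtFilter.eq_zero_of_tendsto (hw.integrableAtFilter atTop)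
    (by intro s hs; obtain ⟨a, ha⟩ := mem_atTop_sets.1 hs
        rw [← top_le_iff, ← Real.volume_Ici (a := a)]; exact measure_mono ha) hR
  have e2 := IntegrableAtFilter.eq_zero_of_tendsto (hw.integrableAtFilter atBot)
    (by intro s hs; obtain ⟨a, ha⟩ := mem_atBot_sets.1 hs
        rw [← top_le_iff, ← Real.volume_Iic (a := a)]; exact measure_mono ha) hL
  have := intervalIntegral.integral_Iic_add_Ioi (b := (0:ℝ)) hw'.integrableOn hw'.integrableOn
  linarith

end IsAC

namespace IsH1

variable {w w' a a' b b' : ℝ → ℝ}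

theorem sub (ha : IsH1 a a') (hb : IsH1 b b') :
    IsH1 (fun x => a x - b x) (fun x => a' x - b' x) :=
  ⟨ha.ac.sub hb.ac, ha.memLp.sub hb.memLp, ha.memLp'.sub hb.memLp'⟩

theorem comp_add_right (ha : IsH1 a a') (h : ℝ) :
    IsH1 (fun x => a (x + h)) (fun x => a' (x + h)) :=
  ⟨ha.ac.comp_add_right h,
    ha.memLp.comp_measurePreserving (measurePreserving_add_right volume h),
    ha.memLp'.comp_measurePreserving (measurePreserving_add_right volume h)⟩

/-- The increment `w(· + h) - w` of an `H¹` function. -/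
theorem diff (ha : IsH1 a a') (h : ℝ) :
    IsH1 (fun x => a (x + h) - a x) (fun x => a' (x + h) - a' x) :=
  (ha.comp_add_right h).sub ha

theorem _root_.RadiativeShock.integrable_bdd_mul_mul {m u v : ℝ → ℝ} {C : ℝ}
    (hm : AEStronglyMeasurable m volume) (hC : ∀ x, |m x| ≤ C)
    (hu : MemLp u 2 volume) (hv : MemLp v 2 volume) :
    Integrable (fun x => m x * (u x * v x)) :=
  (hu.integrable_mul hv).bdd_mul (c := C) hm (Eventually.of_forall hC)

/-- Integration by parts on the line with a `C¹` weight. -/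
theorem integral_weight_mul {m m' : ℝ → ℝ} {C C' : ℝ} (ha : IsH1 a a') (hb : IsH1 b b')
    (hm : ∀ x, HasDerivAt m (m' x) x) (hm'c : Continuous m')
    (hC : ∀ x, |m x| ≤ C) (hC' : ∀ x, |m' x| ≤ C') :
    ∫ x, m x * (a' x * b x) + m x * (a x * b' x) = -∫ x, m' x * (a x * b x) := by
  have hmc : Continuous m := continuous_iff_continuousAt.2 fun x => (hm x).continuousAt
  have i1 := integrable_bdd_mul_mul hmc.aestronglyMeasurable hC ha.memLp' hb.memLp
  have i2 := integrable_bdd_mul_mul hmc.aestronglyMeasurable hC ha.memLp hb.memLp'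
  have i3 := integrable_bdd_mul_mul hm'c.aestronglyMeasurable hC' ha.memLp hb.memLp
  have i4 := integrable_bdd_mul_mul hmc.aestronglyMeasurable hC ha.memLp hb.memLp
  have key := ((IsAC.of_hasDerivAt hm hm'c).mul (ha.ac.mul hb.ac)).integral_eq_zero i4
    ((i3.add (i1.add i2)).congr (Eventually.of_forall fun x => by simp only [Pi.add_apply]; ring))
  have e : (fun x => m' x * (a x * b x) + m x * (a' x * b x + a x * b' x)) =
      fun x => m' x * (a x * b x) + (m x * (a' x * b x) + m x * (a x * b' x)) := by
    funext x; ring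
  rw [e] at key
  have s := integral_add i3 (i1.add i2)
  simp only [Pi.add_apply] at s
  linarith

theorem integral_mul (ha : IsH1 a a') (hb : IsH1 b b') :
    ∫ x, a' x * b x = -∫ x, a x * b' x := by
  have := ha.integral_weight_mul hb (m := fun _ => 1) (m' := fun _ => 0) (C := 1) (C' := 0)
    (fun x => hasDerivAt_const x 1) continuous_const (by simp) (by simp)
  simp only [one_mul, zero_mul, integral_zero, neg_zero] at this
  have s := integral_add (ha.memLp'.integrable_mul hb.memLp) (ha.memLp.integrable_mul hb.memLp')
  simp only [Pi.mul_apply] at s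
  linarith

end IsH1

/-- Jensen's inequality for the square, obtained from the nonnegativity of the variance. -/
theorem sq_integral_unit_le {g : ℝ → ℝ} (hg : MemLp g 2 (volume.restrict (Set.Ioc 0 1))) :
    (∫ t in (0:ℝ)..1, g t) ^ 2 ≤ ∫ t in (0:ℝ)..1, g t ^ 2 := by
  set c := ∫ t in (0:ℝ)..1, g t with hc
  have i1 : IntervalIntegrable g volume 0 1 := by
    rw [intervalIntegrable_iff, Set.uIoc_of_le zero_le_one]
    exact hg.integrable (by norm_num)
  have i2 : IntervalIntegrable (fun t => g t ^ 2) volume 0 1 := by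
    rw [intervalIntegrable_iff, Set.uIoc_of_le zero_le_one]
    exact hg.integrable_sq
  have h0 : 0 ≤ ∫ t in (0:ℝ)..1, (g t - c) ^ 2 :=
    intervalIntegral.integral_nonneg zero_le_one fun t _ => sq_nonneg _
  have e : (fun t => (g t - c) ^ 2) = fun t => (g t ^ 2 - (2 * c) * g t) + c ^ 2 := by
    funext t; ring
  rw [e, intervalIntegral.integral_add (i2.sub (i1.const_mul _)) intervalIntegrable_const,
    intervalIntegral.integral_sub i2 (i1.const_mul _), intervalIntegral.integral_const_mul,
    ← hc] at h0
  simp at h0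
  nlinarith

/-- Increments of an `H¹` function are bounded in `L²` by the step times the `L²` norm of the
derivative. -/
theorem IsH1.integral_diff_sq_le {w w' : ℝ → ℝ} (hw : IsH1 w w') (h : ℝ) :
    ∫ x, (w (x + h) - w x) ^ 2 ≤ h ^ 2 * ∫ x, w' x ^ 2 := by
  have hsh : ∀ c : ℝ, MemLp (fun x => w' (x + c)) 2 volume := fun c =>
    hw.memLp'.comp_measurePreserving (measurePreserving_add_right volume c)
  -- write the increment as `h` times a mean value of `w'`; apply Jensen's inequality, then Fubini
  -- and the translation invariance of the integral
  have rep : ∀ x, w (x + h) - w x = h * ∫ t in (0:ℝ)..1, w' (x + h * t) := by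
    intro x
    rw [hw.ac.sub_eq, ← smul_eq_mul, intervalIntegral.smul_integral_comp_add_mul]
    simp
  have hmeas : AEStronglyMeasurable (fun p : ℝ × ℝ => w' (p.1 + h * p.2))
      (volume.prod (volume.restrict (Set.Ioc 0 1))) := by
    have hq : Measure.QuasiMeasurePreserving (fun p : ℝ × ℝ => p.1 + h * p.2)
        (volume.prod (volume.restrict (Set.Ioc 0 1))) volume := by
      have h1 : Measurable (fun p : ℝ × ℝ => p.1 + h * p.2) := by fun_prop
      refine ⟨h1, Measure.AbsolutelyContinuous.mk fun s hs h0 => ?_⟩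
      rw [Measure.map_apply h1 hs, Measure.prod_apply_symm (h1 hs)]
      refine (lintegral_congr fun y => ?_).trans lintegral_zero
      have := (measurePreserving_add_right (volume : Measure ℝ) (h * y)).measure_preimage
        hs.nullMeasurableSet
      rw [h0] at this
      exact this
    exact hw.memLp'.1.comp_quasiMeasurePreserving hq
  have hint : Integrable (fun p : ℝ × ℝ => w' (p.1 + h * p.2) ^ 2)
      (volume.prod (volume.restrict (Set.Ioc 0 1))) := by
    refine (integrable_prod_iff' (hmeas.pow 2)).2 ?_
    refine ⟨Eventually.of_forall fun y => (hsh (h * y)).integrable_sq, ?_⟩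
    have : (fun y => ∫ x, ‖w' (x + h * y) ^ 2‖) = fun _ => ∫ x, w' x ^ 2 := by
      funext y
      simp only [norm_pow, Real.norm_eq_abs, sq_abs]
      exact integral_add_right_eq_self (fun x => w' x ^ 2) (h * y)
    exact (congrArg (fun F => Integrable F (volume.restrict (Set.Ioc 0 1))) this).mpr
      (integrable_const _)
  have hae : ∀ᵐ x, MemLp (fun t => w' (x + h * t)) 2 (volume.restrict (Set.Ioc 0 1)) := by
    filter_upwards [hint.prod_right_ae, hmeas.prodMk_left] with x hx hx2
    exact (memLp_two_iff_integrable_sq hx2).2 hx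
  calc ∫ x, (w (x + h) - w x) ^ 2
      ≤ ∫ x, h ^ 2 * ∫ t in Set.Ioc (0:ℝ) 1, w' (x + h * t) ^ 2 := by
        refine integral_mono_ae (hw.diff h).memLp.integrable_sq
          (hint.integral_prod_left.const_mul _) ?_
        filter_upwards [hae] with x hx
        rw [rep x, mul_pow]
        have := sq_integral_unit_le hx
        rw [intervalIntegral.integral_of_le zero_le_one (f := fun t => w' (x + h * t) ^ 2)] at this
        exact mul_le_mul_of_nonneg_left this (sq_nonneg h)
    _ = h ^ 2 * ∫ x, w' x ^ 2 := by
        rw [integral_const_mul]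
        congr 1
        rw [integral_integral_swap hint]
        have : (fun y => ∫ x, w' (x + h * y) ^ 2) = fun _ => ∫ x, w' x ^ 2 := by
          funext y
          exact integral_add_right_eq_self (fun x => w' x ^ 2) (h * y)
        rw [this]; simp

/-- If the increments of an `H¹` function are `O(h)` in `L²`, the constant also bounds its
derivative, by Fatou's lemma along the difference quotients with step `1 / (k + 1)`. -/
theorem IsH1.integral_sq_le_of_diff {w w' : ℝ → ℝ} (hw : IsH1 w w') {K : ℝ}
    (hK : ∀ h : ℝ, 0 < h → h ≤ 1 → ∫ x, (w (x + h) - w x) ^ 2 ≤ h ^ 2 * K) :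
    ∫ x, w' x ^ 2 ≤ K := by
  set e : ℕ → ℝ := fun k => 1 / ((k : ℝ) + 1) with he
  have he0 : ∀ k, 0 < e k := fun k => by positivity
  have he1 : ∀ k, e k ≤ 1 := fun k => by
    rw [he]; simp only; rw [div_le_one (by positivity)]; linarith [Nat.cast_nonneg (α := ℝ) k]
  have helim : Tendsto e atTop (𝓝[≠] 0) :=
    tendsto_nhdsWithin_iff.2 ⟨tendsto_one_div_add_atTop_nhds_zero_nat,
      Eventually.of_forall fun k => (he0 k).ne'⟩
  set F : ℕ → ℝ → ℝ := fun k x => ((e k)⁻¹ * (w (x + e k) - w x)) ^ 2 with hF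
  have hFi : ∀ k, Integrable (F k) := fun k => by
    simp only [hF, mul_pow]; exact ((hw.diff (e k)).memLp.integrable_sq).const_mul _
  have hlim : ∀ᵐ x, Tendsto (fun k => F k x) atTop (𝓝 (w' x ^ 2)) := by
    filter_upwards [hw.ac.ae_hasDerivAt] with x hx
    have := (hasDerivAt_iff_tendsto_slope_zero.1 hx).comp helim
    simpa [hF, Function.comp_def] using this.pow 2
  have hK0 : 0 ≤ K := by
    have h1 := hK 1 one_pos le_rfl
    have : 0 ≤ ∫ x, (w (x + 1) - w x) ^ 2 := integral_nonneg fun x => sq_nonneg _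
    linarith
  have hbd : ∀ k, ∫⁻ x, ENNReal.ofReal (F k x) ≤ ENNReal.ofReal K := fun k => by
    rw [← ofReal_integral_eq_lintegral_ofReal (hFi k)
      (Eventually.of_forall fun x => sq_nonneg _)]
    apply ENNReal.ofReal_le_ofReal
    simp only [hF, mul_pow]
    rw [integral_const_mul]
    have := hK _ (he0 k) (he1 k)
    calc _ ≤ ((e k)⁻¹) ^ 2 * ((e k) ^ 2 * K) := by gcongr
      _ = K := by have := (he0 k).ne'; field_simp
  have hfat : ∫⁻ x, ENNReal.ofReal (w' x ^ 2) ≤ ENNReal.ofReal K := by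
    calc ∫⁻ x, ENNReal.ofReal (w' x ^ 2)
        = ∫⁻ x, liminf (fun k => ENNReal.ofReal (F k x)) atTop := by
          refine lintegral_congr_ae ?_
          filter_upwards [hlim] with x hx
          exact ((ENNReal.continuous_ofReal.tendsto _).comp hx).liminf_eq.symm
      _ ≤ liminf (fun k => ∫⁻ x, ENNReal.ofReal (F k x)) atTop := by
          refine lintegral_liminf_le' fun k => ?_
          exact (hFi k).1.aemeasurable.ennreal_ofReal
      _ ≤ ENNReal.ofReal K := by
          refine (liminf_le_liminf (Eventually.of_forall hbd)).trans ?_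
          simp
  rw [← ofReal_integral_eq_lintegral_ofReal hw.memLp'.integrable_sq
      (Eventually.of_forall fun x => sq_nonneg _)] at hfat
  exact (ENNReal.ofReal_le_ofReal_iff hK0).1 hfat

/-! ### Quadratic integrals with bounded coefficients -/

/-- Bounded continuous real functions on the line. -/
structure IsBddCont (m : ℝ → ℝ) : Prop where
  continuous : Continuous m
  bdd : ∃ C, ∀ x, |m x| ≤ C

/-- `C¹` functions on the line that are bounded together with their derivative `m'`. -/
structure IsBddC1 (m m' : ℝ → ℝ) : Prop where
  hasDerivAt : ∀ x, HasDerivAt m (m' x) x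
  fst : IsBddCont m
  snd : IsBddCont m'

namespace IsBddCont

variable {m k : ℝ → ℝ}

theorem const (c : ℝ) : IsBddCont fun _ => c := ⟨continuous_const, |c|, fun _ => le_rfl⟩

theorem sub (hm : IsBddCont m) (hk : IsBddCont k) : IsBddCont fun x => m x - k x := by
  obtain ⟨C, hC⟩ := hm.bdd
  obtain ⟨D, hD⟩ := hk.bdd
  exact ⟨hm.continuous.sub hk.continuous, C + D, fun x =>
    (abs_sub _ _).trans (add_le_add (hC x) (hD x))⟩

theorem comp_add_right (hm : IsBddCont m) (h : ℝ) : IsBddCont fun x => m (x + h) :=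
  ⟨hm.continuous.comp (by fun_prop), hm.bdd.imp fun _ hC x => hC _⟩

theorem memLp_mul (hm : IsBddCont m) {u : ℝ → ℝ} (hu : MemLp u 2 volume) :
    MemLp (fun x => m x * u x) 2 volume := by
  obtain ⟨C, hC⟩ := hm.bdd
  refine hu.of_le_mul (c := C) (hm.continuous.aestronglyMeasurable.mul hu.1)
    (Eventually.of_forall fun x => ?_)
  rw [norm_mul]
  exact mul_le_mul_of_nonneg_right (hC x) (norm_nonneg _)

end IsBddCont

theorem integral_add_add {f g k : ℝ → ℝ} (hf : Integrable f) (hg : Integrable g)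
    (hk : Integrable k) :
    ∫ x, (f x + g x + k x) = (∫ x, f x) + (∫ x, g x) + ∫ x, k x := by
  have := integral_add (hf.add hg) hk
  simp only [Pi.add_apply] at this
  rw [this, integral_add hf hg]

theorem integral_add_sub {f g k : ℝ → ℝ} (hf : Integrable f) (hg : Integrable g)
    (hk : Integrable k) :
    ∫ x, (f x + g x - k x) = (∫ x, f x) + (∫ x, g x) - ∫ x, k x := by
  have := integral_sub (hf.add hg) hk
  simp only [Pi.add_apply] at this
  rw [this, integral_add hf hg]

section Forms

variable {n : ℕ}

theorem memLp_dotProduct {b u : ℝ → Fin n → ℝ} (hb : ∀ i, IsBddCont fun x => b x i)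
    (hu : ∀ i, MemLp (fun x => u x i) 2 volume) : MemLp (fun x => b x ⬝ᵥ u x) 2 volume := by
  simp only [dotProduct]
  exact memLp_finsetSum _ fun i _ => (hb i).memLp_mul (hu i)

theorem memLp_mulVec {M : ℝ → Matrix (Fin n) (Fin n) ℝ} {u : ℝ → Fin n → ℝ}
    (hM : ∀ i j, IsBddCont fun x => M x i j)
    (hu : ∀ i, MemLp (fun x => u x i) 2 volume) (i : Fin n) :
    MemLp (fun x => (M x *ᵥ u x) i) 2 volume :=
  memLp_dotProduct (b := fun x => M x i) (hM i) hu

theorem integrable_dotProduct {w u : ℝ → Fin n → ℝ}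
    (hw : ∀ i, MemLp (fun x => w x i) 2 volume)
    (hu : ∀ i, MemLp (fun x => u x i) 2 volume) : Integrable fun x => w x ⬝ᵥ u x := by
  simp only [dotProduct]
  exact integrable_finsetSum _ fun i _ => (hw i).integrable_mul (hu i)

theorem integrable_form {M : ℝ → Matrix (Fin n) (Fin n) ℝ} {w u : ℝ → Fin n → ℝ}
    (hM : ∀ i j, IsBddCont fun x => M x i j) (hw : ∀ i, MemLp (fun x => w x i) 2 volume)
    (hu : ∀ i, MemLp (fun x => u x i) 2 volume) :
    Integrable fun x => w x ⬝ᵥ (M x *ᵥ u x) :=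
  integrable_dotProduct hw (memLp_mulVec hM hu)

/-- Integration by parts in a symmetric form: `w · N w' = (w · N w)' / 2 - w · N' w / 2`. -/
theorem integral_symm_form {N N' : ℝ → Matrix (Fin n) (Fin n) ℝ} {w u : ℝ → Fin n → ℝ}
    (hN : ∀ i j, IsBddC1 (fun x => N x i j) (fun x => N' x i j)) (hs : ∀ x, (N x).IsSymm)
    (hw : ∀ i, IsH1 (fun x => w x i) (fun x => u x i)) :
    ∫ x, w x ⬝ᵥ (N x *ᵥ u x) = -(1 / 2) * ∫ x, w x ⬝ᵥ (N' x *ᵥ w x) := by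
  have hNc : ∀ i j, IsBddCont fun x => N x i j := fun i j => (hN i j).fst
  have hNc' : ∀ i j, IsBddCont fun x => N' x i j := fun i j => (hN i j).snd
  have hwL := fun i => (hw i).memLp
  have huL := fun i => (hw i).memLp'
  have i1 := integrable_form hNc hwL huL
  have key : ∫ x, (w x ⬝ᵥ (N x *ᵥ u x) + w x ⬝ᵥ (N x *ᵥ u x)) =
      -∫ x, w x ⬝ᵥ (N' x *ᵥ w x) := by
    have e1 : ∀ x, w x ⬝ᵥ (N x *ᵥ u x) + w x ⬝ᵥ (N x *ᵥ u x) =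
        ∑ i, ∑ j, (N x i j * (u x i * w x j) + N x i j * (w x i * u x j)) := by
      intro x
      have : w x ⬝ᵥ (N x *ᵥ u x) = u x ⬝ᵥ (N x *ᵥ w x) := by
        rw [dotProduct_mulVec, ← mulVec_transpose, (hs x).eq, dotProduct_comm]
      nth_rw 1 [this]
      simp only [dotProduct, mulVec, Finset.mul_sum, ← Finset.sum_add_distrib]
      exact Finset.sum_congr rfl fun i _ => Finset.sum_congr rfl fun j _ => by ring
    have e2 : ∀ x, w x ⬝ᵥ (N' x *ᵥ w x) = ∑ i, ∑ j, N' x i j * (w x i * w x j) := by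
      intro x
      simp only [dotProduct, mulVec, Finset.mul_sum]
      exact Finset.sum_congr rfl fun i _ => Finset.sum_congr rfl fun j _ => by ring
    simp only [e1, e2]
    have ii : ∀ i j, Integrable fun x => N x i j * (u x i * w x j) + N x i j * (w x i * u x j) :=
      fun i j => by
        obtain ⟨C, hC⟩ := (hNc i j).bdd
        exact (integrable_bdd_mul_mul (hNc i j).continuous.aestronglyMeasurable hC (huL i)
          (hwL j)).add (integrable_bdd_mul_mul (hNc i j).continuous.aestronglyMeasurable hC (hwL i)
          (huL j))
    have ii' : ∀ i j, Integrable fun x => N' x i j * (w x i * w x j) :=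
      fun i j => by
        obtain ⟨C, hC⟩ := (hNc' i j).bdd
        exact integrable_bdd_mul_mul (hNc' i j).continuous.aestronglyMeasurable hC (hwL i) (hwL j)
    rw [integral_finsetSum _ fun i _ => integrable_finsetSum _ fun j _ => ii i j,
      integral_finsetSum _ fun i _ => integrable_finsetSum _ fun j _ => ii' i j,
      ← Finset.sum_neg_distrib]
    refine Finset.sum_congr rfl fun i _ => ?_
    rw [integral_finsetSum _ fun j _ => ii i j, integral_finsetSum _ fun j _ => ii' i j,
      ← Finset.sum_neg_distrib]
    refine Finset.sum_congr rfl fun j _ => ?_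
    obtain ⟨C, hC⟩ := (hNc i j).bdd
    obtain ⟨C', hC'⟩ := (hNc' i j).bdd
    exact (hw i).integral_weight_mul (hw j) (hN i j).hasDerivAt (hNc' i j).continuous hC hC'
  rw [integral_add i1 i1] at key
  linarith

/-- Integration by parts in the coupling term `(b · w) v'`. -/
theorem integral_dotProduct_mul {b b' w u : ℝ → Fin n → ℝ} {v q : ℝ → ℝ}
    (hb : ∀ i, IsBddC1 (fun x => b x i) (fun x => b' x i))
    (hw : ∀ i, IsH1 (fun x => w x i) (fun x => u x i)) (hv : IsH1 v q) :
    ∫ x, (b x ⬝ᵥ w x) * q x = -(∫ x, (b' x ⬝ᵥ w x) * v x) - ∫ x, (b x ⬝ᵥ u x) * v x := by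
  have hwL := fun i => (hw i).memLp
  have huL := fun i => (hw i).memLp'
  have e : ∀ (b w : ℝ → Fin n → ℝ) (v : ℝ → ℝ), (fun x => (b x ⬝ᵥ w x) * v x) =
      fun x => ∑ i, b x i * (w x i * v x) := fun b w v => by
    funext x; simp only [dotProduct, Finset.sum_mul, mul_assoc]
  have ii : ∀ {b w : ℝ → Fin n → ℝ} {v : ℝ → ℝ}, (∀ i, IsBddCont fun x => b x i) →
      (∀ i, MemLp (fun x => w x i) 2 volume) → MemLp v 2 volume → ∀ i,
      Integrable fun x => b x i * (w x i * v x) := fun hb hw hv i => by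
    obtain ⟨C, hC⟩ := (hb i).bdd
    exact integrable_bdd_mul_mul (hb i).continuous.aestronglyMeasurable hC (hw i) hv
  have hb1 := fun i => (hb i).fst
  have hb2 := fun i => (hb i).snd
  rw [e b w q, e b' w v, e b u v, integral_finsetSum _ fun i _ => ii hb1 hwL hv.memLp' i,
    integral_finsetSum _ fun i _ => ii hb2 hwL hv.memLp i,
    integral_finsetSum _ fun i _ => ii hb1 huL hv.memLp i, ← Finset.sum_neg_distrib,
    ← Finset.sum_sub_distrib]
  refine Finset.sum_congr rfl fun i _ => ?_
  obtain ⟨C, hC⟩ := (hb1 i).bdd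
  obtain ⟨C', hC'⟩ := (hb2 i).bdd
  have := (hw i).integral_weight_mul hv (hb i).hasDerivAt (hb2 i).continuous hC hC'
  rw [integral_add (ii hb1 huL hv.memLp i) (ii hb1 hwL hv.memLp' i)] at this
  linarith

end Forms

/-! ### Energy estimates for the integrated eigenvalue problem -/

/-- A real solution of the integrated problem `F + A W' + L v' = 0`, `v'' - v = B W'`, with
`u = W'`, `q = v'`, `r = v''`. -/
structure IsForcedMode {n : ℕ} (A : ℝ → Matrix (Fin n) (Fin n) ℝ) (B : ℝ → Fin n → ℝ)
    (L : Fin n → ℝ) (F W u : ℝ → Fin n → ℝ) (v q r : ℝ → ℝ) : Prop where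
  hF : ∀ i, MemLp (fun x => F x i) 2 volume
  hW : ∀ i, IsH1 (fun x => W x i) (fun x => u x i)
  hv : IsH1 v q
  hq : IsH1 q r
  eqW : ∀ᵐ x, F x + A x *ᵥ u x + q x • L = 0
  eqv : ∀ᵐ x, r x - v x = B x ⬝ᵥ u x

section Energy

variable {n : ℕ} {A : ℝ → Matrix (Fin n) (Fin n) ℝ} {B : ℝ → Fin n → ℝ}
  {L : Fin n → ℝ} {F W u : ℝ → Fin n → ℝ} {v q r : ℝ → ℝ}

/-- The equation for `W` tested against an `L²` field `T`. -/
theorem IsForcedMode.test (hm : IsForcedMode A B L F W u v q r)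
    (hA : ∀ i j, IsBddCont fun x => A x i j) {T : ℝ → Fin n → ℝ}
    (hT : ∀ i, MemLp (fun x => T x i) 2 volume) :
    (∫ x, T x ⬝ᵥ F x) + (∫ x, T x ⬝ᵥ (A x *ᵥ u x)) + ∫ x, (T x ⬝ᵥ L) * q x = 0 := by
  have huL := fun i => (hm.hW i).memLp'
  have i1 := integrable_dotProduct hT hm.hF
  have i2 := integrable_dotProduct hT (memLp_mulVec hA huL)
  have hTL : MemLp (fun x => T x ⬝ᵥ L) 2 volume := by
    have := memLp_dotProduct (b := fun _ => L) (fun i => IsBddCont.const (L i)) hT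
    simpa only [dotProduct_comm] using this
  have i3 := hTL.integrable_mul hm.hv.memLp'
  have : ∫ x, (T x ⬝ᵥ F x + T x ⬝ᵥ (A x *ᵥ u x) + (T x ⬝ᵥ L) * q x) = ∫ _ : ℝ, (0 : ℝ) := by
    refine integral_congr_ae ?_
    filter_upwards [hm.eqW] with x hx
    have : T x ⬝ᵥ (F x + A x *ᵥ u x + q x • L) = 0 := by rw [hx, dotProduct_zero]
    rw [dotProduct_add, dotProduct_add, dotProduct_smul, smul_eq_mul] at this
    linarith
  rw [integral_zero] at this
  rw [← this]
  exact (integral_add_add i1 i2 i3).symm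

/-- Goodman's estimate for the integrated problem, which is tested with `Aw W`.  The matrix `Aw A` is
symmetric and its derivative `N'` is negative enough to absorb the derivative `D'` of `Aw L`
(`hP`); as `Aw L` is close to `B` (`hQ`), the coupling term is nearly `-∫ (v'' - v) v`. -/
theorem IsForcedMode.weighted_estimate (hm : IsForcedMode A B L F W u v q r)
    (hA : ∀ i j, IsBddCont fun x => A x i j) (hB : ∀ i, IsBddCont fun x => B x i)
    {Aw N' : ℝ → Matrix (Fin n) (Fin n) ℝ} {D' : ℝ → Fin n → ℝ} {δ : ℝ}
    (hAw : ∀ i j, IsBddCont fun x => Aw x i j) (hAws : ∀ x, (Aw x).IsSymm)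
    (hN : ∀ i j, IsBddC1 (fun x => (Aw x * A x) i j) (fun x => N' x i j))
    (hNs : ∀ x, (Aw x * A x).IsSymm)
    (hD : ∀ i, IsBddC1 (fun x => (Aw x *ᵥ L) i) (fun x => D' x i))
    (hP : ∀ x w t, 1 / 2 * (w ⬝ᵥ (N' x *ᵥ w)) + (D' x ⬝ᵥ w) * t ≤ t ^ 2 / 4)
    (hQ : ∀ x w t, ((Aw x *ᵥ L - B x) ⬝ᵥ w) * t ≤ δ * (w ⬝ᵥ w) + t ^ 2 / 4) :
    (∫ x, (Aw x *ᵥ W x) ⬝ᵥ F x) + 1 / 2 * ((∫ x, v x ^ 2) + ∫ x, q x ^ 2) ≤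
      δ * ∫ x, u x ⬝ᵥ u x := by
  have hwL := fun i => (hm.hW i).memLp
  have huL := fun i => (hm.hW i).memLp'
  have hvL := hm.hv.memLp
  have hqL := hm.hq.memLp
  have hrL := hm.hq.memLp'
  have test := hm.test hA (memLp_mulVec hAw hwL)
  have e1 : ∀ x, (Aw x *ᵥ W x) ⬝ᵥ (A x *ᵥ u x) = W x ⬝ᵥ ((Aw x * A x) *ᵥ u x) := fun x => by
    rw [← mulVec_mulVec, dotProduct_mulVec (W x), ← mulVec_transpose, (hAws x).eq]
  have e2 : ∀ x w, (Aw x *ᵥ w) ⬝ᵥ L = (Aw x *ᵥ L) ⬝ᵥ w := fun x w => by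
    rw [dotProduct_comm, dotProduct_mulVec, ← mulVec_transpose, (hAws x).eq]
  simp only [e1, e2] at test
  rw [integral_symm_form hN hNs hm.hW, integral_dotProduct_mul hD hm.hW hm.hv] at test
  have hDc := fun i => (hD i).fst
  have hDc' := fun i => (hD i).snd
  have hNc' := fun i j => (hN i j).snd
  have iN := integrable_form hNc' hwL hwL
  have iD := (memLp_dotProduct hDc' hwL).integrable_mul hvL
  have iv := hvL.integrable_sq
  have iE : Integrable fun x => ((Aw x *ᵥ L - B x) ⬝ᵥ u x) * v x :=
    (memLp_dotProduct (b := fun x => Aw x *ᵥ L - B x) (fun i => (hDc i).sub (hB i))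
      huL).integrable_mul hvL
  have iu := integrable_dotProduct huL huL
  have b1 : 1 / 2 * (∫ x, W x ⬝ᵥ (N' x *ᵥ W x)) + ∫ x, (D' x ⬝ᵥ W x) * v x ≤
      1 / 4 * ∫ x, v x ^ 2 := by
    rw [← integral_const_mul, ← integral_const_mul]
    have s := integral_add (iN.const_mul (1 / 2)) iD
    simp only [Pi.mul_apply] at s
    rw [← s]
    refine integral_mono ((iN.const_mul (1 / 2)).add iD) (iv.const_mul _) fun x => ?_
    have := hP x (W x) (v x)
    simp only
    linarith
  have b2 : ∫ x, ((Aw x *ᵥ L - B x) ⬝ᵥ u x) * v x ≤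
      δ * (∫ x, u x ⬝ᵥ u x) + 1 / 4 * ∫ x, v x ^ 2 := by
    rw [← integral_const_mul, ← integral_const_mul, ← integral_add (iu.const_mul δ)
      (iv.const_mul _)]
    refine integral_mono iE ((iu.const_mul δ).add (iv.const_mul _)) fun x => ?_
    have := hQ x (u x) (v x)
    simp only
    linarith
  have b3 : ∫ x, ((Aw x *ᵥ L) ⬝ᵥ u x) * v x =
      (∫ x, ((Aw x *ᵥ L - B x) ⬝ᵥ u x) * v x) + (∫ x, r x * v x) - ∫ x, v x ^ 2 := by
    have irv : Integrable (fun x => r x * v x) := hrL.integrable_mul hvL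
    rw [← integral_add_sub iE irv iv]
    refine integral_congr_ae ?_
    filter_upwards [hm.eqv] with x hx
    rw [sub_dotProduct, ← hx]; ring
  have b4 : ∫ x, r x * v x = -∫ x, q x ^ 2 := by
    rw [hm.hq.integral_mul hm.hv]; simp only [sq]
  have b5 : 0 ≤ ∫ x, q x ^ 2 := integral_nonneg fun x => sq_nonneg _
  linarith

/-- The energy estimate for increments `W(· + h) - W`, which serves as a substitute for an energy
estimate on `u = W'` that needs no regularity of `u`. -/
theorem IsForcedMode.increment_estimate (hm : IsForcedMode A B L F W u v q r)
    (hA : ∀ i j, IsBddCont fun x => A x i j)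
    {A₀ N' : ℝ → Matrix (Fin n) (Fin n) ℝ} {B' : ℝ → Fin n → ℝ} {δ h : ℝ} (hδ : 0 ≤ δ)
    (hA₀ : ∀ i j, IsBddCont fun x => A₀ x i j) (hA₀s : ∀ x, (A₀ x).IsSymm)
    (hN : ∀ i j, IsBddC1 (fun x => (A₀ x * A x) i j) (fun x => N' x i j))
    (hNs : ∀ x, (A₀ x * A x).IsSymm)
    (hB : ∀ i, IsBddC1 (fun x => B x i) (fun x => B' x i))
    (hBL : ∀ x, A₀ x *ᵥ L = B x)
    (hP : ∀ x w, 1 / 2 * (w ⬝ᵥ (N' x *ᵥ w)) ≤ δ * (w ⬝ᵥ w))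
    (hQ : ∀ x w y, -((A₀ x *ᵥ w) ⬝ᵥ ((A (x + h) - A x) *ᵥ y)) ≤
      δ * (w ⬝ᵥ w) + δ * h ^ 2 * (y ⬝ᵥ y))
    (hR : ∀ x w t, (B' x ⬝ᵥ w) * t ≤ δ * (w ⬝ᵥ w) + t ^ 2 / 4)
    (hS : ∀ x y t, ((B (x + h) - B x) ⬝ᵥ y) * t ≤ δ * h ^ 2 * (y ⬝ᵥ y) + t ^ 2 / 4) :
    (∫ x, (A₀ x *ᵥ (W (x + h) - W x)) ⬝ᵥ (F (x + h) - F x)) +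
      1 / 2 * ((∫ x, (v (x + h) - v x) ^ 2) + ∫ x, (q (x + h) - q x) ^ 2) ≤
      5 * δ * h ^ 2 * ∫ x, u x ⬝ᵥ u x := by
  -- the increments solve the same problem with an additional force
  have hshift : MeasurePreserving (fun x : ℝ => x + h) volume volume :=
    measurePreserving_add_right volume h
  have huL := fun i => (hm.hW i).memLp'
  have hτu : ∀ i, MemLp (fun x => u (x + h) i) 2 volume := fun i =>
    (huL i).comp_measurePreserving hshift
  have hdA : ∀ i j, IsBddCont fun x => (A (x + h) - A x) i j := fun i j =>
    ((hA i j).comp_add_right h).sub (hA i j)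
  have hBc := fun i => (hB i).fst
  have hBc' := fun i => (hB i).snd
  have hdB : ∀ i, IsBddCont fun x => (B (x + h) - B x) i := fun i =>
    ((hBc i).comp_add_right h).sub (hBc i)
  have hdW : ∀ i, IsH1 (fun x => (W (x + h) - W x) i) (fun x => (u (x + h) - u x) i) := fun i =>
    (hm.hW i).diff h
  have hdv := hm.hv.diff h
  have hdq := hm.hq.diff h
  have hdF : ∀ i, MemLp (fun x => (F (x + h) - F x) i) 2 volume := fun i =>
    ((hm.hF i).comp_measurePreserving hshift).sub (hm.hF i)
  have hwL := fun i => (hdW i).memLp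
  have hduL := fun i => (hdW i).memLp'
  have hT := memLp_mulVec hA₀ hwL
  have eqW : ∀ᵐ x, (F (x + h) - F x) + A x *ᵥ (u (x + h) - u x) +
      (A (x + h) - A x) *ᵥ u (x + h) + (q (x + h) - q x) • L = 0 := by
    filter_upwards [hm.eqW, hshift.quasiMeasurePreserving.ae hm.eqW] with x h1 h2
    have := congrArg₂ (· - ·) h2 h1
    simp only [sub_zero] at this
    rw [← this, mulVec_sub, sub_mulVec, sub_smul]
    abel
  have eqv : ∀ᵐ x, B x ⬝ᵥ (u (x + h) - u x) =
      (r (x + h) - r x) - (v (x + h) - v x) - (B (x + h) - B x) ⬝ᵥ u (x + h) := by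
    filter_upwards [hm.eqv, hshift.quasiMeasurePreserving.ae hm.eqv] with x h1 h2
    rw [dotProduct_sub, sub_dotProduct, ← h1, ← h2]; ring
  have i1 := integrable_dotProduct hT hdF
  have i2 := integrable_dotProduct hT (memLp_mulVec hA hduL)
  have i3 := integrable_dotProduct hT (memLp_mulVec hdA hτu)
  have e2 : ∀ x w, (A₀ x *ᵥ w) ⬝ᵥ L = B x ⬝ᵥ w := fun x w => by
    rw [← hBL, dotProduct_comm, dotProduct_mulVec, ← mulVec_transpose, (hA₀s x).eq]
  have i4 : Integrable fun x => (B x ⬝ᵥ (W (x + h) - W x)) * (q (x + h) - q x) :=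
    (memLp_dotProduct hBc hwL).integrable_mul hdv.memLp'
  have test : (∫ x, (A₀ x *ᵥ (W (x + h) - W x)) ⬝ᵥ (F (x + h) - F x)) +
      (∫ x, (A₀ x *ᵥ (W (x + h) - W x)) ⬝ᵥ (A x *ᵥ (u (x + h) - u x))) +
      (∫ x, (A₀ x *ᵥ (W (x + h) - W x)) ⬝ᵥ ((A (x + h) - A x) *ᵥ u (x + h))) +
      ∫ x, (B x ⬝ᵥ (W (x + h) - W x)) * (q (x + h) - q x) = 0 := by
    have s := integral_add ((i1.add i2).add i3) i4
    simp only [Pi.add_apply] at s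
    rw [← integral_add_add i1 i2 i3, ← s, ← integral_zero ℝ ℝ]
    refine integral_congr_ae ?_
    filter_upwards [eqW] with x hx
    have := congrArg (fun y => (A₀ x *ᵥ (W (x + h) - W x)) ⬝ᵥ y) hx
    simp only [dotProduct_add, dotProduct_smul, smul_eq_mul, dotProduct_zero] at this
    rw [← e2]
    linarith
  have e1 : ∀ x, (A₀ x *ᵥ (W (x + h) - W x)) ⬝ᵥ (A x *ᵥ (u (x + h) - u x)) =
      (W (x + h) - W x) ⬝ᵥ ((A₀ x * A x) *ᵥ (u (x + h) - u x)) := fun x => by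
    rw [← mulVec_mulVec, dotProduct_mulVec (W (x + h) - W x), ← mulVec_transpose, (hA₀s x).eq]
  simp only [e1] at test
  rw [integral_symm_form (w := fun x => W (x + h) - W x) hN hNs hdW,
    integral_dotProduct_mul (w := fun x => W (x + h) - W x) hB hdW hdv] at test
  have iw := integrable_dotProduct hwL hwL
  have iτ := integrable_dotProduct hτu hτu
  have iv := hdv.memLp.integrable_sq
  have iN := integrable_form (fun i j => (hN i j).snd) hwL hwL
  have b1 : 1 / 2 * (∫ x, (W (x + h) - W x) ⬝ᵥ (N' x *ᵥ (W (x + h) - W x))) ≤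
      δ * ∫ x, (W (x + h) - W x) ⬝ᵥ (W (x + h) - W x) := by
    rw [← integral_const_mul, ← integral_const_mul]
    exact integral_mono (iN.const_mul _) (iw.const_mul _) fun x => hP x _
  have b2 : -(∫ x, (A₀ x *ᵥ (W (x + h) - W x)) ⬝ᵥ ((A (x + h) - A x) *ᵥ u (x + h))) ≤
      δ * (∫ x, (W (x + h) - W x) ⬝ᵥ (W (x + h) - W x)) +
        δ * h ^ 2 * ∫ x, u (x + h) ⬝ᵥ u (x + h) := by
    rw [← integral_neg, ← integral_const_mul, ← integral_const_mul,
      ← integral_add (iw.const_mul _) (iτ.const_mul _)]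
    exact integral_mono i3.neg ((iw.const_mul _).add (iτ.const_mul _)) fun x => hQ x _ _
  have iB' : Integrable fun x => (B' x ⬝ᵥ (W (x + h) - W x)) * (v (x + h) - v x) :=
    (memLp_dotProduct hBc' hwL).integrable_mul hdv.memLp
  have b3 : ∫ x, (B' x ⬝ᵥ (W (x + h) - W x)) * (v (x + h) - v x) ≤
      δ * (∫ x, (W (x + h) - W x) ⬝ᵥ (W (x + h) - W x)) +
        1 / 4 * ∫ x, (v (x + h) - v x) ^ 2 := by
    rw [← integral_const_mul, ← integral_const_mul,
      ← integral_add (iw.const_mul _) (iv.const_mul _)]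
    refine integral_mono iB' ((iw.const_mul _).add (iv.const_mul _)) fun x => ?_
    have := hR x (W (x + h) - W x) (v (x + h) - v x)
    simp only
    linarith
  have iS : Integrable fun x => ((B (x + h) - B x) ⬝ᵥ u (x + h)) * (-(v (x + h) - v x)) :=
    (memLp_dotProduct hdB hτu).integrable_mul hdv.memLp.neg
  have b4 : ∫ x, ((B (x + h) - B x) ⬝ᵥ u (x + h)) * (-(v (x + h) - v x)) ≤
      δ * h ^ 2 * (∫ x, u (x + h) ⬝ᵥ u (x + h)) + 1 / 4 * ∫ x, (v (x + h) - v x) ^ 2 := by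
    rw [← integral_const_mul, ← integral_const_mul,
      ← integral_add (iτ.const_mul _) (iv.const_mul _)]
    refine integral_mono iS ((iτ.const_mul _).add (iv.const_mul _)) fun x => ?_
    have := hS x (u (x + h)) (-(v (x + h) - v x))
    simp only
    linarith
  have irv : Integrable (fun x => (r (x + h) - r x) * (v (x + h) - v x)) :=
    hdq.memLp'.integrable_mul hdv.memLp
  have b5 : ∫ x, (B x ⬝ᵥ (u (x + h) - u x)) * (v (x + h) - v x) =
      (∫ x, (r (x + h) - r x) * (v (x + h) - v x)) +
      (∫ x, ((B (x + h) - B x) ⬝ᵥ u (x + h)) * (-(v (x + h) - v x))) -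
      ∫ x, (v (x + h) - v x) ^ 2 := by
    rw [← integral_add_sub irv iS iv]
    refine integral_congr_ae ?_
    filter_upwards [eqv] with x hx
    rw [hx]; ring
  have b6 : ∫ x, (r (x + h) - r x) * (v (x + h) - v x) = -∫ x, (q (x + h) - q x) ^ 2 := by
    rw [hdq.integral_mul hdv]; simp only [sq]
  have b7 : ∫ x, u (x + h) ⬝ᵥ u (x + h) = ∫ x, u x ⬝ᵥ u x :=
    integral_add_right_eq_self (fun x => u x ⬝ᵥ u x) h
  have b8 : ∫ x, (W (x + h) - W x) ⬝ᵥ (W (x + h) - W x) ≤ h ^ 2 * ∫ x, u x ⬝ᵥ u x := by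
    simp only [dotProduct]
    have iw' : ∀ i, Integrable fun x => (W (x + h) - W x) i * (W (x + h) - W x) i :=
      fun i => (hwL i).integrable_mul (hwL i)
    have iu' : ∀ i, Integrable fun x => u x i * u x i := fun i => (huL i).integrable_mul (huL i)
    rw [integral_finsetSum _ fun i _ => iw' i, integral_finsetSum _ fun i _ => iu' i,
      Finset.mul_sum]
    refine Finset.sum_le_sum fun i _ => ?_
    have := (hm.hW i).integral_diff_sq_le h
    simpa only [sq, Pi.sub_apply] using this
  have b9 := mul_le_mul_of_nonneg_left b8 hδ
  rw [b7] at b2 b4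
  have b10 : 0 ≤ ∫ x, (q (x + h) - q x) ^ 2 := integral_nonneg fun x => sq_nonneg _
  linarith

/-- Kawashima's estimate: testing with a compensating matrix `K` controls `u = W'` by the
dissipated quantities. -/
theorem IsForcedMode.compensator_estimate (hm : IsForcedMode A B L F W u v q r)
    (hA : ∀ i j, IsBddCont fun x => A x i j) (hB : ∀ i, IsBddCont fun x => B x i)
    {K : Matrix (Fin n) (Fin n) ℝ} {c C : ℝ} (hC : 0 ≤ C)
    (hP : ∀ x w, c * (w ⬝ᵥ w) ≤ (K *ᵥ w) ⬝ᵥ (A x *ᵥ w) + C * (B x ⬝ᵥ w) ^ 2)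
    (hQ : ∀ w t, -((K *ᵥ w) ⬝ᵥ L) * t ≤ c / 2 * (w ⬝ᵥ w) + C * t ^ 2) :
    c / 2 * (∫ x, u x ⬝ᵥ u x) ≤
      2 * C * ((∫ x, v x ^ 2) + (∫ x, q x ^ 2) + ∫ x, r x ^ 2) -
        ∫ x, (K *ᵥ u x) ⬝ᵥ F x := by
  have huL := fun i => (hm.hW i).memLp'
  have hvL := hm.hv.memLp
  have hqL := hm.hq.memLp
  have hrL := hm.hq.memLp'
  have hKu := memLp_mulVec (M := fun _ => K) (fun i j => IsBddCont.const (K i j)) huL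
  have test := hm.test hA hKu
  have iu := integrable_dotProduct huL huL
  have iA := integrable_dotProduct hKu (memLp_mulVec hA huL)
  have iB := (memLp_dotProduct hB huL).integrable_sq
  have iv := hvL.integrable_sq
  have iq := hqL.integrable_sq
  have ir := hrL.integrable_sq
  have iL : Integrable fun x => -((K *ᵥ u x) ⬝ᵥ L) * q x := by
    have := memLp_dotProduct (b := fun _ => L) (fun i => IsBddCont.const (L i)) hKu
    simp only [dotProduct_comm L] at this
    exact this.neg.integrable_mul hqL
  have b1 : c * (∫ x, u x ⬝ᵥ u x) ≤
      (∫ x, (K *ᵥ u x) ⬝ᵥ (A x *ᵥ u x)) + C * ∫ x, (B x ⬝ᵥ u x) ^ 2 := by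
    rw [← integral_const_mul, ← integral_const_mul, ← integral_add iA (iB.const_mul _)]
    exact integral_mono (iu.const_mul _) (iA.add (iB.const_mul _)) fun x => hP x _
  have b2 : ∫ x, -((K *ᵥ u x) ⬝ᵥ L) * q x ≤
      c / 2 * (∫ x, u x ⬝ᵥ u x) + C * ∫ x, q x ^ 2 := by
    rw [← integral_const_mul, ← integral_const_mul,
      ← integral_add (iu.const_mul _) (iq.const_mul _)]
    exact integral_mono iL ((iu.const_mul _).add (iq.const_mul _)) fun x => hQ _ _
  have b3 : ∫ x, (B x ⬝ᵥ u x) ^ 2 ≤ 2 * (∫ x, v x ^ 2) + 2 * ∫ x, r x ^ 2 := by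
    rw [← integral_const_mul, ← integral_const_mul,
      ← integral_add (iv.const_mul _) (ir.const_mul _)]
    refine integral_mono_ae iB ((iv.const_mul _).add (ir.const_mul _)) ?_
    filter_upwards [hm.eqv] with x hx
    rw [← hx]
    nlinarith [sq_nonneg (r x + v x)]
  have b4 : ∫ x, -((K *ᵥ u x) ⬝ᵥ L) * q x = -∫ x, ((K *ᵥ u x) ⬝ᵥ L) * q x := by
    rw [← integral_neg]; simp only [neg_mul]
  have b5 := mul_le_mul_of_nonneg_left b3 hC
  have b6 : 0 ≤ C * ∫ x, q x ^ 2 := mul_nonneg hC (integral_nonneg fun x => sq_nonneg _)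
  linarith

end Energy

/-! ### Combination of the energy estimates -/

/-- The coefficient bounds that make the Goodman and Kawashima estimates close: `A₀` and `Aw` are
symmetrizers of `A`, `N₀'` and `Nw'` are the derivatives of `A₀ A` and `Aw A`, `D'` is the derivative
of `Aw L`, and `K` is a compensating matrix; `δ` measures the variation of the coefficients. -/
structure EnergyData {n : ℕ} (A A₀ Aw N₀' Nw' : ℝ → Matrix (Fin n) (Fin n) ℝ)
    (B B' D' : ℝ → Fin n → ℝ) (L : Fin n → ℝ) (K : Matrix (Fin n) (Fin n) ℝ)
    (c c₀ C δ : ℝ) : Prop where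
  hA : ∀ i j, IsBddCont fun x => A x i j
  hA₀ : ∀ i j, IsBddCont fun x => A₀ x i j
  hAw : ∀ i j, IsBddCont fun x => Aw x i j
  A₀_symm : ∀ x, (A₀ x).IsSymm
  Aw_symm : ∀ x, (Aw x).IsSymm
  hN₀ : ∀ i j, IsBddC1 (fun x => (A₀ x * A x) i j) (fun x => N₀' x i j)
  hNw : ∀ i j, IsBddC1 (fun x => (Aw x * A x) i j) (fun x => Nw' x i j)
  N₀_symm : ∀ x, (A₀ x * A x).IsSymm
  Nw_symm : ∀ x, (Aw x * A x).IsSymm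
  hB : ∀ i, IsBddC1 (fun x => B x i) (fun x => B' x i)
  hD : ∀ i, IsBddC1 (fun x => (Aw x *ᵥ L) i) (fun x => D' x i)
  A₀_mulVec : ∀ x, A₀ x *ᵥ L = B x
  c₀_pos : 0 < c₀
  C_nonneg : 0 ≤ C
  δ_nonneg : 0 ≤ δ
  A₀_pos : ∀ x w, c₀ * (w ⬝ᵥ w) ≤ w ⬝ᵥ (A₀ x *ᵥ w)
  Aw_pos : ∀ x w, c₀ * (w ⬝ᵥ w) ≤ w ⬝ᵥ (Aw x *ᵥ w)
  compressive : ∀ x w t, 1 / 2 * (w ⬝ᵥ (Nw' x *ᵥ w)) + (D' x ⬝ᵥ w) * t ≤ t ^ 2 / 4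
  weight_close : ∀ x w t, ((Aw x *ᵥ L - B x) ⬝ᵥ w) * t ≤ δ * (w ⬝ᵥ w) + t ^ 2 / 4
  N₀'_small : ∀ x w, 1 / 2 * (w ⬝ᵥ (N₀' x *ᵥ w)) ≤ δ * (w ⬝ᵥ w)
  A_diff : ∀ h, 0 < h → ∀ x w y, -((A₀ x *ᵥ w) ⬝ᵥ ((A (x + h) - A x) *ᵥ y)) ≤
      δ * (w ⬝ᵥ w) + δ * h ^ 2 * (y ⬝ᵥ y)
  B'_small : ∀ x w t, (B' x ⬝ᵥ w) * t ≤ δ * (w ⬝ᵥ w) + t ^ 2 / 4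
  B_diff : ∀ h, 0 < h → ∀ x y t, ((B (x + h) - B x) ⬝ᵥ y) * t ≤ δ * h ^ 2 * (y ⬝ᵥ y) + t ^ 2 / 4
  K_skew : Kᵀ = -K
  K_pos : ∀ x w, c * (w ⬝ᵥ w) ≤ (K *ᵥ w) ⬝ᵥ (A x *ᵥ w) + C * (B x ⬝ᵥ w) ^ 2
  K_L : ∀ w t, -((K *ᵥ w) ⬝ᵥ L) * t ≤ c / 2 * (w ⬝ᵥ w) + C * t ^ 2
  K_bdd : ∀ w y, -((K *ᵥ w) ⬝ᵥ y) ≤ C * (w ⬝ᵥ w) + C * (y ⬝ᵥ y)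

section Combine

variable {n : ℕ}

/-- The contribution of the eigenvalue `a + i b` to an energy estimate with a symmetric weight: the
terms with `b` cancel between the real and the imaginary part. -/
theorem pair_energy_le {M : ℝ → Matrix (Fin n) (Fin n) ℝ} {W₁ W₂ : ℝ → Fin n → ℝ} {a b c₀ : ℝ}
    (ha : 0 ≤ a) (hM : ∀ i j, IsBddCont fun x => M x i j) (hMs : ∀ x, (M x).IsSymm)
    (hpos : ∀ x w, c₀ * (w ⬝ᵥ w) ≤ w ⬝ᵥ (M x *ᵥ w))
    (h₁ : ∀ i, MemLp (fun x => W₁ x i) 2 volume) (h₂ : ∀ i, MemLp (fun x => W₂ x i) 2 volume) :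
    a * c₀ * ((∫ x, W₁ x ⬝ᵥ W₁ x) + ∫ x, W₂ x ⬝ᵥ W₂ x) ≤
      (∫ x, (M x *ᵥ W₁ x) ⬝ᵥ (a • W₁ x - b • W₂ x)) +
        ∫ x, (M x *ᵥ W₂ x) ⬝ᵥ (a • W₂ x + b • W₁ x) := by
  have k₁ := integrable_dotProduct h₁ h₁
  have k₂ := integrable_dotProduct h₂ h₂
  have f₁ : ∀ i, MemLp (fun x => (a • W₁ x - b • W₂ x) i) 2 volume := fun i =>
    ((h₁ i).const_mul a).sub ((h₂ i).const_mul b)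
  have f₂ : ∀ i, MemLp (fun x => (a • W₂ x + b • W₁ x) i) 2 volume := fun i =>
    ((h₂ i).const_mul a).add ((h₁ i).const_mul b)
  have i₁ := integrable_dotProduct (memLp_mulVec hM h₁) f₁
  have i₂ := integrable_dotProduct (memLp_mulVec hM h₂) f₂
  rw [← integral_add k₁ k₂, ← integral_add i₁ i₂, ← integral_const_mul]
  refine integral_mono ((k₁.add k₂).const_mul _) (i₁.add i₂) fun x => ?_
  have e : (M x *ᵥ W₁ x) ⬝ᵥ W₂ x = (M x *ᵥ W₂ x) ⬝ᵥ W₁ x := by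
    rw [dotProduct_comm, dotProduct_mulVec, ← mulVec_transpose, (hMs x).eq]
  simp only [dotProduct_add, dotProduct_sub, dotProduct_smul, smul_eq_mul]
  rw [e]
  have p₁ := mul_le_mul_of_nonneg_left (hpos x (W₁ x)) ha
  have p₂ := mul_le_mul_of_nonneg_left (hpos x (W₂ x)) ha
  rw [dotProduct_comm (W₁ x) (M x *ᵥ W₁ x)] at p₁
  rw [dotProduct_comm (W₂ x) (M x *ᵥ W₂ x)] at p₂
  linarith

/-- Passage from increments to derivatives, componentwise.  The factor `μ` may vanish, in which case
the increments are not controlled at all. -/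
theorem integral_dotProduct_le_of_diff {W u : ℝ → Fin n → ℝ} {μ T : ℝ} (hμ : 0 ≤ μ)
    (hT : 0 ≤ T) (hW : ∀ i, IsH1 (fun x => W x i) (fun x => u x i))
    (h : ∀ h : ℝ, 0 < h → h ≤ 1 →
      μ * ∫ x, (W (x + h) - W x) ⬝ᵥ (W (x + h) - W x) ≤ h ^ 2 * T) :
    μ * ∫ x, u x ⬝ᵥ u x ≤ n * T := by
  rcases hμ.eq_or_lt with rfl | hμ
  · rw [zero_mul]; positivity
  have hi : ∀ i, ∫ x, u x i ^ 2 ≤ T / μ := by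
    intro i
    refine (hW i).integral_sq_le_of_diff fun s hs hs1 => ?_
    have hd : ∀ j, MemLp (fun x => (W (x + s) - W x) j) 2 volume := fun j => ((hW j).diff s).memLp
    have : ∫ x, (W (x + s) i - W x i) ^ 2 ≤ ∫ x, (W (x + s) - W x) ⬝ᵥ (W (x + s) - W x) := by
      refine integral_mono (hd i).integrable_sq (integrable_dotProduct hd hd) fun x => ?_
      have := Finset.single_le_sum (f := fun j => (W (x + s) - W x) j * (W (x + s) - W x) j)
        (fun j _ => mul_self_nonneg _) (Finset.mem_univ i)
      simpa only [sq, dotProduct, Pi.sub_apply] using this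
    have h2 := h s hs hs1
    rw [← mul_div_assoc, le_div_iff₀ hμ]
    nlinarith
  have iu : ∀ i, Integrable fun x => u x i * u x i := fun i =>
    (hW i).memLp'.integrable_mul (hW i).memLp'
  have : ∫ x, u x ⬝ᵥ u x ≤ n * (T / μ) := by
    simp only [dotProduct]
    rw [integral_finsetSum _ fun i _ => iu i]
    calc ∑ i, ∫ x, u x i * u x i ≤ ∑ _i : Fin n, T / μ :=
          Finset.sum_le_sum fun i _ => by simpa only [sq] using hi i
      _ = n * (T / μ) := by simp
  calc μ * ∫ x, u x ⬝ᵥ u x ≤ μ * (n * (T / μ)) := mul_le_mul_of_nonneg_left this hμ.le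
    _ = n * T := by field_simp

theorem ae_eq_zero_of_integral_dotProduct {u : ℝ → Fin n → ℝ}
    (hu : ∀ i, MemLp (fun x => u x i) 2 volume) (h : ∫ x, u x ⬝ᵥ u x ≤ 0) : u =ᵐ[volume] 0 := by
  have hn : 0 ≤ fun x => u x ⬝ᵥ u x := fun x =>
    Finset.sum_nonneg fun i _ => mul_self_nonneg _
  have h0 : ∫ x, u x ⬝ᵥ u x = 0 := le_antisymm h (integral_nonneg hn)
  rw [integral_eq_zero_iff_of_nonneg hn (integrable_dotProduct hu hu)] at h0
  filter_upwards [h0] with x hx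
  exact dotProduct_self_eq_zero.1 hx

theorem ae_eq_zero_of_integral_sq {v : ℝ → ℝ} (hv : MemLp v 2 volume) (h : ∫ x, v x ^ 2 ≤ 0) :
    v =ᵐ[volume] 0 := by
  have h0 : ∫ x, v x ^ 2 = 0 := le_antisymm h (integral_nonneg fun x => sq_nonneg _)
  rw [integral_eq_zero_iff_of_nonneg (fun x => sq_nonneg _) hv.integrable_sq] at h0
  filter_upwards [h0] with x hx
  exact pow_eq_zero_iff (two_ne_zero) |>.1 hx

variable {A A₀ Aw N₀' Nw' : ℝ → Matrix (Fin n) (Fin n) ℝ} {B B' D' : ℝ → Fin n → ℝ}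
  {L : Fin n → ℝ} {K : Matrix (Fin n) (Fin n) ℝ} {c c₀ C δ : ℝ}

/-- If the coefficients vary little, the integrated eigenvalue problem with eigenvalue `a + i b`,
`a ≥ 0`, has only the trivial solution.  The real and the imaginary part of the eigenfunction are
forced modes that force each other. -/
theorem EnergyData.eq_zero (hE : EnergyData A A₀ Aw N₀' Nw' B B' D' L K c c₀ C δ)
    (hδ : δ * (44 * C + C / c₀ * (10 * n + 1)) < c / 2) {a b : ℝ} (ha : 0 ≤ a)
    {W₁ W₂ u₁ u₂ : ℝ → Fin n → ℝ} {v₁ v₂ q₁ q₂ r₁ r₂ : ℝ → ℝ}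
    (m₁ : IsForcedMode A B L (fun x => a • W₁ x - b • W₂ x) W₁ u₁ v₁ q₁ r₁)
    (m₂ : IsForcedMode A B L (fun x => a • W₂ x + b • W₁ x) W₂ u₂ v₂ q₂ r₂) :
    (u₁ =ᵐ[volume] 0 ∧ u₂ =ᵐ[volume] 0) ∧ q₁ =ᵐ[volume] 0 ∧ q₂ =ᵐ[volume] 0 := by
  have nn : ∀ v : ℝ → ℝ, 0 ≤ ∫ x, v x ^ 2 := fun v => integral_nonneg fun x => sq_nonneg _
  have nd : ∀ u : ℝ → Fin n → ℝ, 0 ≤ ∫ x, u x ⬝ᵥ u x := fun u =>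
    integral_nonneg fun x => Finset.sum_nonneg fun i _ => mul_self_nonneg _
  have hw₁ := fun i => (m₁.hW i).memLp
  have hw₂ := fun i => (m₂.hW i).memLp
  have hu₁ := fun i => (m₁.hW i).memLp'
  have hu₂ := fun i => (m₂.hW i).memLp'
  set U₁ := ∫ x, u₁ x ⬝ᵥ u₁ x with hU₁
  set U₂ := ∫ x, u₂ x ⬝ᵥ u₂ x with hU₂
  have hδ0 := hE.δ_nonneg
  have hc0 := hE.c₀_pos
  have hC0 := hE.C_nonneg
  have hU : 0 ≤ U₁ + U₂ := add_nonneg (nd u₁) (nd u₂)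
  have hδU : 0 ≤ δ * (U₁ + U₂) := mul_nonneg hδ0 hU
  have hBc := fun i => (hE.hB i).fst
  -- the weighted estimate
  have s₁ := m₁.weighted_estimate hE.hA hBc hE.hAw hE.Aw_symm hE.hNw hE.Nw_symm hE.hD
    hE.compressive hE.weight_close
  have s₂ := m₂.weighted_estimate hE.hA hBc hE.hAw hE.Aw_symm hE.hNw hE.Nw_symm hE.hD
    hE.compressive hE.weight_close
  have s₃ := pair_energy_le (b := b) ha hE.hAw hE.Aw_symm hE.Aw_pos hw₁ hw₂
  -- the estimate for increments
  have t : ∀ h : ℝ, 0 < h → h ≤ 1 →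
      a * c₀ * ((∫ x, (W₁ (x + h) - W₁ x) ⬝ᵥ (W₁ (x + h) - W₁ x)) +
        ∫ x, (W₂ (x + h) - W₂ x) ⬝ᵥ (W₂ (x + h) - W₂ x)) +
      1 / 2 * ((∫ x, (q₁ (x + h) - q₁ x) ^ 2) + ∫ x, (q₂ (x + h) - q₂ x) ^ 2) ≤
      h ^ 2 * (5 * (δ * (U₁ + U₂))) := by
    intro h hh hh1
    have t₁ := m₁.increment_estimate hE.hA hδ0 hE.hA₀ hE.A₀_symm hE.hN₀ hE.N₀_symm hE.hB
      hE.A₀_mulVec hE.N₀'_small (hE.A_diff h hh) hE.B'_small (hE.B_diff h hh)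
    have t₂ := m₂.increment_estimate hE.hA hδ0 hE.hA₀ hE.A₀_symm hE.hN₀ hE.N₀_symm hE.hB
      hE.A₀_mulVec hE.N₀'_small (hE.A_diff h hh) hE.B'_small (hE.B_diff h hh)
    have t₃ := pair_energy_le (b := b) ha hE.hA₀ hE.A₀_symm hE.A₀_pos
      (W₁ := fun x => W₁ (x + h) - W₁ x) (W₂ := fun x => W₂ (x + h) - W₂ x)
      (fun i => ((m₁.hW i).diff h).memLp) (fun i => ((m₂.hW i).diff h).memLp)
    have e₁ : ∀ x, a • W₁ (x + h) - b • W₂ (x + h) - (a • W₁ x - b • W₂ x) =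
        a • (W₁ (x + h) - W₁ x) - b • (W₂ (x + h) - W₂ x) := fun x => by
      rw [smul_sub, smul_sub]; abel
    have e₂ : ∀ x, a • W₂ (x + h) + b • W₁ (x + h) - (a • W₂ x + b • W₁ x) =
        a • (W₂ (x + h) - W₂ x) + b • (W₁ (x + h) - W₁ x) := fun x => by
      rw [smul_sub, smul_sub]; abel
    simp only [e₁, ← hU₁] at t₁
    simp only [e₂, ← hU₂] at t₂
    linarith [nn fun x => v₁ (x + h) - v₁ x, nn fun x => v₂ (x + h) - v₂ x]
  have hac : 0 ≤ a * c₀ := mul_nonneg ha hc0.le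
  have r₁b : ∫ x, r₁ x ^ 2 ≤ 10 * (δ * (U₁ + U₂)) := m₁.hq.integral_sq_le_of_diff fun h hh hh1 => by
    have := t h hh hh1
    have p := mul_nonneg hac (add_nonneg (nd fun x => W₁ (x + h) - W₁ x)
      (nd fun x => W₂ (x + h) - W₂ x))
    linarith [nn fun x => q₂ (x + h) - q₂ x]
  have r₂b : ∫ x, r₂ x ^ 2 ≤ 10 * (δ * (U₁ + U₂)) := m₂.hq.integral_sq_le_of_diff fun h hh hh1 => by
    have := t h hh hh1
    have p := mul_nonneg hac (add_nonneg (nd fun x => W₁ (x + h) - W₁ x)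
      (nd fun x => W₂ (x + h) - W₂ x))
    linarith [nn fun x => q₁ (x + h) - q₁ x]
  have u₁b : a * c₀ * U₁ ≤ n * (5 * (δ * (U₁ + U₂))) :=
    integral_dotProduct_le_of_diff hac (by linarith) m₁.hW fun h hh hh1 => by
      have := t h hh hh1
      have p := mul_nonneg hac (nd fun x => W₂ (x + h) - W₂ x)
      linarith [nn fun x => q₁ (x + h) - q₁ x, nn fun x => q₂ (x + h) - q₂ x]
  have u₂b : a * c₀ * U₂ ≤ n * (5 * (δ * (U₁ + U₂))) :=
    integral_dotProduct_le_of_diff hac (by linarith) m₂.hW fun h hh hh1 => by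
      have := t h hh hh1
      have p := mul_nonneg hac (nd fun x => W₁ (x + h) - W₁ x)
      linarith [nn fun x => q₁ (x + h) - q₁ x, nn fun x => q₂ (x + h) - q₂ x]
  -- the compensator estimate
  have k₁ := m₁.compensator_estimate hE.hA hBc hC0 hE.K_pos hE.K_L
  have k₂ := m₂.compensator_estimate hE.hA hBc hC0 hE.K_pos hE.K_L
  have hK : ∀ i j, IsBddCont fun _ : ℝ => K i j := fun i j => IsBddCont.const _
  -- `K` is skew and integration by parts produces another sign, so the terms with `b` cancel in
  -- the sum of the two estimates
  have cross : ∫ x, (K *ᵥ u₁ x) ⬝ᵥ W₂ x = ∫ x, (K *ᵥ u₂ x) ⬝ᵥ W₁ x := by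
    have e₁ : ∀ x, (K *ᵥ u₁ x) ⬝ᵥ W₂ x = ∑ i, ∑ j, K i j * (u₁ x j * W₂ x i) := fun x => by
      simp only [dotProduct, mulVec, Finset.sum_mul]
      exact Finset.sum_congr rfl fun i _ => Finset.sum_congr rfl fun j _ => by ring
    have e₂ : ∀ x, (K *ᵥ u₂ x) ⬝ᵥ W₁ x = ∑ i, ∑ j, K j i * (u₂ x i * W₁ x j) := fun x => by
      simp only [dotProduct, mulVec, Finset.sum_mul]
      rw [Finset.sum_comm]
      exact Finset.sum_congr rfl fun i _ => Finset.sum_congr rfl fun j _ => by ring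
    have i₁ : ∀ i j, Integrable fun x => K i j * (u₁ x j * W₂ x i) := fun i j =>
      ((hu₁ j).integrable_mul (hw₂ i)).const_mul _
    have i₂ : ∀ i j, Integrable fun x => K j i * (u₂ x i * W₁ x j) := fun i j =>
      ((hu₂ i).integrable_mul (hw₁ j)).const_mul _
    simp only [e₁, e₂]
    rw [integral_finsetSum _ fun i _ => integrable_finsetSum _ fun j _ => i₁ i j,
      integral_finsetSum _ fun i _ => integrable_finsetSum _ fun j _ => i₂ i j]
    refine Finset.sum_congr rfl fun i _ => ?_
    rw [integral_finsetSum _ fun j _ => i₁ i j, integral_finsetSum _ fun j _ => i₂ i j]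
    refine Finset.sum_congr rfl fun j _ => ?_
    have sk : K j i = -K i j := by
      have := congrFun (congrFun hE.K_skew i) j
      simpa using this
    have := (m₁.hW j).integral_mul (m₂.hW i)
    rw [integral_const_mul, integral_const_mul, this, sk]
    simp only [mul_comm (W₁ _ _)]
    ring
  have iKW : ∀ {u W : ℝ → Fin n → ℝ}, (∀ i, MemLp (fun x => u x i) 2 volume) →
      (∀ i, MemLp (fun x => W x i) 2 volume) → Integrable fun x => (K *ᵥ u x) ⬝ᵥ W x :=
    fun hu hW => integrable_dotProduct (memLp_mulVec hK hu) hW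
  have f₁ : ∫ x, (K *ᵥ u₁ x) ⬝ᵥ (a • W₁ x - b • W₂ x) =
      a * (∫ x, (K *ᵥ u₁ x) ⬝ᵥ W₁ x) - b * ∫ x, (K *ᵥ u₁ x) ⬝ᵥ W₂ x := by
    rw [← integral_const_mul, ← integral_const_mul,
      ← integral_sub ((iKW hu₁ hw₁).const_mul _) ((iKW hu₁ hw₂).const_mul _)]
    simp only [dotProduct_sub, dotProduct_smul, smul_eq_mul]
  have f₂ : ∫ x, (K *ᵥ u₂ x) ⬝ᵥ (a • W₂ x + b • W₁ x) =
      a * (∫ x, (K *ᵥ u₂ x) ⬝ᵥ W₂ x) + b * ∫ x, (K *ᵥ u₂ x) ⬝ᵥ W₁ x := by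
    rw [← integral_const_mul, ← integral_const_mul,
      ← integral_add ((iKW hu₂ hw₂).const_mul _) ((iKW hu₂ hw₁).const_mul _)]
    simp only [dotProduct_add, dotProduct_smul, smul_eq_mul]
  have bd : ∀ {u W : ℝ → Fin n → ℝ}, (∀ i, MemLp (fun x => u x i) 2 volume) →
      (∀ i, MemLp (fun x => W x i) 2 volume) →
      -(∫ x, (K *ᵥ u x) ⬝ᵥ W x) ≤ C * (∫ x, u x ⬝ᵥ u x) + C * ∫ x, W x ⬝ᵥ W x := by
    intro u W hu hW
    have iu := integrable_dotProduct hu hu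
    have iW := integrable_dotProduct hW hW
    rw [← integral_neg, ← integral_const_mul, ← integral_const_mul,
      ← integral_add (iu.const_mul _) (iW.const_mul _)]
    exact integral_mono (iKW hu hW).neg ((iu.const_mul _).add (iW.const_mul _))
      fun x => hE.K_bdd _ _
  have g₁ := mul_le_mul_of_nonneg_left (bd hu₁ hw₁) ha
  have g₂ := mul_le_mul_of_nonneg_left (bd hu₂ hw₂) ha
  rw [← hU₁] at g₁ s₁ k₁
  rw [← hU₂] at g₂ s₂ k₂
  rw [f₁] at k₁
  rw [f₂, ← cross] at k₂
  set X₁ := ∫ x, W₁ x ⬝ᵥ W₁ x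
  set X₂ := ∫ x, W₂ x ⬝ᵥ W₂ x
  have hX₁ : 0 ≤ X₁ := nd W₁
  have hX₂ : 0 ≤ X₂ := nd W₂
  have hU₁0 : 0 ≤ U₁ := nd u₁
  have hU₂0 : 0 ≤ U₂ := nd u₂
  have vb : (∫ x, v₁ x ^ 2) + (∫ x, q₁ x ^ 2) + ((∫ x, v₂ x ^ 2) + ∫ x, q₂ x ^ 2) ≤
      2 * (δ * (U₁ + U₂)) := by
    have := mul_nonneg hac (add_nonneg hX₁ hX₂)
    linarith
  have xb : a * c₀ * (X₁ + X₂) ≤ δ * (U₁ + U₂) := by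
    linarith [nn v₁, nn v₂, nn q₁, nn q₂]
  have xu : a * (X₁ + X₂ + (U₁ + U₂)) ≤ (10 * n + 1) / c₀ * (δ * (U₁ + U₂)) := by
    rw [div_mul_eq_mul_div, le_div_iff₀ hc0]
    linarith
  have xuC := mul_le_mul_of_nonneg_left xu hC0
  -- `v`, `q` contribute `2 δ ‖u‖²` and `r` contributes `20 δ ‖u‖²` to the dissipation, each with
  -- the factor `2 C`; this gives `44 C`, and the remaining terms come from
  -- the products of `a W` with `K u`
  have tot : c / 2 * (U₁ + U₂) ≤ δ * (44 * C + C / c₀ * (10 * n + 1)) * (U₁ + U₂) := by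
    have vbC := mul_le_mul_of_nonneg_left
      (add_le_add vb (add_le_add r₁b r₂b)) (mul_nonneg zero_le_two hC0)
    have e : C * ((10 * n + 1) / c₀ * (δ * (U₁ + U₂))) =
      C / c₀ * (10 * n + 1) * (δ * (U₁ + U₂)) := by ring
    rw [e] at xuC
    linarith
  have hU0 : U₁ + U₂ = 0 := by
    by_contra hne
    have : 0 < U₁ + U₂ := lt_of_le_of_ne hU (Ne.symm hne)
    exact absurd (lt_of_mul_lt_mul_right (lt_of_le_of_lt tot
      (mul_lt_mul_of_pos_right hδ this)) this.le) (lt_irrefl _)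
  rw [hU0, mul_zero, mul_zero] at vb
  refine ⟨⟨ae_eq_zero_of_integral_dotProduct hu₁ (by linarith),
    ae_eq_zero_of_integral_dotProduct hu₂ (by linarith)⟩,
    ae_eq_zero_of_integral_sq m₁.hv.memLp' ?_, ae_eq_zero_of_integral_sq m₂.hv.memLp' ?_⟩
  · linarith [nn v₁, nn v₂, nn q₁, nn q₂]
  · linarith [nn v₁, nn v₂, nn q₁, nn q₂]

end Combine

open scoped ContDiff

/-! ### From distributional solutions to `H¹` solutions -/

/-- Real test functions on the line. -/
structure IsTest (φ : ℝ → ℝ) : Prop where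
  contDiff : ContDiff ℝ (⊤ : ℕ∞) φ
  compact : HasCompactSupport φ

namespace IsTest

variable {φ ψ : ℝ → ℝ}

theorem deriv (h : IsTest φ) : IsTest (deriv φ) :=
  ⟨(contDiff_infty_iff_deriv.1 h.contDiff).2, h.compact.deriv⟩

theorem differentiable (h : IsTest φ) : Differentiable ℝ φ :=
  (contDiff_infty_iff_deriv.1 h.contDiff).1

theorem continuous (h : IsTest φ) : Continuous φ := h.contDiff.continuous

theorem integrable (h : IsTest φ) : Integrable φ :=
  h.continuous.integrable_of_hasCompactSupport h.compact

theorem isAC (h : IsTest φ) : IsAC φ (_root_.deriv φ) :=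
  IsAC.of_hasDerivAt (fun x => (h.differentiable x).hasDerivAt) h.deriv.continuous

theorem sub_smul (h : IsTest φ) (k : IsTest ψ) (c : ℝ) : IsTest (fun x => φ x - c * ψ x) :=
  ⟨h.contDiff.sub (contDiff_const.mul k.contDiff), h.compact.sub (k.compact.mul_left)⟩

theorem integrable_mul (h : IsTest φ) {g : ℝ → ℝ} (hg : LocallyIntegrable g volume) :
    Integrable fun x => g x * φ x := by
  have := hg.integrable_smul_left_of_hasCompactSupport h.continuous h.compact
  simpa only [smul_eq_mul, mul_comm] using this

/-- A test function of zero mean is the derivative of a test function. -/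
theorem exists_primitive (h : IsTest ψ) (h0 : ∫ x, ψ x = 0) :
    ∃ φ, IsTest φ ∧ _root_.deriv φ = ψ := by
  obtain ⟨R, hR⟩ := h.compact.isCompact.isBounded.subset_closedBall 0
  have hz : ∀ x, R < |x| → ψ x = 0 := fun x hx => by
    by_contra hne
    have := hR (subset_tsupport ψ hne)
    rw [Metric.mem_closedBall, dist_zero_right, Real.norm_eq_abs] at this
    linarith
  set φ : ℝ → ℝ := fun x => ∫ t in Set.Iic x, ψ t with hφ
  have hd : ∀ x, HasDerivAt φ (ψ x) x := fun x => by
    have e : φ = fun y => (∫ t in Set.Iic 0, ψ t) + ∫ t in (0:ℝ)..y, ψ t := by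
      funext y
      rw [← intervalIntegral.integral_Iic_sub_Iic h.integrable.integrableOn
        h.integrable.integrableOn]
      simp [hφ]
    rw [e]
    exact (intervalIntegral.integral_hasDerivAt_right
      (h.continuous.intervalIntegrable _ _) (h.continuous.stronglyMeasurableAtFilter _ _)
      h.continuous.continuousAt).const_add _
  have hde : _root_.deriv φ = ψ := funext fun x => (hd x).deriv
  refine ⟨φ, ⟨contDiff_infty_iff_deriv.2 ⟨fun x => (hd x).differentiableAt, hde ▸ h.contDiff⟩,
    ?_⟩, hde⟩
  refine HasCompactSupport.intro (isCompact_closedBall (0:ℝ) R) fun x hx => ?_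
  rw [Metric.mem_closedBall, dist_zero_right, Real.norm_eq_abs, not_le] at hx
  rcases le_or_gt x 0 with hx0 | hx0
  · rw [abs_of_nonpos hx0] at hx
    simp only [hφ]
    rw [setIntegral_congr_fun (g := fun _ => (0:ℝ)) measurableSet_Iic, integral_zero]
    intro t ht
    refine hz t ?_
    rw [abs_of_nonpos (le_trans ht hx0)]
    linarith [Set.mem_Iic.1 ht]
  · rw [abs_of_pos hx0] at hx
    have := integral_add_compl (s := Set.Iic x) measurableSet_Iic h.integrable
    rw [h0, Set.compl_Iic, setIntegral_congr_fun (s := Set.Ioi x) (g := fun _ => (0:ℝ))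
      measurableSet_Ioi, integral_zero, add_zero] at this
    · exact this
    · intro t ht
      have ht' : x < t := ht
      refine hz t ?_
      rw [abs_of_pos (hx0.trans ht')]
      linarith

theorem exists_integral_eq_one : ∃ ρ, IsTest ρ ∧ ∫ x, ρ x = 1 := by
  let b : ContDiffBump (0 : ℝ) := ⟨1, 2, one_pos, one_lt_two⟩
  exact ⟨b.normed volume, ⟨b.contDiff_normed, b.hasCompactSupport_normed⟩, b.integral_normed⟩

end IsTest

theorem IsAC.congr_deriv {w g g' : ℝ → ℝ} (h : IsAC w g) (hg : LocallyIntegrable g' volume)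
    (e : g =ᵐ[volume] g') : IsAC w g' :=
  ⟨hg, fun x y => (h.sub_eq x y).trans (intervalIntegral.integral_congr_ae
    (by filter_upwards [e] with t ht _ using ht))⟩

theorem isAC_primitive {g : ℝ → ℝ} (hg : LocallyIntegrable g volume) (c : ℝ) :
    IsAC (fun x => c + ∫ t in (0:ℝ)..x, g t) g :=
  ⟨hg, fun x y => by
    have hi : ∀ x y, IntervalIntegrable g volume x y := fun x y =>
      (hg.integrableOn_isCompact isCompact_uIcc).intervalIntegrable
    rw [← intervalIntegral.integral_add_adjacent_intervals (hi 0 x) (hi x y)]; ring⟩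

theorem IsAC.integral_mul_test {w g φ : ℝ → ℝ} (h : IsAC w g) (hφ : IsTest φ) :
    ∫ x, (w x * deriv φ x + g x * φ x) = 0 := by
  have hw : LocallyIntegrable w volume := h.continuous.locallyIntegrable
  have i := (hφ.integrable_mul h.locInt).add (hφ.deriv.integrable_mul hw)
  have := (h.mul hφ.isAC).integral_eq_zero (hφ.integrable_mul hw) i
  simpa only [add_comm] using this

/-- The lemma of du Bois-Reymond: a locally integrable function with a locally integrable weak
derivative agrees almost everywhere with a locally absolutely continuous one. -/
theorem exists_isAC_of_weakDeriv {w g : ℝ → ℝ} (hw : LocallyIntegrable w volume)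
    (hg : LocallyIntegrable g volume)
    (h : ∀ φ, IsTest φ → ∫ x, (w x * deriv φ x + g x * φ x) = 0) :
    ∃ w₀, w₀ =ᵐ[volume] w ∧ IsAC w₀ g := by
  obtain ⟨ρ, hρ, hρ1⟩ := IsTest.exists_integral_eq_one
  have hG := isAC_primitive hg 0
  set G : ℝ → ℝ := fun x => 0 + ∫ t in (0:ℝ)..x, g t with hGdef
  have hGl : LocallyIntegrable G volume := hG.continuous.locallyIntegrable
  have hwG : LocallyIntegrable (fun x => w x - G x) volume := hw.sub hGl
  have h1 : ∀ φ, IsTest φ → ∫ x, (w x - G x) * deriv φ x = 0 := fun φ hφ => by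
    have i1 := (hφ.deriv.integrable_mul hw).add (hφ.integrable_mul hg)
    have i2 := (hφ.deriv.integrable_mul hGl).add (hφ.integrable_mul hg)
    have := integral_sub i1 i2
    simp only [Pi.add_apply] at this
    rw [h φ hφ, hG.integral_mul_test hφ, sub_zero] at this
    rw [← this]
    congr 1; funext x; ring
  set c := ∫ x, (w x - G x) * ρ x with hc
  have h2 : ∀ ψ, IsTest ψ → ∫ x, (w x - G x - c) * ψ x = 0 := fun ψ hψ => by
    have ht := hψ.sub_smul hρ (∫ x, ψ x)
    have h0 : ∫ x, (ψ x - (∫ x, ψ x) * ρ x) = 0 := by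
      rw [integral_sub hψ.integrable (hρ.integrable.const_mul _), integral_const_mul, hρ1]; ring
    obtain ⟨φ, hφ, hφ'⟩ := ht.exists_primitive h0
    have k := h1 φ hφ
    rw [hφ'] at k
    have j1 := hψ.integrable_mul hwG
    have j2 := hρ.integrable_mul hwG
    have e : (fun x => (w x - G x) * (ψ x - (∫ x, ψ x) * ρ x)) =
        fun x => (w x - G x) * ψ x - (∫ x, ψ x) * ((w x - G x) * ρ x) := by
      funext x; ring
    rw [e, integral_sub j1 (j2.const_mul _), integral_const_mul, ← hc] at k
    have e' : (fun x => (w x - G x - c) * ψ x) = fun x => (w x - G x) * ψ x - c * ψ x := by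
      funext x; ring
    rw [e', integral_sub j1 (hψ.integrable.const_mul _), integral_const_mul]
    linarith
  have h3 : ∀ᵐ x, w x - G x - c = 0 := by
    refine ae_eq_zero_of_integral_contDiff_smul_eq_zero
      (hwG.sub (locallyIntegrable_const c)) fun ψ h1 h2' => ?_
    have := h2 ψ ⟨h1, h2'⟩
    simpa only [smul_eq_mul, mul_comm] using this
  refine ⟨fun x => c + ∫ t in (0:ℝ)..x, g t, ?_, isAC_primitive hg c⟩
  filter_upwards [h3] with x hx
  simp only [hGdef] at hx
  linarith

/-- If `v'' - v = b` with `v'` and `b` in `L²`, then `v` is in `L²`. -/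
theorem memLp_of_second_order {v q b : ℝ → ℝ} (hv : IsAC v q) (hq : IsAC q fun x => v x + b x)
    (hqL : MemLp q 2 volume) (hbL : MemLp b 2 volume) : MemLp v 2 volume := by
  have hvc := hv.continuous
  have hqc := hq.continuous
  set T := ∫ x, q x ^ 2 with hT
  -- `v` grows at most linearly since `v' = q` is square integrable; this makes the weighted
  -- integrals below finite
  have growth : ∀ x, |v x| ≤ (|v 0| + T + 1) * (1 + |x|) := fun x => by
    have h1 := hv.eq_add 0 x
    have h2 : ‖∫ t in (0:ℝ)..x, q t‖ ≤ |∫ t in (0:ℝ)..x, (1 + q t ^ 2)| := by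
      refine (intervalIntegral.norm_integral_le_abs_integral_norm).trans ?_
      rw [intervalIntegral.abs_integral_eq_abs_integral_uIoc,
        intervalIntegral.abs_integral_eq_abs_integral_uIoc,
        abs_of_nonneg (integral_nonneg fun t => norm_nonneg _),
        abs_of_nonneg (integral_nonneg fun t => by positivity)]
      refine integral_mono_of_nonneg (Eventually.of_forall fun t => norm_nonneg _) ?_
        (Eventually.of_forall fun t => ?_)
      · have : Continuous fun t => 1 + q t ^ 2 := by fun_prop
        exact this.integrableOn_uIoc
      · simp only [Real.norm_eq_abs]
        nlinarith [sq_nonneg (|q t| - 1), sq_abs (q t), abs_nonneg (q t)]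
    have h3 : |∫ t in (0:ℝ)..x, (1 + q t ^ 2)| ≤ |x| + T := by
      have i1 : IntervalIntegrable (fun t => q t ^ 2) volume 0 x :=
        (hqc.pow 2).intervalIntegrable _ _
      rw [intervalIntegral.integral_add intervalIntegrable_const i1,
        intervalIntegral.integral_const]
      simp only [sub_zero, smul_eq_mul, mul_one]
      refine (abs_add_le _ _).trans (add_le_add le_rfl ?_)
      rw [intervalIntegral.abs_integral_eq_abs_integral_uIoc,
        abs_of_nonneg (integral_nonneg fun t => sq_nonneg _)]
      exact setIntegral_le_integral hqL.integrable_sq (Eventually.of_forall fun t => sq_nonneg _)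
    have hT0 : 0 ≤ T := integral_nonneg fun t => sq_nonneg _
    rw [h1]
    rw [Real.norm_eq_abs] at h2
    refine (abs_add_le _ _).trans ?_
    nlinarith [abs_nonneg x, abs_nonneg (v 0), mul_nonneg hT0 (abs_nonneg x),
      mul_nonneg (abs_nonneg (v 0)) (abs_nonneg x)]
  -- estimates with the weight `m = 1 / (1 + ε² x²)`, uniform in `ε`
  have key : ∀ ε : ℝ, 0 < ε → ε ≤ 1 →
      Integrable (fun x => ((1 + ε ^ 2 * x ^ 2)⁻¹ * v x) ^ 2) ∧
      ∫ x, ((1 + ε ^ 2 * x ^ 2)⁻¹ * v x) ^ 2 ≤ 8 * T + 2 * ∫ x, b x ^ 2 := by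
    intro ε hε hε1
    set m : ℝ → ℝ := fun x => (1 + ε ^ 2 * x ^ 2)⁻¹ with hm
    set m' : ℝ → ℝ := fun x => -(ε ^ 2 * (2 * x)) / (1 + ε ^ 2 * x ^ 2) ^ 2 with hm'
    have pos : ∀ x : ℝ, 0 < 1 + ε ^ 2 * x ^ 2 := fun x => by positivity
    have hmd : ∀ x, HasDerivAt m (m' x) x := fun x => by
      have h1 : HasDerivAt (fun x : ℝ => 1 + ε ^ 2 * x ^ 2) (ε ^ 2 * (2 * x)) x := by
        have := ((hasDerivAt_pow 2 x).const_mul (ε ^ 2)).const_add 1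
        simpa using this
      exact h1.inv (pos x).ne'
    have hmc' : Continuous m' := by
      refine Continuous.div (by fun_prop) (by fun_prop) fun x => (pow_pos (pos x) 2).ne'
    have hm0 : ∀ x, 0 < m x := fun x => inv_pos.2 (pos x)
    have hm1 : ∀ x, m x ≤ 1 := fun x => inv_le_one_of_one_le₀ (by
      have : 0 ≤ ε ^ 2 * x ^ 2 := by positivity
      linarith)
    have hmm' : ∀ x, |m' x| ≤ m x := fun x => by
      have e : m x = (1 + ε ^ 2 * x ^ 2) / (1 + ε ^ 2 * x ^ 2) ^ 2 := by
        simp only [hm]; have := (pos x).ne'; field_simp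
      rw [e, hm', abs_div, abs_of_pos (pow_pos (pos x) 2), abs_neg]
      refine div_le_div_of_nonneg_right ?_ (pow_pos (pos x) 2).le
      rw [abs_le]
      constructor <;>
      nlinarith [sq_nonneg (ε * x - 1), sq_nonneg (ε * x + 1), sq_nonneg (x + 1), sq_nonneg (x - 1),
        sq_nonneg (ε * x - ε), sq_nonneg (ε * x + ε)]
    have mB : IsBddCont m :=
      ⟨continuous_iff_continuousAt.2 fun x => (hmd x).continuousAt, 1, fun x => by
        rw [abs_of_pos (hm0 x)]; exact hm1 x⟩
    have mB' : IsBddCont m' := ⟨hmc', 1, fun x => (hmm' x).trans (hm1 x)⟩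
    set S := |v 0| + T + 1
    have mvL : MemLp (fun x => m x * v x) 2 volume := by
      refine (memLp_two_iff_integrable_sq (mB.continuous.mul hvc).aestronglyMeasurable).2 ?_
      refine ((integrable_inv_one_add_sq).const_mul
        (2 * S ^ 2 / ε ^ 4)).mono' ((mB.continuous.mul hvc).pow 2).aestronglyMeasurable
        (Eventually.of_forall fun x => ?_)
      rw [Real.norm_of_nonneg (sq_nonneg _), Pi.mul_apply, mul_pow, ← sq_abs (v x)]
      have h1 : |v x| ^ 2 ≤ S ^ 2 * (2 * (1 + x ^ 2)) := by
        calc |v x| ^ 2 ≤ (S * (1 + |x|)) ^ 2 := pow_le_pow_left₀ (abs_nonneg _) (growth x) 2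
          _ ≤ S ^ 2 * (2 * (1 + x ^ 2)) := by
            rw [mul_pow]
            refine mul_le_mul_of_nonneg_left ?_ (sq_nonneg S)
            nlinarith [sq_nonneg (|x| - 1), sq_abs x]
      have h2 : m x ≤ (ε ^ 2)⁻¹ * (1 + x ^ 2)⁻¹ := by
        rw [← mul_inv]
        refine inv_anti₀ (by positivity) ?_
        nlinarith [hε.le]
      calc m x ^ 2 * |v x| ^ 2
          ≤ ((ε ^ 2)⁻¹ * (1 + x ^ 2)⁻¹) ^ 2 * (S ^ 2 * (2 * (1 + x ^ 2))) :=
            mul_le_mul (pow_le_pow_left₀ (hm0 x).le h2 2) h1 (sq_nonneg _) (sq_nonneg _)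
        _ = 2 * S ^ 2 / ε ^ 4 * (1 + x ^ 2)⁻¹ := by
            have : (1 + x ^ 2) ≠ 0 := by positivity
            field_simp
    have mqL := mB.memLp_mul hqL
    have mbL := mB.memLp_mul hbL
    have mqL' := mB'.memLp_mul hqL
    have mvL' : MemLp (fun x => m' x * v x) 2 volume := by
      refine mvL.mono (mB'.continuous.mul hvc).aestronglyMeasurable (Eventually.of_forall fun x => ?_)
      rw [norm_mul, norm_mul, Real.norm_eq_abs (m x), abs_of_pos (hm0 x)]
      exact mul_le_mul_of_nonneg_right (hmm' x) (norm_nonneg _)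
    have H1 : IsH1 (fun x => m x * v x) (fun x => m' x * v x + m x * q x) :=
      ⟨(IsAC.of_hasDerivAt hmd hmc').mul hv, mvL, mvL'.add mqL⟩
    have H2 : IsH1 (fun x => m x * q x) (fun x => m' x * q x + m x * (v x + b x)) :=
      ⟨(IsAC.of_hasDerivAt hmd hmc').mul hq, mqL, mqL'.add (by
        simp only [mul_add]; exact mvL.add mbL)⟩
    have ibp := H1.integral_mul H2
    have j1 := mqL.integrable_sq
    have j2 := mvL.integrable_sq
    have i1 : Integrable (fun x => (m' x * v x + m x * q x) * (m x * q x)) :=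
      H1.memLp'.integrable_mul H2.memLp
    have i2 : Integrable (fun x => (m x * v x) * (m' x * q x + m x * (v x + b x))) :=
      H1.memLp.integrable_mul H2.memLp'
    refine ⟨j2, ?_⟩
    have iq := hqL.integrable_sq
    have ib := hbL.integrable_sq
    have hs := integral_add i1 i2
    rw [ibp, neg_add_cancel] at hs
    have bd : 1 / 2 * (∫ x, (m x * v x) ^ 2) - (4 * T + ∫ x, b x ^ 2) ≤
        ∫ x, ((m' x * v x + m x * q x) * (m x * q x) +
          (m x * v x) * (m' x * q x + m x * (v x + b x))) := by
      rw [hT, ← integral_const_mul, ← integral_const_mul,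
        ← integral_add (iq.const_mul _) ib]
      have hs2 := integral_sub (j2.const_mul (1 / 2)) ((iq.const_mul 4).add ib)
      simp only [Pi.add_apply] at hs2
      rw [← hs2]
      refine integral_mono ((j2.const_mul _).sub ((iq.const_mul _).add ib)) (i1.add i2)
        fun x => ?_
      simp only
      set α := m x * v x
      have p1 : |m' x * v x * (m x * q x)| ≤ |α| * |q x| := by
        rw [abs_mul, abs_mul, abs_mul (m x) (q x), abs_mul (m x) (v x)]
        have a1 := mul_le_mul_of_nonneg_right (hmm' x) (abs_nonneg (v x))
        have a2 : |m x| * |q x| ≤ |q x| := by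
          rw [abs_of_pos (hm0 x)]; nlinarith [hm1 x, abs_nonneg (q x)]
        rw [abs_of_pos (hm0 x)] at a2 ⊢
        exact mul_le_mul a1 a2 (mul_nonneg (hm0 x).le (abs_nonneg _))
          (mul_nonneg (hm0 x).le (abs_nonneg _))
      have p2 : |α * (m' x * q x)| ≤ |α| * |q x| := by
        rw [abs_mul]
        have : |m' x * q x| ≤ |q x| := by
          rw [abs_mul]
          nlinarith [(hmm' x).trans (hm1 x), abs_nonneg (q x)]
        exact mul_le_mul_of_nonneg_left this (abs_nonneg _)
      have p3 : |α * (m x * b x)| ≤ |α| * |b x| := by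
        rw [abs_mul]
        have : |m x * b x| ≤ |b x| := by
          rw [abs_mul, abs_of_pos (hm0 x)]
          nlinarith [hm1 x, abs_nonneg (b x)]
        exact mul_le_mul_of_nonneg_left this (abs_nonneg _)
      have e : (m' x * v x + m x * q x) * (m x * q x) + α * (m' x * q x + m x * (v x + b x)) =
          m' x * v x * (m x * q x) + (m x * q x) ^ 2 + α * (m' x * q x) + α ^ 2 +
            α * (m x * b x) := by ring
      rw [e]
      have a1 := (abs_le.1 p1).1
      have a2 := (abs_le.1 p2).1
      have a3 := (abs_le.1 p3).1
      nlinarith [sq_nonneg (m x * q x), sq_nonneg (|α| / 2 - 2 * |q x|),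
        sq_nonneg (|α| / 2 - |b x|), sq_abs α, sq_abs (q x), sq_abs (b x)]
    rw [hs] at bd
    linarith
  -- let `ε → 0`
  rw [memLp_two_iff_integrable_sq hvc.aestronglyMeasurable]
  refine ⟨(hvc.pow 2).aestronglyMeasurable, ?_⟩
  set e : ℕ → ℝ := fun k => 1 / ((k : ℝ) + 1) with he
  have he0 : ∀ k, 0 < e k := fun k => by positivity
  have he1 : ∀ k, e k ≤ 1 := fun k => by
    simp only [he]; rw [div_le_one (by positivity)]; linarith [Nat.cast_nonneg (α := ℝ) k]
  have helim : Tendsto e atTop (𝓝 0) := tendsto_one_div_add_atTop_nhds_zero_nat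
  rw [hasFiniteIntegral_iff_ofReal (Eventually.of_forall fun x => sq_nonneg _)]
  refine lt_of_le_of_lt ?_ (ENNReal.ofReal_lt_top (r := 8 * T + 2 * ∫ x, b x ^ 2))
  have lim : ∀ x, Tendsto (fun k => ENNReal.ofReal (((1 + e k ^ 2 * x ^ 2)⁻¹ * v x) ^ 2)) atTop
      (𝓝 (ENNReal.ofReal (v x ^ 2))) := fun x => by
    refine (ENNReal.continuous_ofReal.tendsto _).comp ?_
    have h1 : Tendsto (fun k => 1 + e k ^ 2 * x ^ 2) atTop (𝓝 1) := by
      simpa using ((helim.pow 2).mul_const (x ^ 2)).const_add 1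
    simpa using (((h1.inv₀ one_ne_zero).mul_const (v x)).pow 2)
  calc ∫⁻ x, ENNReal.ofReal (v x ^ 2)
      = ∫⁻ x, liminf (fun k => ENNReal.ofReal (((1 + e k ^ 2 * x ^ 2)⁻¹ * v x) ^ 2)) atTop :=
        lintegral_congr fun x => (lim x).liminf_eq.symm
    _ ≤ liminf (fun k => ∫⁻ x, ENNReal.ofReal (((1 + e k ^ 2 * x ^ 2)⁻¹ * v x) ^ 2)) atTop :=
        lintegral_liminf_le' fun k => (key _ (he0 k) (he1 k)).1.1.aemeasurable.ennreal_ofReal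
    _ ≤ ENNReal.ofReal (8 * T + 2 * ∫ x, b x ^ 2) := by
        refine (liminf_le_liminf (Eventually.of_forall fun k => ?_)).trans (liminf_const _).le
        rw [← ofReal_integral_eq_lintegral_ofReal (key _ (he0 k) (he1 k)).1
          (Eventually.of_forall fun x => sq_nonneg _)]
        exact ENNReal.ofReal_le_ofReal (key _ (he0 k) (he1 k)).2

/-- An `L²` distributional solution of `-q'' + q + b' = 0` has the form `q = v'` with `v ∈ H²`
and `v'' - v = b`. -/
theorem exists_isH1_of_elliptic {q b : ℝ → ℝ} (hq : MemLp q 2 volume) (hb : MemLp b 2 volume)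
    (h : ∀ φ, IsTest φ →
      ∫ x, (-(q x * deriv (deriv φ) x) + q x * φ x - b x * deriv φ x) = 0) :
    ∃ v q₀ : ℝ → ℝ, q₀ =ᵐ[volume] q ∧ IsH1 v q₀ ∧ IsH1 q₀ fun x => v x + b x := by
  obtain ⟨ρ, hρ, hρ1⟩ := IsTest.exists_integral_eq_one
  have hql := hq.locallyIntegrable_two
  have hbl := hb.locallyIntegrable_two
  -- integrate the equation once: with `p' = q` it reads `q' = p + b - c` weakly for a constant `c`,
  -- so that `v = p - c` is the potential
  have hp := isAC_primitive hql 0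
  set p : ℝ → ℝ := fun x => 0 + ∫ t in (0:ℝ)..x, q t with hpdef
  have hpl : LocallyIntegrable p volume := hp.continuous.locallyIntegrable
  have hpb : LocallyIntegrable (fun x => p x + b x) volume := hpl.add hbl
  have h1 : ∀ φ, IsTest φ → ∫ x, (q x * deriv (deriv φ) x + (p x + b x) * deriv φ x) = 0 :=
    fun φ hφ => by
      have k := hp.integral_mul_test hφ
      have k2 := h φ hφ
      have i1 := ((hφ.deriv.integrable_mul hpl).add (hφ.integrable_mul hql))
      have i2 := ((hφ.deriv.deriv.integrable_mul hql).neg.add (hφ.integrable_mul hql)).sub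
        (hφ.deriv.integrable_mul hbl)
      have := integral_sub i1 i2
      simp only [Pi.add_apply, Pi.sub_apply, Pi.neg_apply] at this
      rw [k, k2, sub_zero] at this
      rw [← this]
      congr 1; funext x; ring
  set c := ∫ x, (q x * deriv ρ x + (p x + b x) * ρ x) with hc
  have h2 : ∀ ψ, IsTest ψ → ∫ x, (q x * deriv ψ x + (p x + b x - c) * ψ x) = 0 := fun ψ hψ => by
    have ht := hψ.sub_smul hρ (∫ x, ψ x)
    have h0 : ∫ x, (ψ x - (∫ x, ψ x) * ρ x) = 0 := by
      rw [integral_sub hψ.integrable (hρ.integrable.const_mul _), integral_const_mul, hρ1]; ring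
    obtain ⟨φ, hφ, hφ'⟩ := ht.exists_primitive h0
    have k := h1 φ hφ
    have hd : deriv (fun x => ψ x - (∫ x, ψ x) * ρ x) =
        fun x => deriv ψ x - (∫ x, ψ x) * deriv ρ x := by
      funext x
      exact ((hψ.differentiable x).hasDerivAt.sub
        ((hρ.differentiable x).hasDerivAt.const_mul _)).deriv
    rw [hφ', hd] at k
    have j1 := (hψ.deriv.integrable_mul hql).add (hψ.integrable_mul hpb)
    have j2 := (hρ.deriv.integrable_mul hql).add (hρ.integrable_mul hpb)
    have s1 := integral_sub j1 (j2.const_mul (∫ x, ψ x))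
    have s2 := integral_sub j1 (hψ.integrable.const_mul c)
    simp only [Pi.add_apply] at s1 s2
    rw [integral_const_mul, ← hc] at s1
    rw [integral_const_mul] at s2
    have e1 : ∫ x, (q x * deriv ψ x + (p x + b x - c) * ψ x) =
        ∫ x, (q x * deriv ψ x + (p x + b x) * ψ x - c * ψ x) := by
      congr 1; funext x; ring
    have e2 : ∫ x, (q x * deriv ψ x + (p x + b x) * ψ x -
        (∫ x, ψ x) * (q x * deriv ρ x + (p x + b x) * ρ x)) = 0 := by
      rw [← k]; congr 1; funext x; ring
    rw [e1, s2]
    rw [e2] at s1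
    linarith
  obtain ⟨q₀, hq₀, hq₀ac⟩ := exists_isAC_of_weakDeriv hql
    (hpb.sub (locallyIntegrable_const c)) h2
  have hq₀L : MemLp q₀ 2 volume := hq.ae_eq hq₀.symm
  have hvac : IsAC (fun x => p x - c) q₀ := by
    have : IsAC (fun x => p x - c) q :=
      ⟨hql, fun x y => by have := hp.sub_eq x y; linarith⟩
    exact this.congr_deriv hq₀L.locallyIntegrable_two hq₀.symm
  have hqac : IsAC q₀ fun x => p x - c + b x := by
    have e : (fun x => p x - c + b x) = fun x => p x + b x - c := by funext x; ring
    rw [e]; exact hq₀ac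
  have hvL := memLp_of_second_order hvac hqac hq₀L hb
  exact ⟨fun x => p x - c, q₀, hq₀, ⟨hvac, hvL, hq₀L⟩, ⟨hqac, hq₀L, hvL.add hb⟩⟩

/-! ### Integrated real and imaginary parts of an eigenfunction -/

theorem integral_re_im_eq_zero {G : ℝ → ℂ} {g₁ g₂ : ℝ → ℝ} (h₁ : Integrable g₁)
    (h₂ : Integrable g₂) (hG : ∀ x, G x = (g₁ x : ℂ) + (g₂ x : ℂ) * Complex.I)
    (h : ∫ x, G x = 0) : (∫ x, g₁ x = 0) ∧ ∫ x, g₂ x = 0 := by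
  have e : ∫ x, G x = ((∫ x, g₁ x : ℝ) : ℂ) + ((∫ x, g₂ x : ℝ) : ℂ) * Complex.I := by
    rw [← integral_complex_ofReal, ← integral_complex_ofReal, ← integral_mul_const,
      ← integral_add h₁.ofReal (h₂.ofReal.mul_const _)]
    exact integral_congr_ae (Eventually.of_forall hG)
  rw [h] at e
  have hr := congrArg Complex.re e
  have hi := congrArg Complex.im e
  simp at hr hi
  exact ⟨hr.symm, hi.symm⟩

section Bridge

variable {n : ℕ} {f : (Fin n → ℝ) → (Fin n → ℝ)} {g : (Fin n → ℝ) → ℝ} {L : Fin n → ℝ} {s : ℝ}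
  {U : ℝ → Fin n → ℝ} {lam : ℂ} {u : ℝ → Fin n → ℂ} {q : ℝ → ℂ}

/-- The real and imaginary parts of an `L²` eigenfunction, together with the antiderivative
`W = -((A(U) - s) u + L q) / lam` of `u` and the potential `v` of `q`, are forced modes. -/
theorem IsL2EigenSolution.exists_modes (h : IsL2EigenSolution f g L s U lam u q)
    (hlam : lam ≠ 0) (hA : ∀ i j, IsBddCont fun x => (jac f (U x) - s • 1) i j)
    (hB : ∀ j, IsBddCont fun x => grad g (U x) j) :
    ∃ (W₁ W₂ : ℝ → Fin n → ℝ) (v₁ v₂ q₁ q₂ : ℝ → ℝ),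
      q₁ =ᵐ[volume] (fun x => (q x).re) ∧ q₂ =ᵐ[volume] (fun x => (q x).im) ∧
      IsForcedMode (fun x => jac f (U x) - s • 1) (fun x => grad g (U x)) L
        (fun x => lam.re • W₁ x - lam.im • W₂ x) W₁ (fun x i => (u x i).re) v₁ q₁
        (fun x => v₁ x + grad g (U x) ⬝ᵥ (fun i => (u x i).re)) ∧
      IsForcedMode (fun x => jac f (U x) - s • 1) (fun x => grad g (U x)) L
        (fun x => lam.re • W₂ x + lam.im • W₁ x) W₂ (fun x i => (u x i).im) v₂ q₂
        (fun x => v₂ x + grad g (U x) ⬝ᵥ (fun i => (u x i).im)) := by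
  set a := lam.re with ha
  set b := lam.im with hb
  set u₁ : ℝ → Fin n → ℝ := fun x i => (u x i).re with hu₁
  set u₂ : ℝ → Fin n → ℝ := fun x i => (u x i).im with hu₂
  set p₁ : ℝ → ℝ := fun x => (q x).re with hp₁
  set p₂ : ℝ → ℝ := fun x => (q x).im with hp₂
  set A : ℝ → Matrix (Fin n) (Fin n) ℝ := fun x => jac f (U x) - s • 1 with hAdef
  have hu : ∀ i, MemLp (fun x => u x i) 2 volume := fun i =>
    (ContinuousLinearMap.proj (R := ℂ) (φ := fun _ : Fin n => ℂ) i).comp_memLp' h.memLp_u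
  have hu₁L : ∀ i, MemLp (fun x => u₁ x i) 2 volume := fun i =>
    Complex.reCLM.comp_memLp' (hu i)
  have hu₂L : ∀ i, MemLp (fun x => u₂ x i) 2 volume := fun i =>
    Complex.imCLM.comp_memLp' (hu i)
  have hp₁L : MemLp p₁ 2 volume := Complex.reCLM.comp_memLp' h.memLp_q
  have hp₂L : MemLp p₂ 2 volume := Complex.imCLM.comp_memLp' h.memLp_q
  -- the elliptic equation
  have hb₁ : MemLp (fun x => grad g (U x) ⬝ᵥ u₁ x) 2 volume := memLp_dotProduct hB hu₁L
  have hb₂ : MemLp (fun x => grad g (U x) ⬝ᵥ u₂ x) 2 volume := memLp_dotProduct hB hu₂L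
  have ell : ∀ φ, IsTest φ →
      (∫ x, (-(p₁ x * deriv (deriv φ) x) + p₁ x * φ x -
        (grad g (U x) ⬝ᵥ u₁ x) * deriv φ x) = 0) ∧
      ∫ x, (-(p₂ x * deriv (deriv φ) x) + p₂ x * φ x -
        (grad g (U x) ⬝ᵥ u₂ x) * deriv φ x) = 0 := fun φ hφ => by
    have int : ∀ {p β : ℝ → ℝ}, MemLp p 2 volume → MemLp β 2 volume →
        Integrable fun x => -(p x * deriv (deriv φ) x) + p x * φ x - β x * deriv φ x :=
      fun hp hβ => ((hφ.deriv.deriv.integrable_mul hp.locallyIntegrable_two).neg.add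
        (hφ.integrable_mul hp.locallyIntegrable_two)).sub
        (hφ.deriv.integrable_mul hβ.locallyIntegrable_two)
    refine integral_re_im_eq_zero (int hp₁L hb₁) (int hp₂L hb₂) (fun x => ?_)
      (h.eq_q φ hφ.contDiff hφ.compact)
    apply Complex.ext <;> simp [hu₁, hu₂, hp₁, hp₂, dotProduct]
  obtain ⟨v₁, q₁, hq₁, hv₁, hr₁⟩ := exists_isH1_of_elliptic hp₁L hb₁ fun φ hφ => (ell φ hφ).1
  obtain ⟨v₂, q₂, hq₂, hv₂, hr₂⟩ := exists_isH1_of_elliptic hp₂L hb₂ fun φ hφ => (ell φ hφ).2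
  -- the transport equation
  have hw₁ : ∀ i, MemLp (fun x => (A x *ᵥ u₁ x) i + L i * p₁ x) 2 volume := fun i =>
    (memLp_mulVec hA hu₁L i).add (hp₁L.const_mul _)
  have hw₂ : ∀ i, MemLp (fun x => (A x *ᵥ u₂ x) i + L i * p₂ x) 2 volume := fun i =>
    (memLp_mulVec hA hu₂L i).add (hp₂L.const_mul _)
  have hg₁ : ∀ i, MemLp (fun x => -(a * u₁ x i - b * u₂ x i)) 2 volume := fun i =>
    (((hu₁L i).const_mul a).sub ((hu₂L i).const_mul b)).neg
  have hg₂ : ∀ i, MemLp (fun x => -(a * u₂ x i + b * u₁ x i)) 2 volume := fun i =>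
    (((hu₂L i).const_mul a).add ((hu₁L i).const_mul b)).neg
  have tra : ∀ i φ, IsTest φ →
      (∫ x, (((A x *ᵥ u₁ x) i + L i * p₁ x) * deriv φ x +
        -(a * u₁ x i - b * u₂ x i) * φ x) = 0) ∧
      ∫ x, (((A x *ᵥ u₂ x) i + L i * p₂ x) * deriv φ x +
        -(a * u₂ x i + b * u₁ x i) * φ x) = 0 := fun i φ hφ => by
    have int : ∀ {p β : ℝ → ℝ}, MemLp p 2 volume → MemLp β 2 volume →
        Integrable fun x => p x * deriv φ x + β x * φ x :=
      fun hp hβ => (hφ.deriv.integrable_mul hp.locallyIntegrable_two).add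
        (hφ.integrable_mul hβ.locallyIntegrable_two)
    have h0 := h.eq_u φ hφ.contDiff hφ.compact i
    rw [← neg_eq_zero, ← integral_neg] at h0
    have hAu : ∀ (x : ℝ) (w : Fin n → ℝ),
        (A x *ᵥ w) i = (∑ j, jac f (U x) i j * w j) - s * w i := fun x w => by
      simp only [hAdef, sub_mulVec, smul_mulVec, one_mulVec, Pi.sub_apply, Pi.smul_apply,
        smul_eq_mul]
      rfl
    refine integral_re_im_eq_zero (int (hw₁ i) (hg₁ i)) (int (hw₂ i) (hg₂ i)) (fun x => ?_) h0
    rw [hAu, hAu]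
    apply Complex.ext <;>
      simp [hu₁, hu₂, hp₁, hp₂, ha, hb] <;> ring
  have hex₁ := fun i => exists_isAC_of_weakDeriv (hw₁ i).locallyIntegrable_two
    (hg₁ i).locallyIntegrable_two fun φ hφ => (tra i φ hφ).1
  have hex₂ := fun i => exists_isAC_of_weakDeriv (hw₂ i).locallyIntegrable_two
    (hg₂ i).locallyIntegrable_two fun φ hφ => (tra i φ hφ).2
  choose w₁ hw₁e hw₁ac using hex₁
  choose w₂ hw₂e hw₂ac using hex₂
  -- division of `-((A - s) u + L q)` by `lam`, in real terms; `D = |lam|²`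
  set D := a ^ 2 + b ^ 2 with hD
  have hD0 : D ≠ 0 := by
    intro h0
    have ha0 : a = 0 := by nlinarith [sq_nonneg a, sq_nonneg b]
    have hb0 : b = 0 := by nlinarith [sq_nonneg a, sq_nonneg b]
    exact hlam (Complex.ext ha0 hb0)
  have w₁L : ∀ i, MemLp (w₁ i) 2 volume := fun i => (hw₁ i).ae_eq (hw₁e i).symm
  have w₂L : ∀ i, MemLp (w₂ i) 2 volume := fun i => (hw₂ i).ae_eq (hw₂e i).symm
  have acc : ∀ (α β : ℝ) {y y' z z' t : ℝ → ℝ}, IsAC y y' → IsAC z z' →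
      (∀ x, α * y' x + β * z' x = t x) → IsAC (fun x => α * y x + β * z x) t := by
    intro α β y y' z z' t hy hz ht
    have hc : ∀ α : ℝ, IsAC (fun _ => α) fun _ => 0 := fun α =>
      IsAC.of_hasDerivAt (fun x => hasDerivAt_const x α) continuous_const
    have := ((hc α).mul hy).add ((hc β).mul hz)
    simp only [zero_mul, zero_add] at this
    rwa [funext ht] at this
  have H₁ : ∀ i, IsH1 (fun x => -(a / D) * w₁ i x + -(b / D) * w₂ i x) (fun x => u₁ x i) :=
    fun i => ⟨acc _ _ (hw₁ac i) (hw₂ac i) fun x => by field_simp; rw [hD]; ring,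
      ((w₁L i).const_mul _).add ((w₂L i).const_mul _), hu₁L i⟩
  have H₂ : ∀ i, IsH1 (fun x => -(a / D) * w₂ i x + (b / D) * w₁ i x) (fun x => u₂ x i) :=
    fun i => ⟨acc _ _ (hw₂ac i) (hw₁ac i) fun x => by field_simp; rw [hD]; ring,
      ((w₂L i).const_mul _).add ((w₁L i).const_mul _), hu₂L i⟩
  refine ⟨fun x i => -(a / D) * w₁ i x + -(b / D) * w₂ i x,
    fun x i => -(a / D) * w₂ i x + (b / D) * w₁ i x, v₁, v₂, q₁, q₂, hq₁, hq₂,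
    ⟨fun i => ?_, H₁, hv₁, hr₁, ?_, Eventually.of_forall fun x => by ring⟩,
    ⟨fun i => ?_, H₂, hv₂, hr₂, ?_, Eventually.of_forall fun x => by ring⟩⟩
  · exact ((H₁ i).memLp.const_mul a).sub ((H₂ i).memLp.const_mul b)
  · filter_upwards [eventually_countable_forall.2 hw₁e, hq₁] with x hx hq
    funext i
    simp only [Pi.add_apply, Pi.sub_apply, Pi.smul_apply, smul_eq_mul, Pi.zero_apply]
    rw [hq, hx i]
    field_simp
    rw [hD]; ring
  · exact ((H₂ i).memLp.const_mul a).add ((H₁ i).memLp.const_mul b)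
  · filter_upwards [eventually_countable_forall.2 hw₂e, hq₂] with x hx hq
    funext i
    simp only [Pi.add_apply, Pi.smul_apply, smul_eq_mul, Pi.zero_apply]
    rw [hq, hx i]
    field_simp
    rw [hD]; ring

end Bridge

/-! ### Monotonicity of the profile along the principal field -/

/-- The scalar system governing a profile: `z` is the component of `U'` along the principal field,
`a` measures the distance of the principal speed from the shock speed, `a' = γ z`, `Q' = -a z` and
`Q'' = Q + β z`.  The function `z` is not assumed to be differentiable, since the profile passes
through points where `a = 0`. -/
structure IsScalarProfile (a Q z γ β : ℝ → ℝ) (γ₁ γ₂ β₁ κ T : ℝ) : Prop where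
  ha : ∀ x, HasDerivAt a (z x * γ x) x
  hQ : ∀ x, HasDerivAt Q (-(a x * z x)) x
  hQ' : ∀ x, HasDerivAt (fun y => -(a y * z y)) (Q x + z x * β x) x
  hz : Continuous z
  γ₁_pos : 0 < γ₁
  γ_ge : ∀ x, γ₁ ≤ γ x
  γ_le : ∀ x, γ x ≤ γ₂
  β₁_pos : 0 < β₁
  β_ge : ∀ x, β₁ ≤ β x
  Q_le : ∀ x, |Q x| ≤ κ
  a_le : ∀ x, |a x| ≤ T
  Q_bot : Tendsto Q atBot (𝓝 0)
  Q_top : Tendsto Q atTop (𝓝 0)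

/-- The last point of a closed set before a given point outside it. -/
theorem exists_last_mem {S : Set ℝ} (hS : IsClosed S) {x₀ : ℝ} (hx₀ : x₀ ∉ S) :
    (∀ x ≤ x₀, x ∉ S) ∨ ∃ x₁ < x₀, x₁ ∈ S ∧ ∀ x, x₁ < x → x ≤ x₀ → x ∉ S := by
  by_cases hne : (S ∩ Set.Iic x₀).Nonempty
  · right
    have hb : BddAbove (S ∩ Set.Iic x₀) := ⟨x₀, fun x hx => hx.2⟩
    have hm := (hS.inter isClosed_Iic).csSup_mem hne hb
    refine ⟨sSup (S ∩ Set.Iic x₀), lt_of_le_of_ne hm.2 fun e => hx₀ (e ▸ hm.1), hm.1,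
      fun x hx hxx hxS => ?_⟩
    exact absurd (le_csSup hb ⟨hxS, hxx⟩) (not_le.2 hx)
  · left
    intro x hx hxS
    exact hne ⟨x, hxS, hx⟩

theorem eventually_pos_right {F : ℝ → ℝ} {F' x : ℝ} (h : HasDerivAt F F' x) (h0 : F x = 0)
    (hF' : 0 < F') : ∀ᶠ y in 𝓝[>] x, 0 < F y := by
  have := (hasDerivWithinAt_iff_tendsto_slope' (by simp)).1 (h.hasDerivWithinAt (s := Set.Ioi x))
  filter_upwards [this.eventually (lt_mem_nhds hF'), self_mem_nhdsWithin] with y hy hyx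
  rw [slope_def_field, h0, sub_zero] at hy
  have hyx' : 0 < y - x := sub_pos.2 hyx
  exact (div_pos_iff_of_pos_right hyx').1 hy

theorem eventually_neg_right {F : ℝ → ℝ} {F' x : ℝ} (h : HasDerivAt F F' x) (h0 : F x = 0)
    (hF' : F' < 0) : ∀ᶠ y in 𝓝[>] x, F y < 0 := by
  have := eventually_pos_right h.neg (by simp [h0]) (neg_pos.2 hF')
  filter_upwards [this] with y hy
  simpa using hy

namespace IsScalarProfile

variable {a Q z γ β : ℝ → ℝ} {γ₁ γ₂ β₁ κ T : ℝ}

/-- Under `x ↦ -x` the scalar system is preserved if `a` changes its sign. -/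
theorem reflect (h : IsScalarProfile a Q z γ β γ₁ γ₂ β₁ κ T) :
    IsScalarProfile (fun x => -a (-x)) (fun x => Q (-x)) (fun x => z (-x)) (fun x => γ (-x))
      (fun x => β (-x)) γ₁ γ₂ β₁ κ T where
  ha x := by
    have := ((h.ha (-x)).comp x (hasDerivAt_neg x)).fun_neg
    simpa [Function.comp_def] using this
  hQ x := by
    have := (h.hQ (-x)).comp x (hasDerivAt_neg x)
    simpa [Function.comp_def] using this
  hQ' x := by
    have := ((h.hQ' (-x)).comp x (hasDerivAt_neg x)).fun_neg
    simpa [Function.comp_def, add_comm] using this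
  hz := h.hz.comp continuous_neg
  γ₁_pos := h.γ₁_pos
  γ_ge x := h.γ_ge _
  γ_le x := h.γ_le _
  β₁_pos := h.β₁_pos
  β_ge x := h.β_ge _
  Q_le x := h.Q_le _
  a_le x := by rw [abs_neg]; exact h.a_le _
  Q_bot := h.Q_top.comp tendsto_neg_atBot_atTop
  Q_top := h.Q_bot.comp tendsto_neg_atTop_atBot

theorem continuous_a (h : IsScalarProfile a Q z γ β γ₁ γ₂ β₁ κ T) : Continuous a :=
  continuous_iff_continuousAt.2 fun x => (h.ha x).continuousAt

/-- At a sonic point the product `a z` is differentiable although `z` need not be. -/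
theorem sonic (h : IsScalarProfile a Q z γ β γ₁ γ₂ β₁ κ T) {x : ℝ} (hx : a x = 0) :
    Q x + z x * β x = -(z x ^ 2 * γ x) := by
  have h1 : HasDerivAt (fun y => -(a y * z y)) (-(z x * γ x * z x)) x := by
    refine HasDerivAt.neg ?_
    have hs := hasDerivAt_iff_tendsto_slope.1 (h.ha x)
    rw [hasDerivAt_iff_tendsto_slope]
    have hz : Tendsto z (𝓝[≠] x) (𝓝 (z x)) := (h.hz.tendsto x).mono_left nhdsWithin_le_nhds
    refine (hs.mul hz).congr fun y => ?_
    rw [slope_def_field, slope_def_field, hx]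
    ring
  rw [(h.hQ' x).unique h1]; ring

/-- The minimum principle for the radiative flux. -/
theorem Q_nonneg (h : IsScalarProfile a Q z γ β γ₁ γ₂ β₁ κ T) (x : ℝ) : 0 ≤ Q x := by
  by_contra! hx
  have hc : Continuous Q := continuous_iff_continuousAt.2 fun x => (h.hQ x).continuousAt
  obtain ⟨y, hy⟩ := hc.exists_forall_le' x (by
    rw [cocompact_eq_atBot_atTop, eventually_sup]
    exact ⟨(h.Q_bot.eventually (lt_mem_nhds hx)).mono fun _ => le_of_lt,
      (h.Q_top.eventually (lt_mem_nhds hx)).mono fun _ => le_of_lt⟩)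
  have hQy : Q y < 0 := (hy x).trans_lt hx
  have h0 : -(a y * z y) = 0 :=
    IsLocalMin.hasDerivAt_eq_zero (Eventually.of_forall fun w => hy w) (h.hQ y)
  have hneg : Q y + z y * β y < 0 := by
    by_cases hzy : z y = 0
    · rw [hzy]; simpa using hQy
    · have hay : a y = 0 := by
        rcases mul_eq_zero.1 (neg_eq_zero.1 h0) with h1 | h1
        · exact h1
        · exact absurd h1 hzy
      rw [h.sonic hay]
      have := lt_of_lt_of_le h.γ₁_pos (h.γ_ge y)
      have := mul_pos (pow_pos (abs_pos.2 hzy) 2) this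
      rw [sq_abs] at this
      linarith
  have hev := eventually_neg_right (h.hQ' y) h0 hneg
  obtain ⟨w, hw, hwlt⟩ := (mem_nhdsGT_iff_exists_Ioo_subset).1 hev
  obtain ⟨c, hc, hce⟩ := exists_hasDerivAt_eq_slope Q (fun y => -(a y * z y))
    (show y < (y + w) / 2 by have : y < w := hw; linarith) hc.continuousOn fun t _ => h.hQ t
  have hwy : y < w := hw
  have h1 := hwlt (⟨hc.1, by linarith [hc.2]⟩ : c ∈ Set.Ioo y w)
  rw [Set.mem_ofPred_eq, hce, div_lt_iff₀ (by linarith)] at h1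
  linarith [hy ((y + w) / 2)]

theorem a_sub (h : IsScalarProfile a Q z γ β γ₁ γ₂ β₁ κ T) {x y : ℝ} (hxy : x < y) :
    ∃ c ∈ Set.Ioo x y, a y - a x = z c * γ c * (y - x) := by
  obtain ⟨c, hc, e⟩ := exists_hasDerivAt_eq_slope a (fun x => z x * γ x) hxy
    h.continuous_a.continuousOn fun t _ => h.ha t
  refine ⟨c, hc, ?_⟩
  rw [e, div_mul_cancel₀ _ (sub_pos.2 hxy).ne']

/-- If `z > m > 0` at a point where `a > 0`, go back to the last point where this fails.  There
`z = m`, and `m a - a z` has a zero with positive derivative, so it is positive to the right, although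
`z > m` there.  At a sonic point or when there is no such point the equations give a contradiction
directly. -/
theorem z_nonpos_of_pos (h : IsScalarProfile a Q z γ β γ₁ γ₂ β₁ κ T) {x₀ : ℝ}
    (hx₀ : 0 < a x₀) : z x₀ ≤ 0 := by
  by_contra! hz
  obtain ⟨m, hm0, hm⟩ := exists_between hz
  have hac := h.continuous_a
  have hγ : ∀ x, 0 < γ x := fun x => lt_of_lt_of_le h.γ₁_pos (h.γ_ge x)
  have hβ : ∀ x, 0 < β x := fun x => lt_of_lt_of_le h.β₁_pos (h.β_ge x)
  have hS : IsClosed {x | a x ≤ 0 ∨ z x ≤ m} :=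
    (isClosed_le hac continuous_const).union (isClosed_le h.hz continuous_const)
  rcases exists_last_mem hS (x₀ := x₀) (by simp only [Set.mem_ofPred_eq]; push Not; exact ⟨hx₀, hm⟩)
    with hall | ⟨x₁, hx₁, hmem, hall⟩
  · -- `a` would decrease backwards at a definite rate
    have hmγ : 0 < m * γ₁ := mul_pos hm0 h.γ₁_pos
    set x := x₀ - a x₀ / (m * γ₁) with hxdef
    have hxlt : x < x₀ := by have := div_pos hx₀ hmγ; linarith
    obtain ⟨c, hc, e⟩ := h.a_sub hxlt
    have hcS := hall c hc.2.le
    have hxS := hall x hxlt.le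
    simp only [Set.mem_ofPred_eq] at hcS hxS
    push Not at hcS hxS
    have h1 : m * γ₁ ≤ z c * γ c := mul_le_mul hcS.2.le (h.γ_ge c) h.γ₁_pos.le (hm0.trans hcS.2).le
    have h2 : m * γ₁ * (x₀ - x) = a x₀ := by
      rw [hxdef, sub_sub_cancel, mul_div_cancel₀ _ hmγ.ne']
    have h3 := mul_le_mul_of_nonneg_right h1 (sub_pos.2 hxlt).le
    linarith
  · have hr : ∀ᶠ x in 𝓝[>] x₁, 0 < a x ∧ m < z x := by
      filter_upwards [Ioo_mem_nhdsGT hx₁] with x hx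
      have := hall x hx.1 hx.2.le
      simp only [Set.mem_ofPred_eq] at this
      push Not at this
      exact this
    have ha1 : 0 ≤ a x₁ := ge_of_tendsto ((hac.tendsto x₁).mono_left nhdsWithin_le_nhds)
      (hr.mono fun x hx => hx.1.le)
    have hz1 : m ≤ z x₁ := ge_of_tendsto ((h.hz.tendsto x₁).mono_left nhdsWithin_le_nhds)
      (hr.mono fun x hx => hx.2.le)
    rcases ha1.eq_or_lt with ha0 | ha0
    · have hs := h.sonic ha0.symm
      have h1 := h.Q_nonneg x₁
      have hz1' : 0 < z x₁ := hm0.trans_le hz1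
      have h2 := mul_pos hz1' (hβ x₁)
      have h3 := mul_pos (pow_pos hz1' 2) (hγ x₁)
      linarith
    · have hzm : z x₁ = m := by
        rcases hmem with h1 | h1
        · exact absurd h1 (not_le.2 ha0)
        · exact le_antisymm h1 hz1
      have hF : HasDerivAt (fun y => -(a y * z y) + m * a y)
          (Q x₁ + z x₁ * β x₁ + m * (z x₁ * γ x₁)) x₁ :=
        (h.hQ' x₁).add ((h.ha x₁).const_mul m)
      have hpos : 0 < Q x₁ + z x₁ * β x₁ + m * (z x₁ * γ x₁) := by
        rw [hzm]
        have h1 := h.Q_nonneg x₁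
        have h2 := mul_pos hm0 (hβ x₁)
        have h3 := mul_pos hm0 (mul_pos hm0 (hγ x₁))
        linarith
      obtain ⟨x, hx, hx2⟩ :=
        ((eventually_pos_right hF (by rw [hzm]; ring) hpos).and hr).exists
      nlinarith [mul_pos hx2.1 (sub_pos.2 hx2.2)]

/-- The profile is compressive: `U'` never points along the increasing direction of the principal
speed. -/
theorem z_nonpos (h : IsScalarProfile a Q z γ β γ₁ γ₂ β₁ κ T) (x : ℝ) : z x ≤ 0 := by
  rcases lt_trichotomy (a x) 0 with hx | hx | hx
  · have := h.reflect.z_nonpos_of_pos (x₀ := -x) (by simpa using hx)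
    simpa using this
  · by_contra! hz
    have hs := h.sonic hx
    have h1 := h.Q_nonneg x
    have h2 := mul_pos hz (lt_of_lt_of_le h.β₁_pos (h.β_ge x))
    have h3 := mul_pos (pow_pos hz 2) (lt_of_lt_of_le h.γ₁_pos (h.γ_ge x))
    linarith
  · exact h.z_nonpos_of_pos hx

/-- As for `z_nonpos_of_pos`, go back to the last point where `a > 0` and `z < -m` fail.  It cannot
be sonic because `a` increases towards the left as long as `z < 0`; hence `z = -m` there, and
`-a z - m a` has a zero with negative derivative. -/
theorem neg_le_z_of_pos (h : IsScalarProfile a Q z γ β γ₁ γ₂ β₁ κ T) {m : ℝ} (hm0 : 0 < m)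
    (hm : κ + m ^ 2 * γ₂ < m * β₁) {x₀ : ℝ} (hx₀ : 0 < a x₀) : -m ≤ z x₀ := by
  by_contra! hz
  have hac := h.continuous_a
  have hγ : ∀ x, 0 < γ x := fun x => lt_of_lt_of_le h.γ₁_pos (h.γ_ge x)
  have hS : IsClosed {x | a x ≤ 0 ∨ -m ≤ z x} :=
    (isClosed_le hac continuous_const).union (isClosed_le continuous_const h.hz)
  rcases exists_last_mem hS (x₀ := x₀) (by simp only [Set.mem_ofPred_eq]; push Not; exact ⟨hx₀, hz⟩)
    with hall | ⟨x₁, hx₁, hmem, hall⟩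
  · -- `a` would grow backwards without bound
    have hmγ : 0 < m * γ₁ := mul_pos hm0 h.γ₁_pos
    have hT : 0 ≤ T := (abs_nonneg _).trans (h.a_le x₀)
    set x := x₀ - (T + 1) / (m * γ₁) with hxdef
    have hxlt : x < x₀ := by
      have : 0 < (T + 1) / (m * γ₁) := div_pos (by linarith) hmγ
      linarith
    obtain ⟨c, hc, e⟩ := h.a_sub hxlt
    have hcS := hall c hc.2.le
    simp only [Set.mem_ofPred_eq] at hcS
    push Not at hcS
    have h1 : m * γ₁ ≤ -z c * γ c :=
      mul_le_mul (by linarith [hcS.2]) (h.γ_ge c) h.γ₁_pos.le (by linarith [hcS.2])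
    have h2 : m * γ₁ * (x₀ - x) = T + 1 := by
      rw [hxdef, sub_sub_cancel, mul_div_cancel₀ _ hmγ.ne']
    have h3 := mul_le_mul_of_nonneg_right h1 (sub_pos.2 hxlt).le
    have h4 := (abs_le.1 (h.a_le x)).2
    linarith
  · have hr : ∀ᶠ x in 𝓝[>] x₁, 0 < a x ∧ z x < -m := by
      filter_upwards [Ioo_mem_nhdsGT hx₁] with x hx
      have := hall x hx.1 hx.2.le
      simp only [Set.mem_ofPred_eq] at this
      push Not at this
      exact this
    have hz1 : z x₁ ≤ -m := le_of_tendsto ((h.hz.tendsto x₁).mono_left nhdsWithin_le_nhds)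
      (hr.mono fun x hx => hx.2.le)
    have ha0 : 0 < a x₁ := by
      obtain ⟨c, hc, e⟩ := h.a_sub hx₁
      have hcS := hall c hc.1 hc.2.le
      simp only [Set.mem_ofPred_eq] at hcS
      push Not at hcS
      have h1 : 0 < -z c * γ c * (x₀ - x₁) :=
        mul_pos (mul_pos (by linarith [hcS.2]) (hγ c)) (sub_pos.2 hx₁)
      linarith
    have hzm : z x₁ = -m := by
      rcases hmem with h1 | h1
      · exact absurd h1 (not_le.2 ha0)
      · exact le_antisymm hz1 h1
    have hF : HasDerivAt (fun y => -(a y * z y) - m * a y)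
        (Q x₁ + z x₁ * β x₁ - m * (z x₁ * γ x₁)) x₁ :=
      (h.hQ' x₁).sub ((h.ha x₁).const_mul m)
    have hneg : Q x₁ + z x₁ * β x₁ - m * (z x₁ * γ x₁) < 0 := by
      rw [hzm]
      have h1 := (abs_le.1 (h.Q_le x₁)).2
      have h2 := mul_le_mul_of_nonneg_left (h.β_ge x₁) hm0.le
      have h3 := mul_le_mul_of_nonneg_left (h.γ_le x₁) (sq_nonneg m)
      nlinarith
    obtain ⟨x, hx, hx2⟩ :=
      ((eventually_neg_right hF (by rw [hzm]; ring) hneg).and hr).exists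
    nlinarith [mul_pos hx2.1 (sub_pos.2 hx2.2)]

/-- The slope of the profile is small when its amplitude is.  The barrier `-m` separates the small
root from the large root of the quadratic equation that `z` satisfies at sonic points. -/
theorem neg_le_z (h : IsScalarProfile a Q z γ β γ₁ γ₂ β₁ κ T) {m : ℝ} (hm0 : 0 < m)
    (hm : κ + m ^ 2 * γ₂ < m * β₁) (x : ℝ) : -m ≤ z x := by
  rcases lt_trichotomy (a x) 0 with hx | hx | hx
  · have := h.reflect.neg_le_z_of_pos hm0 hm (x₀ := -x) (by simpa using hx)
    simpa using this
  · -- if `z < -m` at a sonic point, then so it is at points with `a > 0` to its left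
    by_contra! hz
    have hd : HasDerivAt (fun y => a (-y)) (-(z x * γ x)) (-x) := by
      have := HasDerivAt.comp (-x) (by simpa using h.ha x) (hasDerivAt_neg (-x))
      simpa [Function.comp_def] using this
    have hpos : 0 < -(z x * γ x) := by
      have := mul_pos (show 0 < -z x by linarith) (lt_of_lt_of_le h.γ₁_pos (h.γ_ge x))
      linarith
    have h1 := eventually_pos_right hd (by simpa using hx) hpos
    have h2 : ∀ᶠ y in 𝓝[>] (-x), z (-y) < -m := by
      have : Tendsto (fun y => z (-y)) (𝓝[>] (-x)) (𝓝 (z x)) := by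
        have := (h.hz.comp continuous_neg).tendsto (-x)
        simp only [Function.comp_def, neg_neg] at this
        exact this.mono_left nhdsWithin_le_nhds
      exact this.eventually (gt_mem_nhds hz)
    obtain ⟨y, hy1, hy2⟩ := (h1.and h2).exists
    exact absurd (h.neg_le_z_of_pos hm0 hm hy1) (not_le.2 hy2)
  · exact h.neg_le_z_of_pos hm0 hm hx

end IsScalarProfile

/-! ### Quadratic forms -/

section QuadraticForms

variable {n : ℕ}

theorem sq_le_dotProduct_self (w : Fin n → ℝ) (i : Fin n) : w i ^ 2 ≤ w ⬝ᵥ w := by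
  have := Finset.single_le_sum (f := fun j => w j * w j)
    (fun j _ => mul_self_nonneg _) (Finset.mem_univ i)
  simpa only [sq, dotProduct] using this

theorem abs_form_le (E : Matrix (Fin n) (Fin n) ℝ) (w y : Fin n → ℝ) :
    |w ⬝ᵥ (E *ᵥ y)| ≤ (∑ i, ∑ j, |E i j|) * ((w ⬝ᵥ w + y ⬝ᵥ y) / 2) := by
  simp only [mulVec, dotProduct, Finset.mul_sum]
  refine (Finset.abs_sum_le_sum_abs _ _).trans ?_
  rw [Finset.sum_mul]
  refine Finset.sum_le_sum fun i _ => (Finset.abs_sum_le_sum_abs _ _).trans ?_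
  rw [Finset.sum_mul]
  refine Finset.sum_le_sum fun j _ => ?_
  rw [show w i * (E i j * y j) = E i j * (w i * y j) by ring, abs_mul]
  refine mul_le_mul_of_nonneg_left ?_ (abs_nonneg _)
  have h1 := sq_le_dotProduct_self w i
  have h2 := sq_le_dotProduct_self y j
  simp only [dotProduct] at h1 h2
  rw [abs_le]
  constructor <;> nlinarith [sq_nonneg (w i + y j), sq_nonneg (w i - y j)]

theorem dotProduct_sq_le (b w : Fin n → ℝ) : (b ⬝ᵥ w) ^ 2 ≤ (b ⬝ᵥ b) * (w ⬝ᵥ w) := by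
  simpa only [dotProduct, sq] using Finset.sum_mul_sq_le_sq_mul_sq Finset.univ b w

theorem dotProduct_mulVec_comm {M : Matrix (Fin n) (Fin n) ℝ} (hM : M.IsSymm) (w y : Fin n → ℝ) :
    (M *ᵥ w) ⬝ᵥ y = w ⬝ᵥ (M *ᵥ y) := by
  rw [dotProduct_comm, dotProduct_mulVec, ← mulVec_transpose, hM.eq, dotProduct_comm]

theorem isCompact_unit_sphere : IsCompact {w : Fin n → ℝ | w ⬝ᵥ w = 1} := by
  refine Metric.isCompact_of_isClosed_isBounded ?_ ?_
  · refine isClosed_eq ?_ continuous_const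
    unfold dotProduct; fun_prop
  · refine (Metric.isBounded_closedBall (x := (0 : Fin n → ℝ)) (r := 1)).subset fun w hw => ?_
    rw [mem_closedBall_zero_iff, pi_norm_le_iff_of_nonneg zero_le_one]
    intro i
    have := sq_le_dotProduct_self w i
    rw [Set.mem_ofPred_eq] at hw
    rw [hw] at this
    rw [Real.norm_eq_abs]
    exact (sq_le_one_iff_abs_le_one _).1 this

theorem dotProduct_self_pos {w : Fin n → ℝ} (hw : w ≠ 0) : 0 < w ⬝ᵥ w :=
  lt_of_le_of_ne (Finset.sum_nonneg fun _ _ => mul_self_nonneg _)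
    fun h => hw (dotProduct_self_eq_zero.1 h.symm)

theorem exists_lower_bound_of_unit_sphere {φ : (Fin n → ℝ) → ℝ}
    (hhom : ∀ (t : ℝ) w, φ (t • w) = t ^ 2 * φ w) {c : ℝ}
    (hpos : ∀ w, w ⬝ᵥ w = 1 → c ≤ φ w) (w : Fin n → ℝ) : c * (w ⬝ᵥ w) ≤ φ w := by
  rcases eq_or_ne w 0 with rfl | hw
  · have h0 := hhom 0 0
    rw [smul_zero] at h0
    rw [h0, dotProduct_zero]
    simp
  have hp := dotProduct_self_pos hw
  have hs : 0 < √(w ⬝ᵥ w) := Real.sqrt_pos.2 hp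
  have h1 := hpos ((√(w ⬝ᵥ w))⁻¹ • w) (by
    rw [smul_dotProduct, dotProduct_smul, smul_eq_mul, smul_eq_mul, ← mul_assoc, ← mul_inv,
      Real.mul_self_sqrt hp.le, inv_mul_cancel₀ hp.ne'])
  rw [hhom, inv_pow, Real.sq_sqrt hp.le, inv_mul_eq_div, le_div_iff₀ hp] at h1
  exact h1

theorem exists_coercive {φ : (Fin n → ℝ) → ℝ} (hc : Continuous φ)
    (hhom : ∀ (t : ℝ) w, φ (t • w) = t ^ 2 * φ w) (hpos : ∀ w, w ≠ 0 → 0 < φ w) :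
    ∃ c > (0 : ℝ), ∀ w, c * (w ⬝ᵥ w) ≤ φ w := by
  rcases Set.eq_empty_or_nonempty {w : Fin n → ℝ | w ⬝ᵥ w = 1} with he | hne
  · refine ⟨1, one_pos, exists_lower_bound_of_unit_sphere hhom fun w hw => ?_⟩
    exact absurd (show w ∈ {w : Fin n → ℝ | w ⬝ᵥ w = 1} from hw) (by simp [he])
  · obtain ⟨w₀, hw₀, hmin⟩ := isCompact_unit_sphere.exists_isMinOn hne hc.continuousOn
    have h0 : w₀ ≠ 0 := by
      rintro rfl
      simp at hw₀
    exact ⟨φ w₀, hpos w₀ h0, exists_lower_bound_of_unit_sphere hhom fun w hw => hmin hw⟩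

/-- Finsler's lemma: a form that is positive on the null vectors of a nonnegative form becomes
positive definite after adding a large multiple of the latter. -/
theorem exists_add_mul_coercive {φ ψ : (Fin n → ℝ) → ℝ} (hφ : Continuous φ) (hψ : Continuous ψ)
    (hφh : ∀ (t : ℝ) w, φ (t • w) = t ^ 2 * φ w) (hψh : ∀ (t : ℝ) w, ψ (t • w) = t ^ 2 * ψ w)
    (hψ0 : ∀ w, 0 ≤ ψ w) (hpos : ∀ w, w ≠ 0 → ψ w = 0 → 0 < φ w) :
    ∃ M > (0 : ℝ), ∃ c > (0 : ℝ), ∀ w, c * (w ⬝ᵥ w) ≤ φ w + M * ψ w := by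
  obtain ⟨N, hN⟩ := isCompact_unit_sphere (n := n) |>.elim_directed_cover
    (fun N : ℕ => {w | 0 < φ w + (N + 1) * ψ w})
    (fun N => isOpen_lt continuous_const (by fun_prop))
    (fun w hw => by
      have h0 : w ≠ 0 := by
        rintro rfl
        simp at hw
      rcases (hψ0 w).eq_or_lt with h | h
      · exact Set.mem_iUnion.2 ⟨0, by
          rw [Set.mem_ofPred_eq, ← h]; simpa using hpos w h0 h.symm⟩
      · obtain ⟨N, hN⟩ := exists_nat_gt (-φ w / ψ w)
        refine Set.mem_iUnion.2 ⟨N, ?_⟩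
        rw [Set.mem_ofPred_eq]
        rw [div_lt_iff₀ h] at hN
        nlinarith)
    (directed_of_isDirected_le fun i j hij w hw => by
      rw [Set.mem_ofPred_eq] at hw ⊢
      have := hψ0 w
      have : (i : ℝ) ≤ j := by exact_mod_cast hij
      nlinarith)
  refine ⟨N + 1, by positivity, exists_coercive (by fun_prop)
    (fun t w => by rw [hφh, hψh]; ring) fun w hw => ?_⟩
  have hp := dotProduct_self_pos hw
  have h1 : (√(w ⬝ᵥ w))⁻¹ • w ∈ {w | 0 < φ w + (N + 1) * ψ w} := hN (by
    rw [Set.mem_ofPred_eq, smul_dotProduct, dotProduct_smul, smul_eq_mul, smul_eq_mul, ← mul_assoc,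
      ← mul_inv, Real.mul_self_sqrt hp.le, inv_mul_cancel₀ hp.ne'])
  rw [Set.mem_ofPred_eq, hφh, hψh] at h1
  have h2 : 0 < ((√(w ⬝ᵥ w))⁻¹) ^ 2 := by positivity
  exact pos_of_mul_pos_right (by linarith : 0 < ((√(w ⬝ᵥ w))⁻¹) ^ 2 * (φ w + (N + 1) * ψ w)) h2.le

end QuadraticForms

/-! ### Symmetrizable matrices coupled to a rank-one term -/

section Coupled

variable {n : ℕ}

/-- `A₀` is the symmetrizer of `A` normalized by `A₀ L = B`, and no eigenvector of `A` is
annihilated by `B`. -/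
structure SymmCoupled (A : Matrix (Fin n) (Fin n) ℝ) (B L : Fin n → ℝ)
    (A₀ : Matrix (Fin n) (Fin n) ℝ) : Prop where
  posDef : A₀.PosDef
  symm : (A₀ * A).IsSymm
  mulVec_eq : A₀ *ᵥ L = B
  coupled : ∀ (μ : ℝ) (r : Fin n → ℝ), A *ᵥ r = μ • r → B ⬝ᵥ r = 0 → r = 0

theorem symm_of_posDef {A₀ : Matrix (Fin n) (Fin n) ℝ} (h : A₀.PosDef) : A₀.IsSymm := by
  have := h.isHermitian
  rwa [Matrix.IsHermitian, conjTranspose_eq_transpose_of_trivial] at this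

theorem pos_of_posDef {A₀ : Matrix (Fin n) (Fin n) ℝ} (h : A₀.PosDef) {w : Fin n → ℝ}
    (hw : w ≠ 0) : 0 < w ⬝ᵥ (A₀ *ᵥ w) := by
  simpa using h.dotProduct_mulVec_pos hw

/-- Since `A₀ L Bᵀ` is symmetric of rank one and positive semidefinite, `A₀ L` is a positive multiple
of `B`, and rescaling `A₀` gives the normalization `A₀ L = B`. -/
theorem exists_symmCoupled {A A₀ : Matrix (Fin n) (Fin n) ℝ} {B L : Fin n → ℝ}
    (h0 : A₀.PosDef) (hs : (A₀ * A).IsSymm) (hp : (A₀ * vecMulVec L B).PosSemidef)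
    (hr : (A₀ * vecMulVec L B).rank = 1)
    (hc : ∀ (μ : ℝ) (r : Fin n → ℝ), r ≠ 0 → A *ᵥ r = μ • r → vecMulVec L B *ᵥ r ≠ 0) :
    ∃ A₁, SymmCoupled A B L A₁ := by
  have hcpl : ∀ (μ : ℝ) (r : Fin n → ℝ), A *ᵥ r = μ • r → B ⬝ᵥ r = 0 → r = 0 := by
    intro μ r h hb
    by_contra hne
    refine hc μ r hne h ?_
    rw [vecMulVec_mulVec, hb]
    simp
  have hne : vecMulVec L B ≠ 0 := by
    intro h
    rw [h, mul_zero, rank_zero] at hr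
    exact zero_ne_one hr
  have hB : B ≠ 0 := by
    rintro rfl
    exact hne (by simp)
  have hL : L ≠ 0 := by
    rintro rfl
    exact hne (by simp)
  have hsym := hp.isHermitian
  rw [Matrix.IsHermitian, conjTranspose_eq_transpose_of_trivial, mul_vecMulVec] at hsym
  have hBB := dotProduct_self_pos hB
  set y := A₀ *ᵥ L with hy
  -- symmetry of the rank-one matrix `y Bᵀ` makes `y` a multiple of `B`
  have hyB : y = ((y ⬝ᵥ B) / (B ⬝ᵥ B)) • B := by
    have h := congrArg (fun M => M *ᵥ B) hsym
    simp only [transpose_vecMulVec, vecMulVec_mulVec] at h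
    simp only [op_smul_eq_smul] at h
    rw [div_eq_inv_mul, mul_smul, h, smul_smul, inv_mul_cancel₀ hBB.ne', one_smul]
  set c := (y ⬝ᵥ B) / (B ⬝ᵥ B) with hcdef
  have hcpos : 0 < c := by
    have h1 : 0 ≤ c := by
      have := hp.dotProduct_mulVec_nonneg B
      rw [mul_vecMulVec, vecMulVec_mulVec, op_smul_eq_smul, star_trivial,
        dotProduct_smul, smul_eq_mul, ← hy, dotProduct_comm B y] at this
      exact div_nonneg (nonneg_of_mul_nonneg_right this hBB) hBB.le
    refine lt_of_le_of_ne h1 fun h => ?_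
    rw [← h, zero_smul] at hyB
    have := pos_of_posDef h0 hL
    rw [← hy, hyB] at this
    simp at this
  refine ⟨c⁻¹ • A₀, h0.smul (inv_pos.2 hcpos), ?_, ?_, hcpl⟩
  · rw [smul_mul_assoc]
    exact hs.smul _
  · rw [smul_mulVec, ← hy, hyB, smul_smul, inv_mul_cancel₀ hcpos.ne', one_smul]

/-- Simultaneous diagonalization of a positive definite symmetrizer and the symmetrized matrix. -/
theorem exists_diagonalization {A A₀ : Matrix (Fin n) (Fin n) ℝ} (h0 : A₀.PosDef)
    (hs : (A₀ * A).IsSymm) :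
    ∃ (R : Matrix (Fin n) (Fin n) ℝ) (d : Fin n → ℝ), Rᵀ * A₀ * R = 1 ∧ A * R = R * diagonal d := by
  have hP : ∃ P : Matrix (Fin n) (Fin n) ℝ, Pᵀ * A₀ * P = 1 := by
    have hH := h0.isHermitian
    set V : Matrix (Fin n) (Fin n) ℝ := hH.eigenvectorUnitary.1 with hV
    have hVV : Vᵀ * V = 1 := by
      have := Unitary.coe_star_mul_self hH.eigenvectorUnitary
      simpa [star_eq_conjTranspose] using this
    have hsp : A₀ = V * diagonal hH.eigenvalues * Vᵀ := by
      have := hH.spectral_theorem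
      simpa [Unitary.conjStarAlgAut_apply, star_eq_conjTranspose, Function.comp_def] using this
    refine ⟨V * diagonal (fun i => (√(hH.eigenvalues i))⁻¹), ?_⟩
    rw [transpose_mul, diagonal_transpose]
    calc _ = diagonal (fun i => (√(hH.eigenvalues i))⁻¹) * (Vᵀ * A₀ * V) *
          diagonal (fun i => (√(hH.eigenvalues i))⁻¹) := by simp only [Matrix.mul_assoc]
      _ = diagonal (fun i => (√(hH.eigenvalues i))⁻¹) * diagonal hH.eigenvalues *
          diagonal (fun i => (√(hH.eigenvalues i))⁻¹) := by
          congr 2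
          conv_lhs => rw [hsp]
          calc _ = (Vᵀ * V) * diagonal hH.eigenvalues * (Vᵀ * V) := by
                simp only [Matrix.mul_assoc]
            _ = _ := by rw [hVV, Matrix.one_mul, Matrix.mul_one]
      _ = 1 := by
          rw [diagonal_mul_diagonal, diagonal_mul_diagonal, ← diagonal_one]
          congr 1
          funext i
          have := h0.eigenvalues_pos i
          have h2 := Real.sqrt_pos.2 this
          have h3 := Real.mul_self_sqrt this.le
          field_simp
          nlinarith
  obtain ⟨P, hP⟩ := hP
  have hPinv : P * (Pᵀ * A₀) = 1 := mul_eq_one_comm.1 hP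
  have hS : (Pᵀ * (A₀ * A) * P).IsHermitian := by
    rw [Matrix.IsHermitian, conjTranspose_eq_transpose_of_trivial]
    simp only [transpose_mul, transpose_transpose]
    rw [← transpose_mul, hs.eq]
    simp only [Matrix.mul_assoc]
  set V : Matrix (Fin n) (Fin n) ℝ := hS.eigenvectorUnitary.1 with hV
  have hVV : Vᵀ * V = 1 := by
    have := Unitary.coe_star_mul_self hS.eigenvectorUnitary
    simpa [star_eq_conjTranspose] using this
  have hsp : Pᵀ * (A₀ * A) * P = V * diagonal hS.eigenvalues * Vᵀ := by
    have := hS.spectral_theorem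
    simpa [Unitary.conjStarAlgAut_apply, star_eq_conjTranspose, Function.comp_def] using this
  refine ⟨P * V, hS.eigenvalues, ?_, ?_⟩
  · calc (P * V)ᵀ * A₀ * (P * V) = Vᵀ * (Pᵀ * A₀ * P) * V := by
          rw [transpose_mul]; simp only [Matrix.mul_assoc]
      _ = 1 := by rw [hP, Matrix.mul_one, hVV]
  · calc A * (P * V) = P * (Pᵀ * A₀) * (A * (P * V)) := by rw [hPinv, Matrix.one_mul]
      _ = P * (Pᵀ * (A₀ * A) * P) * V := by simp only [Matrix.mul_assoc]
      _ = P * (V * diagonal hS.eigenvalues * Vᵀ) * V :=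
          congrArg (fun S => P * S * V) hsp
      _ = P * V * diagonal hS.eigenvalues * (Vᵀ * V) := by simp only [Matrix.mul_assoc]
      _ = _ := by rw [hVV, Matrix.mul_one]

namespace SymmCoupled

variable {A A₀ : Matrix (Fin n) (Fin n) ℝ} {B L : Fin n → ℝ}

theorem dotProduct_symm (h : SymmCoupled A B L A₀) (w y : Fin n → ℝ) :
    (A₀ *ᵥ w) ⬝ᵥ (A *ᵥ y) = (A₀ *ᵥ (A *ᵥ w)) ⬝ᵥ y := by
  rw [mulVec_mulVec, dotProduct_mulVec_comm h.symm, ← mulVec_mulVec,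
    dotProduct_mulVec_comm (symm_of_posDef h.posDef)]

theorem dotProduct_L (h : SymmCoupled A B L A₀) (w : Fin n → ℝ) : (A₀ *ᵥ w) ⬝ᵥ L = B ⬝ᵥ w := by
  rw [dotProduct_mulVec_comm (symm_of_posDef h.posDef), h.mulVec_eq, dotProduct_comm]

/-- An eigenvector of a symmetrizable coupled matrix for `μ` is unique up to scaling. -/
theorem eq_smul (h : SymmCoupled A B L A₀) {μ : ℝ} {r w : Fin n → ℝ} (hr : A *ᵥ r = μ • r)
    (hb : B ⬝ᵥ r = 1) (hw : A *ᵥ w = μ • w) : w = (B ⬝ᵥ w) • r := by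
  rw [← sub_eq_zero]
  refine h.coupled μ _ ?_ ?_
  · rw [mulVec_sub, mulVec_smul, hr, hw, smul_sub, smul_comm]
  · rw [dotProduct_sub, dotProduct_smul, hb, smul_eq_mul, mul_one, sub_self]

/-- Uniqueness of the normalized symmetrizer, in its linear form: for every eigenvector `r` of `A` the
vector `A₀⁻¹ X r` is an eigenvector for the same eigenvalue that is annihilated by `B`. -/
theorem symmetrizer_unique (h : SymmCoupled A B L A₀) {X : Matrix (Fin n) (Fin n) ℝ}
    (h1 : X *ᵥ L = 0) (h2 : X * A = Aᵀ * X) (h3 : Xᵀ = X) : X = 0 := by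
  obtain ⟨R, d, hR, hd⟩ := exists_diagonalization h.posDef h.symm
  have hu : IsUnit A₀.det := (isUnit_iff_isUnit_det _).1 h.posDef.isUnit
  have hAA : A * A₀⁻¹ = A₀⁻¹ * Aᵀ := by
    have h4 : A₀ * A = Aᵀ * A₀ := by
      have := h.symm.eq
      rw [transpose_mul, (symm_of_posDef h.posDef).eq] at this
      exact this.symm
    calc A * A₀⁻¹ = A₀⁻¹ * (A₀ * A) * A₀⁻¹ := by
          rw [← Matrix.mul_assoc, nonsing_inv_mul _ hu, Matrix.one_mul]
      _ = A₀⁻¹ * Aᵀ * (A₀ * A₀⁻¹) := by rw [h4]; simp only [Matrix.mul_assoc]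
      _ = _ := by rw [mul_nonsing_inv _ hu, Matrix.mul_one]
  have hcol : ∀ i, X *ᵥ (R.col i) = 0 := by
    intro i
    have hAr : A *ᵥ R.col i = d i • R.col i := by
      ext k
      have := congrFun (congrFun hd k) i
      rw [mul_diagonal] at this
      simpa [mulVec, dotProduct, Matrix.mul_apply, mul_comm] using this
    have hy : A₀⁻¹ *ᵥ (X *ᵥ R.col i) = 0 := by
      refine h.coupled (d i) _ ?_ ?_
      · rw [mulVec_mulVec, hAA, ← mulVec_mulVec, mulVec_mulVec (R.col i) Aᵀ X, ← h2,
          ← mulVec_mulVec, hAr]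
        simp only [mulVec_smul]
      · rw [← h.dotProduct_L, mulVec_mulVec, mul_nonsing_inv _ hu, one_mulVec,
          dotProduct_mulVec_comm h3, h1, dotProduct_zero]
    have := congrArg (fun y => A₀ *ᵥ y) hy
    rwa [mulVec_zero, mulVec_mulVec, mul_nonsing_inv _ hu, one_mulVec] at this
  have hXR : X * R = 0 := by
    ext k i
    simpa [mulVec, dotProduct, Matrix.mul_apply] using congrFun (hcol i) k
  calc X = X * (R * (Rᵀ * A₀)) := by rw [mul_eq_one_comm.1 hR, Matrix.mul_one]
    _ = X * R * (Rᵀ * A₀) := by simp only [Matrix.mul_assoc]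
    _ = 0 := by rw [hXR, Matrix.zero_mul]

/-- Kawashima's compensating matrix: in the eigenbasis of `A` the skew matrix `K` is chosen so
that its commutator with `A` cancels the off-diagonal part of the form `(B · w)²`. -/
theorem exists_compensator (h : SymmCoupled A B L A₀) :
    ∃ K : Matrix (Fin n) (Fin n) ℝ, Kᵀ = -K ∧
      ∃ c > (0 : ℝ), ∀ w, c * (w ⬝ᵥ w) ≤ (K *ᵥ w) ⬝ᵥ (A *ᵥ w) + (B ⬝ᵥ w) ^ 2 := by
  obtain ⟨R, d, hR, hd⟩ := exists_diagonalization h.posDef h.symm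
  have hRi : R * (Rᵀ * A₀) = 1 := mul_eq_one_comm.1 hR
  have hsym := symm_of_posDef h.posDef
  set b : Fin n → ℝ := Rᵀ *ᵥ B with hbdef
  have hcol : ∀ ξ : Fin n → ℝ, Rᵀ *ᵥ (A₀ *ᵥ (R *ᵥ ξ)) = ξ := fun ξ => by
    rw [mulVec_mulVec, mulVec_mulVec, hR, one_mulVec]
  have hAR : ∀ ξ : Fin n → ℝ, A *ᵥ (R *ᵥ ξ) = R *ᵥ (fun i => d i * ξ i) := fun ξ => by
    rw [mulVec_mulVec, hd, ← mulVec_mulVec, funext (mulVec_diagonal d ξ)]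
  have hBR : ∀ ξ : Fin n → ℝ, B ⬝ᵥ (R *ᵥ ξ) = b ⬝ᵥ ξ := fun ξ => by
    rw [hbdef, dotProduct_mulVec, mulVec_transpose]
  have hinj : ∀ ξ : Fin n → ℝ, R *ᵥ ξ = 0 → ξ = 0 := fun ξ hξ => by
    rw [← hcol ξ, hξ, mulVec_zero, mulVec_zero]
  -- by the coupling condition the coordinates of `B` in the eigenbasis do not vanish and all
  -- eigenvalues are simple
  have hb : ∀ i, b i ≠ 0 := by
    intro i hi
    have : (Pi.single i 1 : Fin n → ℝ) = 0 := hinj _ <| h.coupled (d i) _ (by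
      rw [hAR, ← mulVec_smul]
      congr 1
      funext k
      by_cases hk : k = i
      · subst hk; simp
      · simp [hk]) (by rw [hBR]; simp [hi])
    simpa using congrFun this i
  have hdist : ∀ i j, i ≠ j → d i ≠ d j := by
    intro i j hij hdij
    have : (Pi.single i (b j) - Pi.single j (b i) : Fin n → ℝ) = 0 := hinj _ <|
      h.coupled (d i) _ (by
        rw [hAR, ← mulVec_smul]
        congr 1
        funext k
        by_cases hk : k = i
        · subst hk; simp
        · by_cases hk' : k = j
          · subst hk'; simp [hdij]
          · simp [hk, hk']) (by rw [hBR, dotProduct_sub]; simp; ring)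
    have := congrFun this i
    simp [hij] at this
    exact hb j this
  -- the form `∑ S i j * d i * ξ i * ξ j` has the symmetric part
  -- `S i j * (d i - d j) / 2 = -b i * b j` off the diagonal;
  -- on the diagonal the junk value `0 / 0 = 0` is the right one
  obtain ⟨S, hS⟩ : ∃ S : Matrix (Fin n) (Fin n) ℝ,
      ∀ i j, S i j = -2 * b i * b j / (d i - d j) := ⟨of fun i j => _, fun i j => rfl⟩
  have hSs : Sᵀ = -S := by
    ext i j
    rw [transpose_apply, Matrix.neg_apply, hS, hS, ← neg_sub (d i) (d j), div_neg]
    ring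
  refine ⟨A₀ * R * S * (Rᵀ * A₀), ?_, ?_⟩
  · simp only [transpose_mul, transpose_transpose, hsym.eq, hSs]
    simp only [Matrix.mul_assoc, Matrix.neg_mul, Matrix.mul_neg]
  refine exists_coercive (by fun_prop) (fun t w => ?_) fun w hw => ?_
  · simp only [mulVec_smul, dotProduct_smul, smul_dotProduct, smul_eq_mul]
    ring
  obtain ⟨ξ, hξ⟩ : ∃ ξ, ξ = (Rᵀ * A₀) *ᵥ w := ⟨_, rfl⟩
  have hwξ : w = R *ᵥ ξ := by rw [hξ, mulVec_mulVec, hRi, one_mulVec]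
  have hξ0 : ξ ≠ 0 := by
    rintro rfl
    exact hw (by rw [hwξ, mulVec_zero])
  have e1 : ((A₀ * R * S * (Rᵀ * A₀)) *ᵥ w) ⬝ᵥ (A *ᵥ w) =
      ∑ i, ∑ j, S i j * d i * ξ i * ξ j := by
    have : ∀ y η : Fin n → ℝ, (A₀ *ᵥ (R *ᵥ y)) ⬝ᵥ (R *ᵥ η) = y ⬝ᵥ η := fun y η => by
      rw [dotProduct_mulVec, ← mulVec_transpose, hcol]
    rw [← mulVec_mulVec, ← hξ, ← mulVec_mulVec, ← mulVec_mulVec, hwξ, hAR, this]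
    simp only [mulVec, dotProduct, Finset.sum_mul]
    refine Finset.sum_congr rfl fun i _ => Finset.sum_congr rfl fun j _ => ?_
    ring
  have e2 : ∑ i, ∑ j, S i j * d i * ξ i * ξ j = ∑ i, ∑ j, -(S i j * d j * ξ i * ξ j) := by
    rw [Finset.sum_comm]
    refine Finset.sum_congr rfl fun i _ => Finset.sum_congr rfl fun j _ => ?_
    have := congrFun (congrFun hSs i) j
    rw [transpose_apply, Matrix.neg_apply] at this
    rw [this]
    ring
  have e3 : (B ⬝ᵥ w) ^ 2 = ∑ i, ∑ j, b i * b j * ξ i * ξ j := by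
    rw [hwξ, hBR, sq]
    simp only [dotProduct, Finset.sum_mul_sum]
    refine Finset.sum_congr rfl fun i _ => Finset.sum_congr rfl fun j _ => ?_
    ring
  have e4 : 2 * (((A₀ * R * S * (Rᵀ * A₀)) *ᵥ w) ⬝ᵥ (A *ᵥ w) + (B ⬝ᵥ w) ^ 2) =
      ∑ i, 2 * (b i * ξ i) ^ 2 := by
    rw [e1, e3, mul_add, two_mul (∑ i, ∑ j, S i j * d i * ξ i * ξ j)]
    nth_rewrite 2 [e2]
    rw [Finset.mul_sum, ← Finset.sum_add_distrib, ← Finset.sum_add_distrib]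
    refine Finset.sum_congr rfl fun i _ => ?_
    rw [Finset.mul_sum, ← Finset.sum_add_distrib, ← Finset.sum_add_distrib]
    rw [Finset.sum_eq_single i]
    · rw [hS]; simp; ring
    · intro j _ hj
      have := sub_ne_zero.2 (hdist i j hj.symm)
      rw [hS]
      field_simp
      ring
    · simp
  have hpos : 0 < ∑ i, 2 * (b i * ξ i) ^ 2 := by
    obtain ⟨i, hi⟩ := Function.ne_iff.1 hξ0
    refine Finset.sum_pos' (fun _ _ => by positivity) ⟨i, Finset.mem_univ _, ?_⟩
    have := mul_ne_zero (hb i) hi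
    positivity
  linarith

/-- Uniqueness for the linear system that determines the profile direction: away from a sonic
state it is uniquely solvable, and at a sonic state coupling takes the place of hyperbolicity. -/
theorem direction_unique (h : SymmCoupled A B L A₀) {μ a : ℝ} {r₀ r : Fin n → ℝ}
    (hr₀ : A *ᵥ r₀ = μ • r₀) (hb : B ⬝ᵥ r₀ = 1) (h1 : A *ᵥ r - μ • r - a • L = 0)
    (h2 : (A₀ *ᵥ r₀) ⬝ᵥ r = 0) : r = 0 ∧ a = 0 := by
  have ha : a = 0 := by
    have h3 := congrArg (fun y => (A₀ *ᵥ r₀) ⬝ᵥ y) h1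
    simp only [dotProduct_sub, dotProduct_smul, h.dotProduct_symm, hr₀, mulVec_smul,
      smul_dotProduct, h.dotProduct_L, hb, h2, smul_eq_mul, dotProduct_zero] at h3
    linarith
  subst ha
  rw [zero_smul, sub_zero, sub_eq_zero] at h1
  have h3 := h.eq_smul hr₀ hb h1
  rw [h3, dotProduct_smul, smul_eq_mul] at h2
  have h4 : r₀ ≠ 0 := by
    rintro rfl
    simp at hb
  have h5 := pos_of_posDef h.posDef h4
  rw [dotProduct_comm] at h5
  rcases mul_eq_zero.1 h2 with h6 | h6
  · exact ⟨by rw [h3, h6, zero_smul], rfl⟩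
  · exact absurd h6 h5.ne'

/-- The symmetrizer of the coupled system is also a symmetrizer of the shifted matrix. -/
theorem symm_shift (h : SymmCoupled A B L A₀) (s : ℝ) :
    (A₀ * (A - s • (1 : Matrix (Fin n) (Fin n) ℝ))).IsSymm := by
  rw [Matrix.mul_sub, Matrix.mul_smul, Matrix.mul_one]
  exact h.symm.sub ((symm_of_posDef h.posDef).smul _)

/-- If a form is positive on the eigenvector for `μ`, adding a large multiple of the square of
`A - μ` makes it positive definite. -/
theorem exists_coercive_add (h : SymmCoupled A B L A₀) {μ : ℝ} {r₀ : Fin n → ℝ}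
    (hr₀ : A *ᵥ r₀ = μ • r₀) (hb : B ⬝ᵥ r₀ = 1) {G : Matrix (Fin n) (Fin n) ℝ}
    (hG : 0 < r₀ ⬝ᵥ (G *ᵥ r₀)) :
    ∃ M > (0 : ℝ), ∃ c > (0 : ℝ), ∀ w, c * (w ⬝ᵥ w) ≤
      w ⬝ᵥ ((G + M • (A₀ * (A - μ • (1 : Matrix (Fin n) (Fin n) ℝ)) *
        (A - μ • (1 : Matrix (Fin n) (Fin n) ℝ)))) *ᵥ w) := by
  set E := A - μ • (1 : Matrix (Fin n) (Fin n) ℝ) with hE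
  have hEv : ∀ w, E *ᵥ w = A *ᵥ w - μ • w := fun w => by
    rw [hE, sub_mulVec, smul_mulVec, one_mulVec]
  have hsq : ∀ w, w ⬝ᵥ ((A₀ * E * E) *ᵥ w) = (E *ᵥ w) ⬝ᵥ (A₀ *ᵥ (E *ᵥ w)) := by
    intro w
    have hs : (A₀ * E).IsSymm := h.symm_shift μ
    rw [← mulVec_mulVec, ← dotProduct_mulVec_comm hs, dotProduct_comm, ← mulVec_mulVec]
  have hnn : ∀ y, 0 ≤ y ⬝ᵥ (A₀ *ᵥ y) := fun y => by
    rcases eq_or_ne y 0 with rfl | hy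
    · simp
    · exact (pos_of_posDef h.posDef hy).le
  obtain ⟨M, hM, c, hc, H⟩ := exists_add_mul_coercive (n := n)
    (φ := fun w => w ⬝ᵥ (G *ᵥ w)) (ψ := fun w => w ⬝ᵥ ((A₀ * E * E) *ᵥ w))
    (by fun_prop) (by fun_prop)
    (fun t w => by simp only [mulVec_smul, dotProduct_smul, smul_dotProduct, smul_eq_mul]; ring)
    (fun t w => by simp only [mulVec_smul, dotProduct_smul, smul_dotProduct, smul_eq_mul]; ring)
    (fun w => by rw [hsq]; exact hnn _) (fun w hw hz => by
      have h1 : E *ᵥ w = 0 := by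
        by_contra hne
        rw [hsq] at hz
        exact (pos_of_posDef h.posDef hne).ne' hz
      rw [hEv, sub_eq_zero] at h1
      have h2 := h.eq_smul hr₀ hb h1
      have h3 : B ⬝ᵥ w ≠ 0 := fun h0 => hw (by rw [h2, h0, zero_smul])
      rw [h2]
      simp only [mulVec_smul, dotProduct_smul, smul_dotProduct, smul_eq_mul]
      have := pow_pos (abs_pos.2 h3) 2
      rw [sq_abs] at this
      nlinarith)
  refine ⟨M, hM, c, hc, fun w => ?_⟩
  rw [add_mulVec, smul_mulVec, dotProduct_add, dotProduct_smul, smul_eq_mul]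
  exact H w

/-- A root of the characteristic polynomial has an eigenvector normalized by `B · r = 1`. -/
theorem exists_eigenvector (h : SymmCoupled A B L A₀) {μ : ℝ} (hμ : μ ∈ A.charpoly.roots) :
    ∃ r, A *ᵥ r = μ • r ∧ B ⬝ᵥ r = 1 := by
  have h1 : (scalar (Fin n) μ - A).det = 0 := by
    rw [← eval_charpoly]
    exact (Polynomial.mem_roots'.1 hμ).2
  obtain ⟨r, hr, h2⟩ := exists_mulVec_eq_zero_iff.2 h1
  have h3 : A *ᵥ r = μ • r := by
    rw [sub_mulVec, sub_eq_zero] at h2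
    rw [← h2, scalar_apply, ← smul_one_eq_diagonal, smul_mulVec, one_mulVec]
  have h4 : B ⬝ᵥ r ≠ 0 := fun h0 => hr (h.coupled μ r h3 h0)
  refine ⟨(B ⬝ᵥ r)⁻¹ • r, ?_, ?_⟩
  · rw [mulVec_smul, h3, smul_comm]
  · rw [dotProduct_smul, smul_eq_mul, inv_mul_cancel₀ h4]

end SymmCoupled

theorem StructuralAssumptions.exists_symmCoupled {𝒰 : Set (Fin n → ℝ)}
    {f : (Fin n → ℝ) → (Fin n → ℝ)} {g : (Fin n → ℝ) → ℝ} {L : Fin n → ℝ} {p : Fin n}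
    (hS : StructuralAssumptions 𝒰 f g L p) {u : Fin n → ℝ} (hu : u ∈ 𝒰) :
    ∃ A₀, SymmCoupled (jac f u) (grad g u) L A₀ := by
  obtain ⟨A₀, h0, h1, h2, h3⟩ := hS.symmetrizer u hu
  exact RadiativeShock.exists_symmCoupled h0 h1 h2 h3 (hS.genuineCoupling u hu)

theorem StructuralAssumptions.charSpeed_mem_roots {𝒰 : Set (Fin n → ℝ)}
    {f : (Fin n → ℝ) → (Fin n → ℝ)} {g : (Fin n → ℝ) → ℝ} {L : Fin n → ℝ} {p : Fin n}
    (hS : StructuralAssumptions 𝒰 f g L p) {u : Fin n → ℝ} (hu : u ∈ 𝒰) :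
    charSpeed f p u ∈ (jac f u).charpoly.roots := by
  rw [← Multiset.count_pos, hS.simple u hu]
  exact one_pos

end Coupled

/-! ### Smooth dependence of solutions of linear systems -/

section LinearSystems

theorem contDiffAt_clm {Y X Z : Type*} [NormedAddCommGroup Y] [NormedSpace ℝ Y]
    [NormedAddCommGroup X] [NormedSpace ℝ X] [FiniteDimensional ℝ X]
    [NormedAddCommGroup Z] [NormedSpace ℝ Z] {T : Y → X →L[ℝ] Z} {y₀ : Y}
    (h : ∀ x, ContDiffAt ℝ 1 (fun y => T y x) y₀) : ContDiffAt ℝ 1 T y₀ := by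
  let e₁ := ContinuousLinearEquiv.ofFinrankEq (Module.finrank_fin_fun ℝ (n := Module.finrank ℝ X)).symm
  let e₂ := (e₁.arrowCongr (1 : Z ≃L[ℝ] Z)).trans (ContinuousLinearEquiv.piRing _)
  rw [← Function.id_comp T, ← e₂.symm_comp_self]
  exact e₂.symm.contDiff.contDiffAt.comp y₀ (contDiffAt_pi.2 fun i => h _)

variable {Y X Z : Type*} [NormedAddCommGroup Y] [NormedSpace ℝ Y]
  [NormedAddCommGroup X] [NormedSpace ℝ X] [FiniteDimensional ℝ X]
  [NormedAddCommGroup Z] [NormedSpace ℝ Z] [FiniteDimensional ℝ Z]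

/-- Smooth dependence of the solution of a linear system `T y x = b y`. If `T y₀` is injective,
then so is `T y` for `y` near `y₀`, and the solutions, where they exist, form a `C¹` function; if the
system is square they do exist. -/
theorem exists_contDiffAt_solution {T : Y → X →L[ℝ] Z} {b : Y → Z} {y₀ : Y}
    (hT : ContDiffAt ℝ 1 T y₀) (hb : ContDiffAt ℝ 1 b y₀) (hinj : ∀ x, T y₀ x = 0 → x = 0) :
    ∃ ξ : Y → X, ContDiffAt ℝ 1 ξ y₀ ∧
      (∀ᶠ y in 𝓝 y₀, ∀ x, T y x = 0 → x = 0) ∧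
      (∀ᶠ y in 𝓝 y₀, ∀ x, T y x = b y → x = ξ y) ∧
      (Module.finrank ℝ X = Module.finrank ℝ Z → ∀ᶠ y in 𝓝 y₀, T y (ξ y) = b y) := by
  have hker : LinearMap.ker (T y₀ : X →ₗ[ℝ] Z) = ⊥ := LinearMap.ker_eq_bot'.2 hinj
  obtain ⟨P₀, hP₀⟩ := LinearMap.exists_leftInverse_of_injective (T y₀ : X →ₗ[ℝ] Z) hker
  set P : Z →L[ℝ] X := LinearMap.toContinuousLinearMap P₀ with hPdef
  have hP : ∀ x, P (T y₀ x) = x := LinearMap.congr_fun hP₀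
  set S : Y → X →L[ℝ] X := fun y => P.comp (T y) with hS
  have hSs : ContDiffAt ℝ 1 S y₀ := by
    have : ContDiffAt ℝ 1 (fun y => (ContinuousLinearMap.compL ℝ X Z X P) (T y)) y₀ :=
      (ContinuousLinearMap.contDiff _).contDiffAt.comp y₀ hT
    exact this
  have hS0 : S y₀ = 1 := by
    ext x
    exact hP x
  have : CompleteSpace X := FiniteDimensional.complete ℝ X
  have hunit : ∀ᶠ y in 𝓝 y₀, IsUnit (S y) := by
    refine hSs.continuousAt.eventually (Units.isOpen.mem_nhds ?_)
    rw [hS0]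
    exact isUnit_one
  have hinv : ∀ᶠ y in 𝓝 y₀, ∀ x, Ring.inverse (S y) (S y x) = x ∧ S y (Ring.inverse (S y) x) = x := by
    filter_upwards [hunit] with y hy x
    exact ⟨congrArg (fun F : X →L[ℝ] X => F x) (Ring.inverse_mul_cancel _ hy),
      congrArg (fun F : X →L[ℝ] X => F x) (Ring.mul_inverse_cancel _ hy)⟩
  refine ⟨fun y => Ring.inverse (S y) (P (b y)), ?_, ?_, ?_, ?_⟩
  · refine ContDiffAt.clm_apply ?_ (P.contDiff.contDiffAt.comp y₀ hb)
    have h1 : ContDiffAt ℝ 1 (Ring.inverse : (X →L[ℝ] X) → X →L[ℝ] X) (S y₀) := by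
      rw [hS0]
      exact contDiffAt_ringInverse ℝ (1 : (X →L[ℝ] X)ˣ)
    exact h1.comp y₀ hSs
  · filter_upwards [hinv] with y hy x hx
    rw [← (hy x).1]
    simp [hS, hx]
  · filter_upwards [hinv] with y hy x hx
    rw [← (hy x).1, ← hx]
    rfl
  · intro hfin
    have hsurj : Function.Surjective (T y₀ : X →ₗ[ℝ] Z) :=
      (LinearMap.injective_iff_surjective_of_finrank_eq_finrank hfin).1 (LinearMap.ker_eq_bot.1 hker)
    have hPinj : ∀ z z', P z = P z' → z = z' := by
      intro z z' h
      obtain ⟨x, rfl⟩ := hsurj z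
      obtain ⟨x', rfl⟩ := hsurj z'
      have h1 : x = x' := by
        rw [← hP x, ← hP x']
        exact h
      rw [h1]
    filter_upwards [hinv] with y hy
    exact hPinj _ _ (hy (P (b y))).2

end LinearSystems

/-! ### The smooth symmetrizer -/

section Coefficients

variable {n : ℕ}

theorem contDiffAt_jac {f : (Fin n → ℝ) → (Fin n → ℝ)} {u : Fin n → ℝ} (hf : ContDiffAt ℝ 2 f u)
    (i j : Fin n) : ContDiffAt ℝ 1 (fun u => jac f u i j) u := by
  have h1 : ContDiffAt ℝ 1 (fderiv ℝ f) u := hf.fderiv_right (by norm_num)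
  have h2 : ContDiffAt ℝ 1 (fun u => fderiv ℝ f u (Pi.single j 1)) u :=
    h1.clm_apply contDiffAt_const
  exact contDiffAt_pi.1 h2 i

theorem contDiffAt_grad {g : (Fin n → ℝ) → ℝ} {u : Fin n → ℝ} (hg : ContDiffAt ℝ 2 g u)
    (j : Fin n) : ContDiffAt ℝ 1 (fun u => grad g u j) u := by
  have h1 : ContDiffAt ℝ 1 (fderiv ℝ g) u := hg.fderiv_right (by norm_num)
  exact h1.clm_apply contDiffAt_const

theorem fderiv_eq_jac {f : (Fin n → ℝ) → (Fin n → ℝ)} (u v : Fin n → ℝ) :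
    fderiv ℝ f u v = jac f u *ᵥ v := by
  ext i
  have hv : v = ∑ j, v j • (Pi.single j 1 : Fin n → ℝ) := pi_eq_sum_univ' v
  conv_lhs => rw [hv]
  rw [map_sum, Finset.sum_apply]
  simp [mulVec, dotProduct, jac, mul_comm]

theorem fderiv_eq_grad {g : (Fin n → ℝ) → ℝ} (u v : Fin n → ℝ) :
    fderiv ℝ g u v = grad g u ⬝ᵥ v := by
  have hv : v = ∑ j, v j • (Pi.single j 1 : Fin n → ℝ) := pi_eq_sum_univ' v
  conv_lhs => rw [hv]
  rw [map_sum]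
  simp [dotProduct, grad, mul_comm]

/-- The linear conditions `X L = B`, `X A = Aᵀ X`, `Xᵀ = X` on a symmetrizer `X`. -/
def symmetrizerMap (L : Fin n → ℝ) (A : Matrix (Fin n) (Fin n) ℝ) :
    (Fin n → Fin n → ℝ) →L[ℝ] (Fin n → ℝ) × (Fin n → Fin n → ℝ) × (Fin n → Fin n → ℝ) :=
  LinearMap.toContinuousLinearMap
    { toFun := fun X => (of X *ᵥ L, of.symm (of X * A - Aᵀ * of X), of.symm ((of X)ᵀ - of X))
      map_add' := fun X Y => by
        rw [show of (X + Y) = of X + of Y from rfl]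
        refine Prod.ext ?_ (Prod.ext ?_ ?_)
        · exact add_mulVec (of X) (of Y) L
        · exact congrArg of.symm (show _ = (of X * A - Aᵀ * of X) + (of Y * A - Aᵀ * of Y) by
            rw [Matrix.add_mul, Matrix.mul_add]; abel)
        · exact congrArg of.symm (show _ = ((of X)ᵀ - of X) + ((of Y)ᵀ - of Y) by
            rw [transpose_add]; abel)
      map_smul' := fun c X => by
        rw [show of (c • X) = c • of X from rfl]
        refine Prod.ext ?_ (Prod.ext ?_ ?_)
        · exact smul_mulVec c (of X) L
        · exact congrArg of.symm (show _ = c • (of X * A - Aᵀ * of X) by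
            rw [smul_mul_assoc, mul_smul_comm, smul_sub])
        · exact congrArg of.symm (show _ = c • ((of X)ᵀ - of X) by
            rw [transpose_smul, smul_sub]) }

theorem symmetrizerMap_apply (L : Fin n → ℝ) (A : Matrix (Fin n) (Fin n) ℝ) (X : Fin n → Fin n → ℝ) :
    symmetrizerMap L A X =
      (of X *ᵥ L, of.symm (of X * A - Aᵀ * of X), of.symm ((of X)ᵀ - of X)) := rfl

/-- The normalized symmetrizer depends smoothly on the state. -/
theorem StructuralAssumptions.exists_smooth_symmetrizer {𝒰 : Set (Fin n → ℝ)}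
    {f : (Fin n → ℝ) → (Fin n → ℝ)} {g : (Fin n → ℝ) → ℝ} {L : Fin n → ℝ} {p : Fin n}
    (hS : StructuralAssumptions 𝒰 f g L p) {u₀ : Fin n → ℝ} (hu₀ : u₀ ∈ 𝒰) :
    ∃ A₀ : (Fin n → ℝ) → Matrix (Fin n) (Fin n) ℝ,
      (∀ i j, ContDiffAt ℝ 1 (fun u => A₀ u i j) u₀) ∧
      ∀ᶠ u in 𝓝 u₀, SymmCoupled (jac f u) (grad g u) L (A₀ u) := by
  have hnhds := hS.isOpen.mem_nhds hu₀
  have hA := contDiffAt_jac (hS.contDiff_f.contDiffAt hnhds)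
  have hB := contDiffAt_grad (hS.contDiff_g.contDiffAt hnhds)
  obtain ⟨M, hM⟩ := hS.exists_symmCoupled hu₀
  obtain ⟨ξ, h1, -, h2, -⟩ := exists_contDiffAt_solution (y₀ := u₀)
    (T := fun u => symmetrizerMap L (jac f u)) (b := fun u => (grad g u, 0, 0)) (by
      refine contDiffAt_clm fun X => ?_
      simp only [symmetrizerMap_apply]
      refine contDiffAt_const.prodMk (ContDiffAt.prodMk ?_ contDiffAt_const)
      refine contDiffAt_pi.2 fun i => contDiffAt_pi.2 fun j => ?_
      simp only [of_symm_apply, Matrix.sub_apply, Matrix.mul_apply, transpose_apply]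
      exact (ContDiffAt.sum fun k _ => contDiffAt_const.mul (hA k j)).sub
        (ContDiffAt.sum fun k _ => (hA k i).mul contDiffAt_const))
    (ContDiffAt.prodMk (contDiffAt_pi.2 hB) contDiffAt_const) (fun X hX => by
      rw [symmetrizerMap_apply] at hX
      simp only [Prod.mk_eq_zero] at hX
      obtain ⟨e1, e2, e3⟩ := hX
      exact hM.symmetrizer_unique (X := of X) e1 (sub_eq_zero.1 e2) (sub_eq_zero.1 e3))
  refine ⟨fun u => of (ξ u), fun i j => contDiffAt_pi.1 (contDiffAt_pi.1 h1 i) j, ?_⟩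
  filter_upwards [h2, hnhds] with u hu hmem
  obtain ⟨N, hN⟩ := hS.exists_symmCoupled hmem
  have : of.symm N = ξ u := by
    refine hu _ ?_
    have e : N * jac f u = (jac f u)ᵀ * N := by
      rw [← hN.symm.eq, transpose_mul, (symm_of_posDef hN.posDef).eq]
    rw [symmetrizerMap_apply, Equiv.apply_symm_apply, hN.mulVec_eq, e, sub_self,
      (symm_of_posDef hN.posDef).eq, sub_self]
    rfl
  rw [← this]
  exact hN

/-- The linear map `(r, a) ↦ ((A - s) r - a L, l · r)` whose inverse gives the profile direction. -/
def directionMap (L l : Fin n → ℝ) (A : Matrix (Fin n) (Fin n) ℝ) (s : ℝ) :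
    ((Fin n → ℝ) × ℝ) →L[ℝ] (Fin n → ℝ) × ℝ :=
  LinearMap.toContinuousLinearMap
    { toFun := fun x => (A *ᵥ x.1 - s • x.1 - x.2 • L, l ⬝ᵥ x.1)
      map_add' := fun x y => by
        refine Prod.ext ?_ ?_
        · simp only [Prod.fst_add, Prod.snd_add, mulVec_add]; module
        · simp [dotProduct_add]
      map_smul' := fun c x => by
        refine Prod.ext ?_ ?_
        · simp only [Prod.smul_fst, Prod.smul_snd, mulVec_smul, RingHom.id_apply, smul_eq_mul]
          module
        · simp }

theorem directionMap_apply (L l : Fin n → ℝ) (A : Matrix (Fin n) (Fin n) ℝ) (s : ℝ)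
    (x : (Fin n → ℝ) × ℝ) :
    directionMap L l A s x = (A *ᵥ x.1 - s • x.1 - x.2 • L, l ⬝ᵥ x.1) := rfl

end Coefficients

/-! ### Derivatives of matrix-valued functions -/

section MatrixDerivatives

variable {n : ℕ}

theorem hasDerivAt_mulVec {M : ℝ → Matrix (Fin n) (Fin n) ℝ} {M' : Matrix (Fin n) (Fin n) ℝ}
    {y : ℝ → Fin n → ℝ} {y' : Fin n → ℝ} {t : ℝ}
    (hM : ∀ i j, HasDerivAt (fun t => M t i j) (M' i j) t) (hy : HasDerivAt y y' t) :
    HasDerivAt (fun t => M t *ᵥ y t) (M' *ᵥ y t + M t *ᵥ y') t := by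
  refine hasDerivAt_pi.2 fun i => ?_
  have := HasDerivAt.fun_sum (u := Finset.univ) fun j _ => (hM i j).mul (hasDerivAt_pi.1 hy j)
  simp only [mulVec, dotProduct, Pi.add_apply]
  rw [← Finset.sum_add_distrib]
  exact this

theorem hasDerivAt_matrix_mul {M N : ℝ → Matrix (Fin n) (Fin n) ℝ}
    {M' N' : Matrix (Fin n) (Fin n) ℝ} {t : ℝ}
    (hM : ∀ i j, HasDerivAt (fun t => M t i j) (M' i j) t)
    (hN : ∀ i j, HasDerivAt (fun t => N t i j) (N' i j) t) (i j : Fin n) :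
    HasDerivAt (fun t => (M t * N t) i j) ((M' * N t + M t * N') i j) t := by
  have := HasDerivAt.fun_sum (u := Finset.univ) fun k _ => (hM i k).mul (hN k j)
  simp only [Matrix.mul_apply, Matrix.add_apply]
  rw [← Finset.sum_add_distrib]
  exact this

theorem contDiffAt_matrix_mul {Y : Type*} [NormedAddCommGroup Y] [NormedSpace ℝ Y]
    {M N : Y → Matrix (Fin n) (Fin n) ℝ} {y : Y}
    (hM : ∀ i j, ContDiffAt ℝ 1 (fun y => M y i j) y)
    (hN : ∀ i j, ContDiffAt ℝ 1 (fun y => N y i j) y) (i j : Fin n) :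
    ContDiffAt ℝ 1 (fun y => (M y * N y) i j) y := by
  simp only [Matrix.mul_apply]
  exact ContDiffAt.sum fun k _ => (hM i k).mul (hN k j)

theorem hasDerivAt_line {Y F : Type*} [NormedAddCommGroup Y] [NormedSpace ℝ Y]
    [NormedAddCommGroup F] [NormedSpace ℝ F] {φ : Y → F} {y₀ : Y}
    (h : DifferentiableAt ℝ φ y₀) (w : Y) :
    HasDerivAt (fun t : ℝ => φ (y₀ + t • w)) (fderiv ℝ φ y₀ w) 0 := by
  have h1 : HasDerivAt (fun t : ℝ => y₀ + t • w) w 0 := by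
    simpa using ((hasDerivAt_id (0 : ℝ)).smul_const w).const_add y₀
  refine HasFDerivAt.comp_hasDerivAt (0 : ℝ) ?_ h1
  simpa using h.hasFDerivAt

theorem tendsto_line {Y : Type*} [NormedAddCommGroup Y] [NormedSpace ℝ Y] (y₀ w : Y) :
    Tendsto (fun t : ℝ => y₀ + t • w) (𝓝 0) (𝓝 y₀) := by
  have : Continuous fun t : ℝ => y₀ + t • w := by fun_prop
  simpa using this.tendsto 0

end MatrixDerivatives

/-! ### The direction field of the profiles -/

section Frame

variable {n : ℕ}

/-- The matrix `A(u) - s` in the frame moving with speed `s`, at `y = (u, s)`. -/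
def shiftedJac (f : (Fin n → ℝ) → (Fin n → ℝ)) (y : (Fin n → ℝ) × ℝ) :
    Matrix (Fin n) (Fin n) ℝ :=
  jac f y.1 - y.2 • 1

theorem shiftedJac_mulVec (f : (Fin n → ℝ) → (Fin n → ℝ)) (y : (Fin n → ℝ) × ℝ) (w : Fin n → ℝ) :
    shiftedJac f y *ᵥ w = jac f y.1 *ᵥ w - y.2 • w := by
  rw [shiftedJac, sub_mulVec, smul_mulVec, one_mulVec]

theorem contDiffAt_shiftedJac {f : (Fin n → ℝ) → (Fin n → ℝ)} {y : (Fin n → ℝ) × ℝ}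
    (hf : ContDiffAt ℝ 2 f y.1) (i j : Fin n) :
    ContDiffAt ℝ 1 (fun y => shiftedJac f y i j) y := by
  simp only [shiftedJac, Matrix.sub_apply, Matrix.smul_apply, smul_eq_mul]
  exact ((contDiffAt_jac hf i j).comp y contDiffAt_fst).sub (contDiffAt_snd.mul contDiffAt_const)

/-- The profile direction field near a sonic state `y₀ = (u₀, a_p(u₀))`: along a profile of speed
`s`, `(U', -Q')` is a multiple of `(ρ, α)(U, s)`, the solution of `(A - s) ρ = α L`, `l · ρ = 1`. -/
structure IsDirectionField (f : (Fin n → ℝ) → (Fin n → ℝ)) (L l : Fin n → ℝ)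
    (y₀ : (Fin n → ℝ) × ℝ) (ρ : (Fin n → ℝ) × ℝ → Fin n → ℝ) (α : (Fin n → ℝ) × ℝ → ℝ) : Prop where
  smooth_ρ : ContDiffAt ℝ 1 ρ y₀
  smooth_α : ContDiffAt ℝ 1 α y₀
  solves : ∀ᶠ y in 𝓝 y₀, shiftedJac f y *ᵥ ρ y = α y • L ∧ l ⬝ᵥ ρ y = 1
  unique : ∀ᶠ y in 𝓝 y₀, ∀ (r : Fin n → ℝ) (a : ℝ),
    shiftedJac f y *ᵥ r = a • L → l ⬝ᵥ r = 0 → r = 0 ∧ a = 0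

/-- Existence of the direction field, normalized by the left eigenvector `l = A₀ r₀`. -/
theorem exists_directionField {f : (Fin n → ℝ) → (Fin n → ℝ)} {L B r₀ : Fin n → ℝ}
    {y₀ : (Fin n → ℝ) × ℝ} {A₀ : Matrix (Fin n) (Fin n) ℝ} (hf : ContDiffAt ℝ 2 f y₀.1)
    (h : SymmCoupled (jac f y₀.1) B L A₀) (hr : jac f y₀.1 *ᵥ r₀ = y₀.2 • r₀) (hb : B ⬝ᵥ r₀ = 1) :
    ∃ ρ α, IsDirectionField f L (A₀ *ᵥ r₀) y₀ ρ α := by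
  obtain ⟨ξ, h1, h2, -, h4⟩ := exists_contDiffAt_solution (y₀ := y₀)
    (T := fun y => directionMap L (A₀ *ᵥ r₀) (jac f y.1) y.2)
    (b := fun _ => ((0 : Fin n → ℝ), (1 : ℝ))) (by
      refine contDiffAt_clm fun x => ?_
      simp only [directionMap_apply, ← shiftedJac_mulVec]
      refine ContDiffAt.prodMk (ContDiffAt.sub ?_ contDiffAt_const) contDiffAt_const
      refine contDiffAt_pi.2 fun i => ?_
      simp only [mulVec, dotProduct]
      exact ContDiffAt.sum fun k _ => (contDiffAt_shiftedJac hf i k).mul contDiffAt_const)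
    contDiffAt_const (fun x hx => by
      rw [directionMap_apply, Prod.mk_eq_zero] at hx
      obtain ⟨e1, e2⟩ := h.direction_unique hr hb hx.1 hx.2
      exact Prod.ext e1 e2)
  refine ⟨fun y => (ξ y).1, fun y => (ξ y).2, contDiffAt_fst.comp y₀ h1,
    contDiffAt_snd.comp y₀ h1, ?_, ?_⟩
  · filter_upwards [h4 rfl] with y hy
    rw [directionMap_apply, Prod.mk.injEq, sub_eq_zero] at hy
    rw [shiftedJac_mulVec]
    exact hy
  · filter_upwards [h2] with y hy r a hr1 hr2
    have := hy (r, a) (by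
      rw [directionMap_apply, ← shiftedJac_mulVec, hr1, hr2, sub_self]
      rfl)
    exact ⟨congrArg Prod.fst this, congrArg Prod.snd this⟩

namespace IsDirectionField

variable {f : (Fin n → ℝ) → (Fin n → ℝ)} {L B r₀ : Fin n → ℝ} {y₀ : (Fin n → ℝ) × ℝ}
  {A₀ : Matrix (Fin n) (Fin n) ℝ} {ρ : (Fin n → ℝ) × ℝ → Fin n → ℝ} {α : (Fin n → ℝ) × ℝ → ℝ}

/-- At the sonic state the direction field is the eigenvector, up to a positive factor. -/
theorem eq_at (hd : IsDirectionField f L (A₀ *ᵥ r₀) y₀ ρ α)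
    (h : SymmCoupled (jac f y₀.1) B L A₀) (hr : jac f y₀.1 *ᵥ r₀ = y₀.2 • r₀) (hb : B ⬝ᵥ r₀ = 1) :
    0 < B ⬝ᵥ ρ y₀ ∧ r₀ = (B ⬝ᵥ ρ y₀)⁻¹ • ρ y₀ ∧ shiftedJac f y₀ *ᵥ ρ y₀ = 0 := by
  obtain ⟨h1, h2⟩ := hd.solves.self_of_nhds
  have hω : 0 < (A₀ *ᵥ r₀) ⬝ᵥ r₀ := by
    rw [dotProduct_comm]
    refine pos_of_posDef h.posDef ?_
    rintro rfl
    simp at hb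
  obtain ⟨e1, e2⟩ := hd.unique.self_of_nhds (ρ y₀ - ((A₀ *ᵥ r₀) ⬝ᵥ r₀)⁻¹ • r₀) (α y₀) (by
      rw [mulVec_sub, h1, mulVec_smul, shiftedJac_mulVec, hr, sub_self, smul_zero, sub_zero]) (by
      rw [dotProduct_sub, h2, dotProduct_smul, smul_eq_mul, inv_mul_cancel₀ hω.ne', sub_self])
  rw [sub_eq_zero] at e1
  have e3 : B ⬝ᵥ ρ y₀ = ((A₀ *ᵥ r₀) ⬝ᵥ r₀)⁻¹ := by
    rw [e1, dotProduct_smul, hb, smul_eq_mul, mul_one]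
  refine ⟨by rw [e3]; positivity, ?_, by rw [h1, e2, zero_smul]⟩
  rw [e3, inv_inv, e1, smul_smul, mul_inv_cancel₀ hω.ne', one_smul]

/-- The derivative of `α`, obtained by testing the derivative of `(A - s) ρ = α L` with the left
eigenvector. -/
theorem fderiv_α (hd : IsDirectionField f L (A₀ *ᵥ r₀) y₀ ρ α) (hf : ContDiffAt ℝ 2 f y₀.1)
    (h : SymmCoupled (jac f y₀.1) B L A₀) (hr : jac f y₀.1 *ᵥ r₀ = y₀.2 • r₀) (hb : B ⬝ᵥ r₀ = 1)
    (w : (Fin n → ℝ) × ℝ) :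
    (A₀ *ᵥ r₀) ⬝ᵥ ((of fun i j => fderiv ℝ (fun y => shiftedJac f y i j) y₀ w) *ᵥ ρ y₀) =
      fderiv ℝ α y₀ w := by
  have hM := fun i j => hasDerivAt_line
    ((contDiffAt_shiftedJac hf i j).differentiableAt one_ne_zero) w
  have hρ := hasDerivAt_line (hd.smooth_ρ.differentiableAt one_ne_zero) w
  have hα := hasDerivAt_line (hd.smooth_α.differentiableAt one_ne_zero) w
  have h1 := hasDerivAt_mulVec (M := fun t : ℝ => shiftedJac f (y₀ + t • w))
    (M' := of fun i j => fderiv ℝ (fun y => shiftedJac f y i j) y₀ w) hM hρ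
  have h2 := h1.congr_of_eventuallyEq (f₁ := fun t : ℝ => α (y₀ + t • w) • L) (by
    filter_upwards [(tendsto_line y₀ w).eventually hd.solves] with t ht
    exact ht.1.symm)
  have h3 := congrArg (fun y => (A₀ *ᵥ r₀) ⬝ᵥ y) (h2.unique (hα.smul_const L))
  have h4 : ∀ y, (A₀ *ᵥ r₀) ⬝ᵥ (shiftedJac f y₀ *ᵥ y) = 0 := fun y => by
    rw [shiftedJac_mulVec, dotProduct_sub, h.dotProduct_symm, hr, mulVec_smul, dotProduct_smul,
      smul_dotProduct, sub_self]
  simpa [dotProduct_add, h4, dotProduct_smul, h.dotProduct_L, hb] using h3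

/-- `α` vanishes exactly on the sonic surface `s = a(u)`, and `∂_s α = -1` there, so the derivatives
of `α` and of the characteristic speed agree. -/
theorem fderiv_charSpeed (hd : IsDirectionField f L (A₀ *ᵥ r₀) y₀ ρ α)
    (hf : ContDiffAt ℝ 2 f y₀.1) (h : SymmCoupled (jac f y₀.1) B L A₀)
    (hr : jac f y₀.1 *ᵥ r₀ = y₀.2 • r₀) (hb : B ⬝ᵥ r₀ = 1) {cs : (Fin n → ℝ) → ℝ}
    (hcs0 : cs y₀.1 = y₀.2) (hcs : DifferentiableAt ℝ cs y₀.1)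
    (heig : ∀ᶠ u in 𝓝 y₀.1, ∃ r, r ≠ 0 ∧ jac f u *ᵥ r = cs u • r) (v : Fin n → ℝ) :
    fderiv ℝ α y₀ (v, 0) = fderiv ℝ cs y₀.1 v := by
  have htend : Tendsto (fun u => (u, cs u)) (𝓝 y₀.1) (𝓝 y₀) := by
    have := continuousAt_id.prodMk hcs.continuousAt (x := y₀.1)
    rw [ContinuousAt] at this
    simpa [hcs0] using this
  have hzero : ∀ᶠ u in 𝓝 y₀.1, α (u, cs u) = 0 := by
    filter_upwards [htend.eventually hd.solves, htend.eventually hd.unique, heig] with u h1 h2 h3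
    obtain ⟨r, hr0, hr1⟩ := h3
    have h5 : shiftedJac f (u, cs u) *ᵥ r = (0 : ℝ) • L := by
      rw [shiftedJac_mulVec, hr1, sub_self, zero_smul]
    have h6 : (A₀ *ᵥ r₀) ⬝ᵥ r ≠ 0 := fun h0 => hr0 (h2 r 0 h5 h0).1
    refine (h2 (ρ (u, cs u) - ((A₀ *ᵥ r₀) ⬝ᵥ r)⁻¹ • r) _ ?_ ?_).2
    · rw [mulVec_sub, h1.1, mulVec_smul, h5, zero_smul, smul_zero, sub_zero]
    · rw [dotProduct_sub, h1.2, dotProduct_smul, smul_eq_mul, inv_mul_cancel₀ h6, sub_self]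
  have hα : HasFDerivAt α (fderiv ℝ α y₀) (y₀.1, cs y₀.1) := by
    rw [hcs0]
    exact (hd.smooth_α.differentiableAt one_ne_zero).hasFDerivAt
  have h1 := hα.comp y₀.1 ((hasFDerivAt_id y₀.1).prodMk hcs.hasFDerivAt)
  have h2 := h1.congr_of_eventuallyEq (f₁ := fun _ => (0 : ℝ)) (by
    filter_upwards [hzero] with u hu
    exact hu.symm)
  have h3 := congrArg (fun F : (Fin n → ℝ) →L[ℝ] ℝ => F v) (h2.unique (hasFDerivAt_const _ _))
  have h4 : fderiv ℝ α y₀ (0, 1) = -1 := by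
    rw [← hd.fderiv_α hf h hr hb]
    have : (of fun i j => fderiv ℝ (fun y => shiftedJac f y i j) y₀ ((0 : Fin n → ℝ), (1 : ℝ))) =
        -(1 : Matrix (Fin n) (Fin n) ℝ) := by
      ext i j
      have e := hasDerivAt_line
        ((contDiffAt_shiftedJac hf i j).differentiableAt one_ne_zero) ((0 : Fin n → ℝ), (1 : ℝ))
      refine e.unique ?_
      simp only [shiftedJac, Matrix.sub_apply, Matrix.smul_apply, smul_eq_mul, Prod.fst_add,
        Prod.snd_add, Prod.smul_fst, Prod.smul_snd, smul_zero, add_zero, mul_one]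
      simpa using (((hasDerivAt_id (0 : ℝ)).const_add y₀.2).mul_const
        ((1 : Matrix (Fin n) (Fin n) ℝ) i j)).const_sub (jac f y₀.1 i j)
    rw [this, neg_mulVec, one_mulVec, dotProduct_neg, hd.solves.self_of_nhds.2]
  have h5 : (v, fderiv ℝ cs y₀.1 v) =
      ((v, 0) : (Fin n → ℝ) × ℝ) + fderiv ℝ cs y₀.1 v • ((0, 1) : (Fin n → ℝ) × ℝ) := by
    ext <;> simp
  simp only [ContinuousLinearMap.comp_apply, ContinuousLinearMap.prod_apply,
    ContinuousLinearMap.id_apply] at h3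
  rw [h5, map_add, map_smul, h4] at h3
  simp at h3
  linarith

end IsDirectionField

end Frame

/-! ### The local frame near a sonic state -/

section LocalFrame

variable {n : ℕ}

/-- The local data used along a small profile near `y₀ = (u₀, a_p(u₀))`: a smooth symmetrizer `A₀`,
a second symmetrizer `Aw` whose product with `A - s` is strictly monotone in the direction `ρ`, and
the direction field `(ρ, α)`; `sg` is the sign of `∇a_p · ρ`. -/
structure LocalFrame (f : (Fin n → ℝ) → (Fin n → ℝ)) (g : (Fin n → ℝ) → ℝ) (L l : Fin n → ℝ)
    (y₀ : (Fin n → ℝ) × ℝ) (A₀ Aw : (Fin n → ℝ) × ℝ → Matrix (Fin n) (Fin n) ℝ)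
    (ρ : (Fin n → ℝ) × ℝ → Fin n → ℝ) (α : (Fin n → ℝ) × ℝ → ℝ) (sg : ℝ) : Prop where
  sg_eq : sg = 1 ∨ sg = -1
  direction : IsDirectionField f L l y₀ ρ α
  smooth_f : ContDiffAt ℝ 2 f y₀.1
  smooth_g : ContDiffAt ℝ 2 g y₀.1
  smooth_A₀ : ∀ i j, ContDiffAt ℝ 1 (fun y => A₀ y i j) y₀
  smooth_Aw : ∀ i j, ContDiffAt ℝ 1 (fun y => Aw y i j) y₀
  coupled : ∀ᶠ y in 𝓝 y₀, SymmCoupled (jac f y.1) (grad g y.1) L (A₀ y)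
  Aw_symm : ∀ᶠ y in 𝓝 y₀, (Aw y).IsSymm ∧ (Aw y * shiftedJac f y).IsSymm
  Aw_eq : Aw y₀ = A₀ y₀
  l_L : l ⬝ᵥ L = 1
  β_pos : 0 < grad g y₀.1 ⬝ᵥ ρ y₀
  γ_pos : 0 < sg * fderiv ℝ α y₀ (ρ y₀, 0)
  compress : ∃ c > (0 : ℝ), ∀ w, c * (w ⬝ᵥ w) ≤
    w ⬝ᵥ ((of fun i j => sg * fderiv ℝ (fun y => (Aw y * shiftedJac f y) i j) y₀ (ρ y₀, 0)) *ᵥ w)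

/-- The second symmetrizer is `Aw = A₀ - η A₀ (A - s)` with `η(u) = -sg M l · (u - u₀)`.  As
`l · ρ = 1`, the derivative of `Aw (A - s)` along `ρ` at `y₀` is that of `A₀ (A - s)` plus
`sg M A₀ (A - s)²`.  The first is positive (up to `sg`) on the eigenvector by genuine nonlinearity,
and Finsler's lemma provides `M`. -/
theorem StructuralAssumptions.exists_localFrame {𝒰 : Set (Fin n → ℝ)}
    {f : (Fin n → ℝ) → (Fin n → ℝ)} {g : (Fin n → ℝ) → ℝ} {L : Fin n → ℝ} {p : Fin n}
    (hS : StructuralAssumptions 𝒰 f g L p) {u₀ : Fin n → ℝ} (hu₀ : u₀ ∈ 𝒰) :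
    ContinuousAt (charSpeed f p) u₀ ∧
      ∃ l A₀ Aw ρ α sg, LocalFrame f g L l (u₀, charSpeed f p u₀) A₀ Aw ρ α sg := by
  have hnhds := hS.isOpen.mem_nhds hu₀
  have hf := hS.contDiff_f.contDiffAt hnhds
  have hg := hS.contDiff_g.contDiffAt hnhds
  obtain ⟨A₀, hA₀, hcpl⟩ := hS.exists_smooth_symmetrizer hu₀
  have h := hcpl.self_of_nhds
  obtain ⟨r₀, hr, hb⟩ := h.exists_eigenvector (hS.charSpeed_mem_roots hu₀)
  have hr₀ : r₀ ≠ 0 := by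
    rintro rfl
    simp at hb
  -- otherwise `fderiv` would be zero by convention, against genuine nonlinearity
  have hcs : DifferentiableAt ℝ (charSpeed f p) u₀ := by
    by_contra hnd
    exact hS.genuineNonlinearity u₀ hu₀ r₀ hr₀ hr (by
      rw [fderiv_zero_of_not_differentiableAt hnd]; rfl)
  refine ⟨hcs.continuousAt, ?_⟩
  set y₀ : (Fin n → ℝ) × ℝ := (u₀, charSpeed f p u₀) with hy₀
  set l := A₀ u₀ *ᵥ r₀ with hl
  obtain ⟨ρ, α, hd⟩ := exists_directionField (y₀ := y₀) hf h hr hb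
  obtain ⟨hβ, hrρ, hEρ⟩ := hd.eq_at h hr hb
  set w : (Fin n → ℝ) × ℝ := (ρ y₀, 0) with hw
  have hγ0 : fderiv ℝ α y₀ w ≠ 0 := by
    rw [hd.fderiv_charSpeed (cs := charSpeed f p) hf h hr hb rfl hcs (by
      filter_upwards [hnhds, hcpl] with u hu hc
      obtain ⟨r, e1, e2⟩ := hc.exists_eigenvector (hS.charSpeed_mem_roots hu)
      refine ⟨r, ?_, e1⟩
      rintro rfl
      simp at e2) (ρ y₀)]
    intro h0
    refine hS.genuineNonlinearity u₀ hu₀ r₀ hr₀ hr ?_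
    rw [hrρ, map_smul, h0, smul_zero]
  obtain ⟨sg, hsg, hsgγ⟩ : ∃ sg : ℝ, (sg = 1 ∨ sg = -1) ∧ 0 < sg * fderiv ℝ α y₀ w := by
    rcases lt_or_gt_of_ne hγ0 with h0 | h0
    · exact ⟨-1, Or.inr rfl, by linarith⟩
    · exact ⟨1, Or.inl rfl, by linarith⟩
  have hsg2 : sg * sg = 1 := by
    rcases hsg with rfl | rfl <;> norm_num
  have hJ := contDiffAt_shiftedJac (y := y₀) hf
  have hA₀' : ∀ i j, ContDiffAt ℝ 1 (fun y : (Fin n → ℝ) × ℝ => A₀ y.1 i j) y₀ := fun i j =>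
    (hA₀ i j).comp y₀ contDiffAt_fst
  have hN := contDiffAt_matrix_mul hA₀' hJ
  have hNN := contDiffAt_matrix_mul hN hJ
  -- derivatives of the symmetrized matrices in the direction of the profile
  obtain ⟨J', hJ'⟩ : ∃ J' : Matrix (Fin n) (Fin n) ℝ,
      J' = of fun i j => fderiv ℝ (fun y => shiftedJac f y i j) y₀ w := ⟨_, rfl⟩
  obtain ⟨G, hG⟩ : ∃ G : Matrix (Fin n) (Fin n) ℝ, ∀ i j,
      G i j = fderiv ℝ (fun y => (A₀ y.1 * shiftedJac f y) i j) y₀ w :=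
    ⟨of fun i j => _, fun i j => rfl⟩
  obtain ⟨A₀', hA₀d⟩ : ∃ X : Matrix (Fin n) (Fin n) ℝ, ∀ i j,
      X i j = fderiv ℝ (fun y : (Fin n → ℝ) × ℝ => A₀ y.1 i j) y₀ w :=
    ⟨of fun i j => _, fun i j => rfl⟩
  have hGeq : G = A₀' * shiftedJac f y₀ + A₀ u₀ * J' := by
    ext i j
    have e1 := hasDerivAt_matrix_mul (M := fun t : ℝ => A₀ (y₀ + t • w).1)
      (N := fun t : ℝ => shiftedJac f (y₀ + t • w)) (M' := A₀') (N' := J')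
      (fun i j => by
        rw [hA₀d]; exact hasDerivAt_line ((hA₀' i j).differentiableAt one_ne_zero) w)
      (fun i j => by
        rw [hJ']; exact hasDerivAt_line ((hJ i j).differentiableAt one_ne_zero) w) i j
    have e2 := hasDerivAt_line ((hN i j).differentiableAt one_ne_zero) w
    rw [hG, e2.unique e1]
    simp [hy₀]
  have hr₀0 : shiftedJac f y₀ *ᵥ r₀ = 0 := by
    rw [hrρ, mulVec_smul, hEρ, smul_zero]
  have hGr : 0 < r₀ ⬝ᵥ ((sg • G) *ᵥ r₀) := by
    rw [hGeq, smul_mulVec, dotProduct_smul, add_mulVec, ← mulVec_mulVec, hr₀0, mulVec_zero,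
      zero_add, ← mulVec_mulVec, ← dotProduct_mulVec_comm (symm_of_posDef h.posDef)]
    conv => enter [2, 2, 2]; rw [hrρ]
    rw [mulVec_smul, dotProduct_smul, hJ', ← hl, hd.fderiv_α hf h hr hb, smul_eq_mul, smul_eq_mul,
      mul_left_comm]
    exact mul_pos (inv_pos.2 hβ) hsgγ
  obtain ⟨M, -, c, hc, hM⟩ := h.exists_coercive_add hr hb hGr
  set η : (Fin n → ℝ) × ℝ → ℝ := fun y => -sg * M * (l ⬝ᵥ (y.1 - u₀)) with hη
  have hηs : ContDiff ℝ 1 η := by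
    simp only [hη, dotProduct]
    fun_prop
  have hη0 : η y₀ = 0 := by simp [hη, hy₀]
  have hηw : HasDerivAt (fun t : ℝ => η (y₀ + t • w)) (-sg * M) 0 := by
    have e : (fun t : ℝ => η (y₀ + t • w)) = fun t => -sg * M * t := by
      funext t
      have e1 : (y₀ + t • w).1 - u₀ = t • ρ y₀ := add_sub_cancel_left u₀ (t • ρ y₀)
      rw [hη]
      simp only [e1]
      rw [dotProduct_smul, hl, hd.solves.self_of_nhds.2, smul_eq_mul, mul_one]
    rw [e]
    simpa using (hasDerivAt_id (0 : ℝ)).const_mul (-sg * M)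
  refine ⟨l, fun y => A₀ y.1, fun y => A₀ y.1 - η y • (A₀ y.1 * shiftedJac f y), ρ, α, sg, hsg, hd,
    hf, hg, hA₀', ?_, continuous_fst.tendsto y₀ |>.eventually hcpl, ?_, ?_, ?_, hβ, hsgγ, ?_⟩
  · intro i j
    simp only [Matrix.sub_apply, Matrix.smul_apply, smul_eq_mul]
    exact (hA₀' i j).sub (hηs.contDiffAt.mul (hN i j))
  · filter_upwards [continuous_fst.tendsto y₀ |>.eventually hcpl] with y hy
    have s1 := symm_of_posDef hy.posDef
    have s2 : (A₀ y.1 * shiftedJac f y).IsSymm := hy.symm_shift y.2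
    refine ⟨s1.sub (s2.smul _), ?_⟩
    rw [Matrix.sub_mul, smul_mul_assoc]
    refine s2.sub (Matrix.IsSymm.smul ?_ _)
    rw [Matrix.IsSymm, transpose_mul, s2.eq]
    have e : (shiftedJac f y)ᵀ * A₀ y.1 = A₀ y.1 * shiftedJac f y := by
      have := s2.eq
      rwa [transpose_mul, s1.eq] at this
    rw [← Matrix.mul_assoc, e]
  · simp only [hη0, zero_smul, sub_zero]
  · rw [h.dotProduct_L, hb]
  · refine ⟨c, hc, fun w' => (hM w').trans_eq ?_⟩
    congr 2
    ext i j
    rw [of_apply]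
    have e1 : HasDerivAt (fun t : ℝ => ((A₀ (y₀ + t • w).1 - η (y₀ + t • w) •
        (A₀ (y₀ + t • w).1 * shiftedJac f (y₀ + t • w))) * shiftedJac f (y₀ + t • w)) i j)
        (G i j + sg * M * (A₀ u₀ * shiftedJac f y₀ * shiftedJac f y₀) i j) 0 := by
      simp only [Matrix.sub_mul, Matrix.sub_apply, smul_mul_assoc, Matrix.smul_apply, smul_eq_mul]
      have d1 := hasDerivAt_line ((hN i j).differentiableAt one_ne_zero) w
      have d2 := hasDerivAt_line ((hNN i j).differentiableAt one_ne_zero) w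
      rw [hG]
      refine (d1.sub (hηw.mul d2)).congr_deriv ?_
      simp only [zero_smul, add_zero, hη0]
      rw [show A₀ y₀.1 = A₀ u₀ from rfl]
      ring
    have d3 : DifferentiableAt ℝ (fun y => ((A₀ y.1 - η y • (A₀ y.1 * shiftedJac f y)) *
        shiftedJac f y) i j) y₀ := by
      simp only [Matrix.sub_mul, Matrix.sub_apply, smul_mul_assoc, Matrix.smul_apply, smul_eq_mul]
      exact ((hN i j).sub (hηs.contDiffAt.mul (hNN i j))).differentiableAt one_ne_zero
    rw [(hasDerivAt_line d3 w).unique e1, Matrix.add_apply, Matrix.smul_apply, Matrix.smul_apply,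
      smul_eq_mul, smul_eq_mul, mul_add, ← mul_assoc sg (sg * M), ← mul_assoc sg sg, hsg2, one_mul]
    rfl

end LocalFrame

/-! ### Coefficients along a slowly varying curve -/

section Regularity

variable {E : Type*} [NormedAddCommGroup E] [NormedSpace ℝ E]

/-- `Φ` is `C¹` at `y = (u, s)`, and `Φ` and its derivative in the profile direction `(ρ, 0)` are
bounded by `C` there. -/
structure IsRegularAt (ρ : E × ℝ → E) (C : ℝ) (Φ : E × ℝ → ℝ) (y : E × ℝ) : Prop where
  contDiffAt : ContDiffAt ℝ 1 Φ y
  continuousAt : ContinuousAt ρ y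
  bdd : |Φ y| ≤ C
  bdd_fderiv : |fderiv ℝ Φ y (ρ y, 0)| ≤ C

variable {ρ : E × ℝ → E} {y₀ : E × ℝ}

theorem IsRegularAt.mono {C C' : ℝ} {Φ : E × ℝ → ℝ} {y : E × ℝ} (h : IsRegularAt ρ C Φ y)
    (hC : C ≤ C') : IsRegularAt ρ C' Φ y :=
  ⟨h.1, h.2, h.3.trans hC, h.4.trans hC⟩

theorem continuousAt_fderiv_direction {Φ : E × ℝ → ℝ} (hΦ : ContDiffAt ℝ 1 Φ y₀)
    (hρ : ContinuousAt ρ y₀) : ContinuousAt (fun y => fderiv ℝ Φ y (ρ y, 0)) y₀ := by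
  have h1 : ContinuousAt (fderiv ℝ Φ) y₀ :=
    (hΦ.fderiv_right (m := 0) (by norm_num)).continuousAt
  exact h1.clm_apply (hρ.prodMk continuousAt_const)

/-- Finitely many `C¹` functions satisfy a common bound near `y₀`. -/
theorem exists_isRegularAt {ι : Type*} [Fintype ι] {Φ : ι → E × ℝ → ℝ}
    (hΦ : ∀ i, ContDiffAt ℝ 1 (Φ i) y₀) (hρ : ContDiffAt ℝ 1 ρ y₀) :
    ∃ C, ∀ᶠ y in 𝓝 y₀, ∀ i, IsRegularAt ρ C (Φ i) y := by
  refine ⟨(∑ i, (|Φ i y₀| + |fderiv ℝ (Φ i) y₀ (ρ y₀, 0)|)) + 1, eventually_all.2 fun i => ?_⟩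
  have hs := Finset.single_le_sum (f := fun i => |Φ i y₀| + |fderiv ℝ (Φ i) y₀ (ρ y₀, 0)|)
    (fun _ _ => by positivity) (Finset.mem_univ i)
  have p1 := abs_nonneg (Φ i y₀)
  have p2 := abs_nonneg (fderiv ℝ (Φ i) y₀ (ρ y₀, 0))
  have e1 := (hΦ i).continuousAt.abs.eventually_lt continuousAt_const
    (show |Φ i y₀| < (∑ i, (|Φ i y₀| + |fderiv ℝ (Φ i) y₀ (ρ y₀, 0)|)) + 1 by linarith)
  have e2 := (continuousAt_fderiv_direction (hΦ i) hρ.continuousAt).abs.eventually_lt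
    continuousAt_const (show |fderiv ℝ (Φ i) y₀ (ρ y₀, 0)| <
      (∑ i, (|Φ i y₀| + |fderiv ℝ (Φ i) y₀ (ρ y₀, 0)|)) + 1 by linarith)
  filter_upwards [e1, e2, (hΦ i).eventually (by simp), hρ.eventually (by simp)] with y h1 h2 h3 h4
  exact ⟨h3, h4.continuousAt, h1.le, h2.le⟩

/-- Composition with a curve `U' = z ρ(U, s)`. -/
theorem isBddC1_comp {C m s : ℝ} {Φ : E × ℝ → ℝ} {U : ℝ → E} {z : ℝ → ℝ}
    (hΦ : ∀ x, IsRegularAt ρ C Φ (U x, s)) (hU : ∀ x, HasDerivAt U (z x • ρ (U x, s)) x)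
    (hz : Continuous z) (hm : ∀ x, |z x| ≤ m) :
    IsBddC1 (fun x => Φ (U x, s)) (fun x => z x * fderiv ℝ Φ (U x, s) (ρ (U x, s), 0)) := by
  have hc : Continuous fun x => (U x, s) :=
    (continuous_iff_continuousAt.2 fun x => (hU x).continuousAt).prodMk continuous_const
  refine ⟨fun x => ?_, ⟨?_, C, fun x => (hΦ x).bdd⟩, ⟨hz.mul ?_, m * C, fun x => ?_⟩⟩
  · have h1 := ((hΦ x).contDiffAt.differentiableAt one_ne_zero).hasFDerivAt.comp_hasDerivAt x
      ((hU x).prodMk (hasDerivAt_const x s))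
    refine h1.congr_deriv ?_
    rw [← smul_eq_mul, ← map_smul, Prod.smul_mk, smul_zero]
  · exact continuous_iff_continuousAt.2 fun x =>
      ContinuousAt.comp (f := fun x => (U x, s)) (hΦ x).contDiffAt.continuousAt hc.continuousAt
  · exact continuous_iff_continuousAt.2 fun x =>
      ContinuousAt.comp (f := fun x => (U x, s))
        (continuousAt_fderiv_direction (hΦ x).contDiffAt (hΦ x).continuousAt) hc.continuousAt
  · rw [abs_mul]
    exact mul_le_mul (hm x) (hΦ x).bdd_fderiv (abs_nonneg _) ((abs_nonneg _).trans (hm x))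

theorem IsBddC1.abs_sub_le {k k' : ℝ → ℝ} {e : ℝ} (hk : IsBddC1 k k') (he : ∀ x, |k' x| ≤ e)
    {h : ℝ} (hh : 0 < h) (x : ℝ) : |k (x + h) - k x| ≤ e * h := by
  have := Convex.norm_image_sub_le_of_norm_hasDerivWithin_le (s := Set.univ) (x := x) (y := x + h)
    (fun y _ => (hk.hasDerivAt y).hasDerivWithinAt) (fun y _ => he y) convex_univ
    (Set.mem_univ _) (Set.mem_univ _)
  simpa [abs_of_pos hh] using this

end Regularity

/-! ### Forms with small entries -/

section EntryBounds

variable {n : ℕ}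

theorem sum_abs_entries_le {M : Matrix (Fin n) (Fin n) ℝ} {e : ℝ} (h : ∀ i j, |M i j| ≤ e) :
    ∑ i, ∑ j, |M i j| ≤ n ^ 2 * e := by
  calc ∑ i, ∑ j, |M i j| ≤ ∑ _i : Fin n, ∑ _j : Fin n, e :=
        Finset.sum_le_sum fun i _ => Finset.sum_le_sum fun j _ => h i j
    _ = n ^ 2 * e := by simp; ring

theorem dotProduct_self_le {b : Fin n → ℝ} {e : ℝ} (h : ∀ i, |b i| ≤ e) : b ⬝ᵥ b ≤ n * e ^ 2 := by
  calc b ⬝ᵥ b ≤ ∑ _i : Fin n, e ^ 2 := Finset.sum_le_sum fun i _ => by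
        rw [← sq]; exact sq_le_sq' (by linarith [(abs_le.1 (h i)).1]) (abs_le.1 (h i)).2
    _ = n * e ^ 2 := by simp

theorem form_le {M : Matrix (Fin n) (Fin n) ℝ} {e : ℝ} (h : ∀ i j, |M i j| ≤ e)
    (w y : Fin n → ℝ) : w ⬝ᵥ (M *ᵥ y) ≤ n ^ 2 * e * ((w ⬝ᵥ w + y ⬝ᵥ y) / 2) := by
  refine (le_abs_self _).trans ((abs_form_le M w y).trans ?_)
  refine mul_le_mul_of_nonneg_right (sum_abs_entries_le h) ?_
  have h1 : 0 ≤ w ⬝ᵥ w := Finset.sum_nonneg fun _ _ => mul_self_nonneg _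
  have h2 : 0 ≤ y ⬝ᵥ y := Finset.sum_nonneg fun _ _ => mul_self_nonneg _
  positivity

/-- Young's inequality. -/
theorem dotProduct_mul_le (d w : Fin n → ℝ) (t : ℝ) {c : ℝ} (hc : 0 < c) :
    (d ⬝ᵥ w) * t ≤ c / 2 * (w ⬝ᵥ w) + (d ⬝ᵥ d) * t ^ 2 / (2 * c) := by
  have h1 : 0 ≤ (w - (t / c) • d) ⬝ᵥ (w - (t / c) • d) :=
    Finset.sum_nonneg fun _ _ => mul_self_nonneg _
  simp only [sub_dotProduct, dotProduct_sub, smul_dotProduct, dotProduct_smul, smul_eq_mul] at h1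
  rw [dotProduct_comm w d] at h1
  have h2 := mul_nonneg (half_pos hc).le h1
  have h3 : c / 2 * (w ⬝ᵥ w - t / c * d ⬝ᵥ w - (t / c * d ⬝ᵥ w - t / c * (t / c * d ⬝ᵥ d))) =
      c / 2 * (w ⬝ᵥ w) + (d ⬝ᵥ d) * t ^ 2 / (2 * c) - (d ⬝ᵥ w) * t := by
    field_simp; ring
  linarith

theorem dotProduct_mul_le_of_le {b : Fin n → ℝ} {δ : ℝ} (hb : b ⬝ᵥ b ≤ δ) (w : Fin n → ℝ) (t : ℝ) :
    (b ⬝ᵥ w) * t ≤ δ * (w ⬝ᵥ w) + t ^ 2 / 4 := by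
  have h1 := dotProduct_sq_le b w
  have h2 : (b ⬝ᵥ b) * (w ⬝ᵥ w) ≤ δ * (w ⬝ᵥ w) :=
    mul_le_mul_of_nonneg_right hb (Finset.sum_nonneg fun _ _ => mul_self_nonneg _)
  nlinarith [sq_nonneg (b ⬝ᵥ w - t / 2)]

end EntryBounds

/-! ### Energy coefficients along the profile -/

section Along

variable {n : ℕ}

/-- The estimates on the local frame at `y = (u, s)` that are used along the whole profile. -/
structure FrameBounds (f : (Fin n → ℝ) → (Fin n → ℝ)) (g : (Fin n → ℝ) → ℝ) (L : Fin n → ℝ)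
    (A₀ Aw : (Fin n → ℝ) × ℝ → Matrix (Fin n) (Fin n) ℝ)
    (ρ : (Fin n → ℝ) × ℝ → Fin n → ℝ) (sg : ℝ) (K : Matrix (Fin n) (Fin n) ℝ)
    (C₁ c c₀ cH δ : ℝ) (y : (Fin n → ℝ) × ℝ) : Prop where
  reg_J : ∀ i j, IsRegularAt ρ C₁ (fun y => shiftedJac f y i j) y
  reg_B : ∀ j, IsRegularAt ρ C₁ (fun y => grad g y.1 j) y
  reg_A₀ : ∀ i j, IsRegularAt ρ C₁ (fun y => A₀ y i j) y
  reg_Aw : ∀ i j, IsRegularAt ρ C₁ (fun y => Aw y i j) y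
  reg_N₀ : ∀ i j, IsRegularAt ρ C₁ (fun y => (A₀ y * shiftedJac f y) i j) y
  reg_Nw : ∀ i j, IsRegularAt ρ C₁ (fun y => (Aw y * shiftedJac f y) i j) y
  reg_D : ∀ i, IsRegularAt ρ C₁ (fun y => (Aw y *ᵥ L) i) y
  coupled : SymmCoupled (jac f y.1) (grad g y.1) L (A₀ y)
  Aw_symm : (Aw y).IsSymm ∧ (Aw y * shiftedJac f y).IsSymm
  A₀_pos : ∀ w, c₀ * (w ⬝ᵥ w) ≤ w ⬝ᵥ (A₀ y *ᵥ w)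
  Aw_pos : ∀ w, c₀ * (w ⬝ᵥ w) ≤ w ⬝ᵥ (Aw y *ᵥ w)
  compress : ∀ w, cH * (w ⬝ᵥ w) ≤
    w ⬝ᵥ ((of fun i j => sg * fderiv ℝ (fun y => (Aw y * shiftedJac f y) i j) y (ρ y, 0)) *ᵥ w)
  weight : (Aw y *ᵥ L - grad g y.1) ⬝ᵥ (Aw y *ᵥ L - grad g y.1) ≤ δ
  K_pos : ∀ w, c * (w ⬝ᵥ w) ≤ (K *ᵥ w) ⬝ᵥ (shiftedJac f y *ᵥ w) + (grad g y.1 ⬝ᵥ w) ^ 2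

/-- Along a curve `U' = z ρ(U, s)` with a small velocity `z` of the compressive sign, the bounds on the
local frame give all the coefficient bounds required by the energy estimates. -/
theorem FrameBounds.energyData {f : (Fin n → ℝ) → (Fin n → ℝ)} {g : (Fin n → ℝ) → ℝ}
    {L : Fin n → ℝ} {A₀ Aw : (Fin n → ℝ) × ℝ → Matrix (Fin n) (Fin n) ℝ}
    {ρ : (Fin n → ℝ) × ℝ → Fin n → ℝ} {sg : ℝ} {K : Matrix (Fin n) (Fin n) ℝ}
    {C C₁ c c₀ cH δ m s : ℝ} {U : ℝ → Fin n → ℝ} {z : ℝ → ℝ}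
    (h : ∀ x, FrameBounds f g L A₀ Aw ρ sg K C₁ c c₀ cH δ (U x, s))
    (hU : ∀ x, HasDerivAt U (z x • ρ (U x, s)) x) (hz : Continuous z) (hzm : ∀ x, |z x| ≤ m)
    (hsg : sg = 1 ∨ sg = -1) (hz0 : ∀ x, sg * z x ≤ 0)
    (hC₁ : 0 ≤ C₁) (hc : 0 < c) (hc₀ : 0 < c₀) (hcH : 0 < cH) (hδ : 0 ≤ δ) (hm1 : m ≤ 1)
    (hmδ : m * (n ^ 2 * C₁ + n ^ 3 * C₁ ^ 2 + n * C₁ ^ 2) ≤ δ) (hmH : m * (2 * n * C₁ ^ 2) ≤ cH)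
    (hK : Kᵀ = -K) (hC1 : 1 ≤ C) (hCL : (Kᵀ *ᵥ L) ⬝ᵥ (Kᵀ *ᵥ L) / (2 * c) ≤ C)
    (hCK : ∑ i, ∑ j, |K i j| ≤ C) :
    ∃ (N₀' Nw' : ℝ → Matrix (Fin n) (Fin n) ℝ) (B' D' : ℝ → Fin n → ℝ),
      EnergyData (fun x => shiftedJac f (U x, s)) (fun x => A₀ (U x, s)) (fun x => Aw (U x, s))
        N₀' Nw' (fun x => grad g (U x)) B' D' L K c c₀ C δ := by
  have hm0 : 0 ≤ m := (abs_nonneg _).trans (hzm 0)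
  have hnn : ∀ w : Fin n → ℝ, 0 ≤ w ⬝ᵥ w := fun w => Finset.sum_nonneg fun _ _ => mul_self_nonneg _
  have hJ := fun i j => isBddC1_comp (fun x => (h x).reg_J i j) hU hz hzm
  have hB := fun j => isBddC1_comp (fun x => (h x).reg_B j) hU hz hzm
  have hN₀ := fun i j => isBddC1_comp (fun x => (h x).reg_N₀ i j) hU hz hzm
  have hNw := fun i j => isBddC1_comp (fun x => (h x).reg_Nw i j) hU hz hzm
  have hD := fun i => isBddC1_comp (fun x => (h x).reg_D i) hU hz hzm
  have hder : ∀ {Φ : (Fin n → ℝ) × ℝ → ℝ} {x}, IsRegularAt ρ C₁ Φ (U x, s) →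
      |z x * fderiv ℝ Φ (U x, s) (ρ (U x, s), 0)| ≤ m * C₁ := fun {Φ x} hr => by
    rw [abs_mul]
    exact mul_le_mul (hzm x) hr.bdd_fderiv (abs_nonneg _) hm0
  have t1 : 0 ≤ m * (n ^ 2 * C₁) := by positivity
  have t2 : 0 ≤ m * (n ^ 3 * C₁ ^ 2) := by positivity
  have t3 : 0 ≤ m * (n * C₁ ^ 2) := by positivity
  have hBsmall : n * (m * C₁) ^ 2 ≤ δ := by
    have : n * (m * C₁) ^ 2 = m * (m * (n * C₁ ^ 2)) := by ring
    rw [this]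
    nlinarith
  refine ⟨fun x => of fun i j => z x *
      fderiv ℝ (fun y => (A₀ y * shiftedJac f y) i j) (U x, s) (ρ (U x, s), 0),
    fun x => of fun i j => z x *
      fderiv ℝ (fun y => (Aw y * shiftedJac f y) i j) (U x, s) (ρ (U x, s), 0),
    fun x j => z x * fderiv ℝ (fun y => grad g y.1 j) (U x, s) (ρ (U x, s), 0),
    fun x i => z x * fderiv ℝ (fun y => (Aw y *ᵥ L) i) (U x, s) (ρ (U x, s), 0),
    { hA := fun i j => (hJ i j).fst
      hA₀ := fun i j => (isBddC1_comp (fun x => (h x).reg_A₀ i j) hU hz hzm).fst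
      hAw := fun i j => (isBddC1_comp (fun x => (h x).reg_Aw i j) hU hz hzm).fst
      A₀_symm := fun x => symm_of_posDef (h x).coupled.posDef
      Aw_symm := fun x => (h x).Aw_symm.1
      hN₀ := hN₀
      hNw := hNw
      N₀_symm := fun x => (h x).coupled.symm_shift s
      Nw_symm := fun x => (h x).Aw_symm.2
      hB := hB
      hD := hD
      A₀_mulVec := fun x => (h x).coupled.mulVec_eq
      c₀_pos := hc₀
      C_nonneg := zero_le_one.trans hC1
      δ_nonneg := hδ
      A₀_pos := fun x => (h x).A₀_pos
      Aw_pos := fun x => (h x).Aw_pos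
      compressive := fun x w t => ?_
      weight_close := fun x w t => dotProduct_mul_le_of_le (h x).weight w t
      N₀'_small := fun x w => ?_
      A_diff := fun d hd x w y => ?_
      B'_small := fun x w t => ?_
      B_diff := fun d hd x y t => ?_
      K_skew := hK
      K_pos := fun x w => ?_
      K_L := fun w t => ?_
      K_bdd := fun w y => ?_ }⟩
  · set q : Matrix (Fin n) (Fin n) ℝ := of fun i j =>
      fderiv ℝ (fun y => (Aw y * shiftedJac f y) i j) (U x, s) (ρ (U x, s), 0) with hq
    set d : Fin n → ℝ := fun i => fderiv ℝ (fun y => (Aw y *ᵥ L) i) (U x, s) (ρ (U x, s), 0) with hd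
    have e1 : (of fun i j => z x *
        fderiv ℝ (fun y => (Aw y * shiftedJac f y) i j) (U x, s) (ρ (U x, s), 0)) = z x • q := rfl
    have e2 : (fun i => z x * fderiv ℝ (fun y => (Aw y *ᵥ L) i) (U x, s) (ρ (U x, s), 0)) =
      z x • d := rfl
    have e3 := (h x).compress w
    have e4 : (of fun i j => sg *
        fderiv ℝ (fun y => (Aw y * shiftedJac f y) i j) (U x, s) (ρ (U x, s), 0)) = sg • q := rfl
    rw [e4, smul_mulVec, dotProduct_smul, smul_eq_mul] at e3
    rw [e1, e2, smul_mulVec, dotProduct_smul, smul_dotProduct, smul_eq_mul, smul_eq_mul]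
    have hdd : d ⬝ᵥ d ≤ n * C₁ ^ 2 := dotProduct_self_le fun i => ((h x).reg_D i).bdd_fderiv
    have hsg2 : sg * sg = 1 := by rcases hsg with rfl | rfl <;> norm_num
    have e5 := dotProduct_mul_le d w (-sg * t) hcH
    have e6 : (-sg * t) ^ 2 = t ^ 2 := by linear_combination t ^ 2 * hsg2
    rw [e6] at e5
    -- `σ = |z|`; the terms of the compressive estimate are proportional to it
    set σ := -(sg * z x) with hσ
    have hσ0 : 0 ≤ σ := by have := hz0 x; linarith
    have hzσ : z x = -sg * σ := by rw [hσ]; linear_combination (-z x) * hsg2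
    have hσm : σ ≤ m := by
      have := hzm x
      rw [abs_le] at this
      rcases hsg with rfl | rfl <;> linarith
    have e7 : σ * ((d ⬝ᵥ d) * t ^ 2 / (2 * cH)) ≤ t ^ 2 / 4 := by
      have : σ * (d ⬝ᵥ d) ≤ cH / 2 := by
        have := mul_le_mul hσm hdd (hnn d) hm0
        linarith
      rw [mul_div_assoc', div_le_div_iff₀ (by positivity) (by norm_num)]
      nlinarith [sq_nonneg t]
    have e8 := mul_le_mul_of_nonneg_left e3 hσ0
    have e9 := mul_le_mul_of_nonneg_left e5 hσ0
    rw [hzσ]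
    nlinarith
  · have := form_le (M := of fun i j => z x *
        fderiv ℝ (fun y => (A₀ y * shiftedJac f y) i j) (U x, s) (ρ (U x, s), 0))
      (fun i j => hder ((h x).reg_N₀ i j)) w w
    have := hnn w
    nlinarith
  · -- the form bound for the difference quotient with step `d`, at `-w` and `d y`, distributes the
    -- factor `d` as required
    have hE : ∀ i j, |(d⁻¹ • ((A₀ (U x, s))ᵀ * (shiftedJac f (U (x + d), s) -
        shiftedJac f (U x, s)))) i j| ≤ n * C₁ * (m * C₁) := by
      intro i j
      rw [Matrix.smul_apply, Matrix.mul_apply, smul_eq_mul, abs_mul, abs_of_pos (inv_pos.2 hd),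
        inv_mul_le_iff₀ hd]
      refine (Finset.abs_sum_le_sum_abs _ _).trans ?_
      calc _ ≤ ∑ _k : Fin n, C₁ * (m * C₁ * d) := Finset.sum_le_sum fun k _ => by
            rw [abs_mul]
            exact mul_le_mul ((h x).reg_A₀ k i).bdd
              ((hJ k j).abs_sub_le (fun x => hder ((h x).reg_J k j)) hd x) (abs_nonneg _) hC₁
        _ = d * (n * C₁ * (m * C₁)) := by simp; ring
    have h1 := form_le hE (-w) (d • y)
    simp only [smul_mulVec, mulVec_smul, dotProduct_smul, smul_dotProduct, neg_dotProduct,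
      dotProduct_neg, smul_eq_mul, neg_neg, ← mulVec_mulVec] at h1
    rw [dotProduct_mulVec w, vecMul_transpose, mul_inv_cancel_left₀ hd.ne'] at h1
    have := hnn w
    have := hnn y
    have : 0 ≤ d * (d * (y ⬝ᵥ y)) := by positivity
    have h2 : (n : ℝ) ^ 2 * (n * C₁ * (m * C₁)) / 2 ≤ δ := by nlinarith
    nlinarith
  · refine dotProduct_mul_le_of_le ((dotProduct_self_le fun i => hder ((h x).reg_B i)).trans ?_) w t
    exact hBsmall
  · have h1 := dotProduct_mul_le_of_le (δ := δ * d ^ 2) ((dotProduct_self_le fun i =>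
      (hB i).abs_sub_le (fun x => hder ((h x).reg_B i)) hd x).trans (by nlinarith [sq_nonneg d])) y t
    exact h1
  · refine ((h x).K_pos w).trans (add_le_add_right ?_ _)
    exact le_mul_of_one_le_left (sq_nonneg _) hC1
  · have h1 := dotProduct_mul_le (Kᵀ *ᵥ L) w (-t) hc
    have h2 : (K *ᵥ w) ⬝ᵥ L = (Kᵀ *ᵥ L) ⬝ᵥ w := by
      rw [dotProduct_comm, dotProduct_mulVec, mulVec_transpose]
    rw [h2]
    have h3 : (Kᵀ *ᵥ L) ⬝ᵥ (Kᵀ *ᵥ L) * (-t) ^ 2 / (2 * c) =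
      (Kᵀ *ᵥ L) ⬝ᵥ (Kᵀ *ᵥ L) / (2 * c) * t ^ 2 := by ring
    rw [h3] at h1
    nlinarith [sq_nonneg t]
  · have h1 := abs_form_le K (-y) w
    rw [dotProduct_comm (K *ᵥ w) y]
    have h2 := (le_abs_self _).trans h1
    simp only [neg_dotProduct, dotProduct_neg, neg_neg] at h2
    have := hnn w
    have := hnn y
    nlinarith

end Along

/-! ### Uniform bounds near a sonic state -/

section Bounds

variable {n : ℕ}

/-- Coercivity is an open condition. -/
theorem eventually_form_lower {Y : Type*} [TopologicalSpace Y] {M : Y → Matrix (Fin n) (Fin n) ℝ}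
    {y₀ : Y} (hM : ∀ i j, ContinuousAt (fun y => M y i j) y₀) {c c' : ℝ} (hc : c' < c)
    (h : ∀ w, c * (w ⬝ᵥ w) ≤ w ⬝ᵥ (M y₀ *ᵥ w)) :
    ∀ᶠ y in 𝓝 y₀, ∀ w, c' * (w ⬝ᵥ w) ≤ w ⬝ᵥ (M y *ᵥ w) := by
  have h1 : ContinuousAt (fun y => ∑ i, ∑ j, |(M y - M y₀) i j|) y₀ := by
    simp only [Matrix.sub_apply]
    exact tendsto_finsetSum _ fun i _ => tendsto_finsetSum _ fun j _ =>
      ((hM i j).sub continuousAt_const).abs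
  have h2 := h1.eventually_lt continuousAt_const
    (show ∑ i, ∑ j, |(M y₀ - M y₀) i j| < c - c' by simpa using hc)
  filter_upwards [h2] with y hy w
  have h3 := (abs_le.1 (abs_form_le (M y - M y₀) w w)).1
  have h4 : 0 ≤ w ⬝ᵥ w := Finset.sum_nonneg fun _ _ => mul_self_nonneg _
  rw [sub_mulVec, dotProduct_sub] at h3
  have h5 := h w
  nlinarith

/-- The bounds for the local frame hold uniformly near `y₀`; only the neighbourhood depends on the
tolerance `δ`. -/
theorem LocalFrame.exists_bounds {f : (Fin n → ℝ) → (Fin n → ℝ)} {g : (Fin n → ℝ) → ℝ}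
    {L l : Fin n → ℝ} {y₀ : (Fin n → ℝ) × ℝ}
    {A₀ Aw : (Fin n → ℝ) × ℝ → Matrix (Fin n) (Fin n) ℝ} {ρ : (Fin n → ℝ) × ℝ → Fin n → ℝ}
    {α : (Fin n → ℝ) × ℝ → ℝ} {sg : ℝ} (h : LocalFrame f g L l y₀ A₀ Aw ρ α sg) :
    ∃ (K : Matrix (Fin n) (Fin n) ℝ) (C₁ c c₀ cH : ℝ), Kᵀ = -K ∧ 0 ≤ C₁ ∧ 0 < c ∧ 0 < c₀ ∧ 0 < cH ∧
      ∀ δ > 0, ∀ᶠ y in 𝓝 y₀, FrameBounds f g L A₀ Aw ρ sg K C₁ c c₀ cH δ y := by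
  have hρ := h.direction.smooth_ρ
  have hJ := contDiffAt_shiftedJac h.smooth_f
  have hB : ∀ j, ContDiffAt ℝ 1 (fun y : (Fin n → ℝ) × ℝ => grad g y.1 j) y₀ := fun j =>
    (contDiffAt_grad h.smooth_g j).comp y₀ contDiffAt_fst
  have hN₀ := contDiffAt_matrix_mul h.smooth_A₀ hJ
  have hNw := contDiffAt_matrix_mul h.smooth_Aw hJ
  have hD : ∀ i, ContDiffAt ℝ 1 (fun y => (Aw y *ᵥ L) i) y₀ := fun i => by
    simp only [mulVec, dotProduct]
    exact ContDiffAt.sum fun k _ => (h.smooth_Aw i k).mul contDiffAt_const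
  obtain ⟨C₁, r₁⟩ := exists_isRegularAt (fun ij : Fin n × Fin n => hJ ij.1 ij.2) hρ
  obtain ⟨C₂, r₂⟩ := exists_isRegularAt hB hρ
  obtain ⟨C₃, r₃⟩ := exists_isRegularAt (fun ij : Fin n × Fin n => h.smooth_A₀ ij.1 ij.2) hρ
  obtain ⟨C₄, r₄⟩ := exists_isRegularAt (fun ij : Fin n × Fin n => h.smooth_Aw ij.1 ij.2) hρ
  obtain ⟨C₅, r₅⟩ := exists_isRegularAt (fun ij : Fin n × Fin n => hN₀ ij.1 ij.2) hρ
  obtain ⟨C₆, r₆⟩ := exists_isRegularAt (fun ij : Fin n × Fin n => hNw ij.1 ij.2) hρ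
  obtain ⟨C₇, r₇⟩ := exists_isRegularAt hD hρ
  have hcpl := h.coupled.self_of_nhds
  obtain ⟨K, hK, c, hc, hKc⟩ := hcpl.exists_compensator
  obtain ⟨c₀, hc₀, hA₀c⟩ := exists_coercive (φ := fun w => w ⬝ᵥ (A₀ y₀ *ᵥ w)) (by fun_prop)
    (fun t w => by simp only [mulVec_smul, dotProduct_smul, smul_dotProduct, smul_eq_mul]; ring)
    (fun w hw => pos_of_posDef hcpl.posDef hw)
  obtain ⟨cH, hcH, hHc⟩ := h.compress
  have f₁ := eventually_form_lower (fun i j => (h.smooth_A₀ i j).continuousAt)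
    (half_lt_self hc₀) hA₀c
  have f₂ := eventually_form_lower (fun i j => (h.smooth_Aw i j).continuousAt)
    (half_lt_self hc₀) (h.Aw_eq ▸ hA₀c)
  have f₃ := eventually_form_lower (M := fun y => of fun i j =>
      sg * fderiv ℝ (fun y => (Aw y * shiftedJac f y) i j) y (ρ y, 0))
    (fun i j => continuousAt_const.mul (continuousAt_fderiv_direction (hNw i j) hρ.continuousAt))
    (half_lt_self hcH) hHc
  have f₄ : ∀ᶠ y in 𝓝 y₀, ∀ w, c / 2 * (w ⬝ᵥ w) ≤
      (K *ᵥ w) ⬝ᵥ (shiftedJac f y *ᵥ w) + (grad g y.1 ⬝ᵥ w) ^ 2 := by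
    have e : ∀ (y : (Fin n → ℝ) × ℝ) w,
        w ⬝ᵥ ((Kᵀ * shiftedJac f y + vecMulVec (grad g y.1) (grad g y.1)) *ᵥ w) =
          (K *ᵥ w) ⬝ᵥ (shiftedJac f y *ᵥ w) + (grad g y.1 ⬝ᵥ w) ^ 2 := fun y w => by
      rw [add_mulVec, dotProduct_add, ← mulVec_mulVec, dotProduct_mulVec, vecMul_transpose,
        vecMulVec_mulVec, op_smul_eq_smul, dotProduct_smul, smul_eq_mul, dotProduct_comm w, sq]
    simp only [← e]
    refine eventually_form_lower (fun i j => ?_) (half_lt_self hc) fun w => ?_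
    · simp only [Matrix.add_apply, Matrix.mul_apply, vecMulVec_apply]
      exact (tendsto_finsetSum _ fun k _ => (continuousAt_const.mul (hJ k j).continuousAt)).add
        ((hB i).continuousAt.mul (hB j).continuousAt)
    · rw [e, shiftedJac_mulVec, dotProduct_sub, dotProduct_smul]
      -- a skew form vanishes on the diagonal
      have h0 : (K *ᵥ w) ⬝ᵥ w = 0 := by
        have h1 : (K *ᵥ w) ⬝ᵥ w = -((K *ᵥ w) ⬝ᵥ w) := by
          conv_lhs => rw [dotProduct_comm, dotProduct_mulVec, ← mulVec_transpose, hK, neg_mulVec,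
            neg_dotProduct]
        linarith
      rw [h0, smul_zero, sub_zero]
      exact hKc w
  refine ⟨K, max 0 (max C₁ (max C₂ (max C₃ (max C₄ (max C₅ (max C₆ C₇)))))), c / 2, c₀ / 2, cH / 2,
    hK, le_max_left _ _, half_pos hc, half_pos hc₀, half_pos hcH, fun δ hδ => ?_⟩
  have f₅ : ∀ᶠ y in 𝓝 y₀, (Aw y *ᵥ L - grad g y.1) ⬝ᵥ (Aw y *ᵥ L - grad g y.1) < δ := by
    refine ContinuousAt.eventually_lt ?_ continuousAt_const ?_
    · simp only [dotProduct, Pi.sub_apply]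
      exact tendsto_finsetSum _ fun i _ =>
        ((hD i).continuousAt.sub (hB i).continuousAt).mul ((hD i).continuousAt.sub (hB i).continuousAt)
    · rw [h.Aw_eq, hcpl.mulVec_eq, sub_self, dotProduct_zero]
      exact hδ
  filter_upwards [r₁, r₂, r₃, r₄, r₅, r₆, r₇, h.coupled, h.Aw_symm, f₁, f₂, f₃, f₄, f₅] with y
    a₁ a₂ a₃ a₄ a₅ a₆ a₇ b₁ b₂ b₃ b₄ b₅ b₆ b₇
  exact
    { reg_J := fun i j => (a₁ (i, j)).mono (by simp)
      reg_B := fun j => (a₂ j).mono (by simp)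
      reg_A₀ := fun i j => (a₃ (i, j)).mono (by simp)
      reg_Aw := fun i j => (a₄ (i, j)).mono (by simp)
      reg_N₀ := fun i j => (a₅ (i, j)).mono (by simp)
      reg_Nw := fun i j => (a₆ (i, j)).mono (by simp)
      reg_D := fun i => (a₇ i).mono (by simp)
      coupled := b₁
      Aw_symm := b₂
      A₀_pos := b₃
      Aw_pos := b₄
      compress := b₅
      weight := b₇.le
      K_pos := b₆ }

end Bounds

/-! ### The profile equations -/

section Profile

variable {n : ℕ} {𝒰 : Set (Fin n → ℝ)} {f : (Fin n → ℝ) → (Fin n → ℝ)} {g : (Fin n → ℝ) → ℝ}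
  {L l : Fin n → ℝ} {p : Fin n} {um up : Fin n → ℝ} {s : ℝ} {U : ℝ → Fin n → ℝ} {Q : ℝ → ℝ}
  {ρ : (Fin n → ℝ) × ℝ → Fin n → ℝ} {α : (Fin n → ℝ) × ℝ → ℝ}

theorem IsRadiativeShockProfile.hasDerivAt_flux
    (hP : IsRadiativeShockProfile 𝒰 f g L p um up s U Q) {x : ℝ} (hf : DifferentiableAt ℝ f (U x)) :
    HasDerivAt (fun y => f (U y)) (jac f (U x) *ᵥ deriv U x) x := by
  have hU := (hP.contDiff_U.differentiable one_ne_zero x).hasDerivAt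
  rw [← fderiv_eq_jac]
  exact hf.hasFDerivAt.comp_hasDerivAt x hU

/-- The profile moves along the direction field. -/
theorem IsRadiativeShockProfile.eq_direction
    (hP : IsRadiativeShockProfile 𝒰 f g L p um up s U Q) {x : ℝ} (hf : DifferentiableAt ℝ f (U x))
    (hsol : shiftedJac f (U x, s) *ᵥ ρ (U x, s) = α (U x, s) • L ∧ l ⬝ᵥ ρ (U x, s) = 1)
    (huniq : ∀ (r : Fin n → ℝ) (a : ℝ),
      shiftedJac f (U x, s) *ᵥ r = a • L → l ⬝ᵥ r = 0 → r = 0 ∧ a = 0) :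
    deriv U x = (l ⬝ᵥ deriv U x) • ρ (U x, s) ∧
      deriv Q x = -(α (U x, s) * (l ⬝ᵥ deriv U x)) := by
  have h1 := hP.profile_u x
  rw [(hP.hasDerivAt_flux hf).deriv] at h1
  have h2 : shiftedJac f (U x, s) *ᵥ deriv U x = -(deriv Q x • L) := by
    rw [shiftedJac_mulVec]
    exact eq_neg_of_add_eq_zero_left h1
  obtain ⟨e1, e2⟩ := huniq (deriv U x - (l ⬝ᵥ deriv U x) • ρ (U x, s))
    (-deriv Q x - (l ⬝ᵥ deriv U x) * α (U x, s)) (by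
      rw [mulVec_sub, h2, mulVec_smul, hsol.1, sub_smul, neg_smul, mul_smul]) (by
      rw [dotProduct_sub, dotProduct_smul, hsol.2, smul_eq_mul, mul_one, sub_self])
  exact ⟨sub_eq_zero.1 e1, by linarith⟩

/-- The integrated profile equation. -/
theorem IsRadiativeShockProfile.integrated
    (hP : IsRadiativeShockProfile 𝒰 f g L p um up s U Q) (hf : ∀ x, DifferentiableAt ℝ f (U x))
    (hup : ContinuousAt f up) (x : ℝ) : f (U x) - s • U x + Q x • L = f up - s • up := by
  have hd : ∀ x, HasDerivAt (fun y => f (U y) - s • U y + Q y • L) 0 x := fun x => by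
    have hU := (hP.contDiff_U.differentiable one_ne_zero x).hasDerivAt
    have hQ := (hP.contDiff_Q.differentiable two_ne_zero x).hasDerivAt
    have h1 := hP.hasDerivAt_flux (hf x)
    refine ((h1.sub (hU.const_smul s)).add (hQ.smul_const L)).congr_deriv ?_
    rw [← h1.deriv]
    exact hP.profile_u x
  have hconst : ∀ y, f (U x) - s • U x + Q x • L = f (U y) - s • U y + Q y • L := fun y =>
    is_const_of_deriv_eq_zero (fun x => (hd x).differentiableAt) (fun x => (hd x).deriv) x y
  have hlim : Tendsto (fun y => f (U y) - s • U y + Q y • L) atTop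
      (𝓝 (f up - s • up + (0 : ℝ) • L)) :=
    ((hup.tendsto.comp hP.tendsto_U_right).sub (hP.tendsto_U_right.const_smul s)).add
      (hP.tendsto_Q_right.smul_const L)
  rw [zero_smul, add_zero] at hlim
  refine tendsto_nhds_unique ?_ hlim
  simp only [← hconst]
  exact tendsto_const_nhds

end Profile

/-! ### Stability of a small profile -/

section Stability

variable {n : ℕ}

/-- The estimates at `y = (u, s)` used both for the profile and for the eigenvalue problem. -/
structure GoodState (f : (Fin n → ℝ) → (Fin n → ℝ)) (g : (Fin n → ℝ) → ℝ) (L l : Fin n → ℝ)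
    (A₀ Aw : (Fin n → ℝ) × ℝ → Matrix (Fin n) (Fin n) ℝ)
    (ρ : (Fin n → ℝ) × ℝ → Fin n → ℝ) (α : (Fin n → ℝ) × ℝ → ℝ) (sg : ℝ)
    (K : Matrix (Fin n) (Fin n) ℝ) (C₁ c c₀ cH δ T γ₁ γ₂ β₁ : ℝ) (y : (Fin n → ℝ) × ℝ) : Prop where
  bounds : FrameBounds f g L A₀ Aw ρ sg K C₁ c c₀ cH δ y
  solves : shiftedJac f y *ᵥ ρ y = α y • L ∧ l ⬝ᵥ ρ y = 1
  unique : ∀ (r : Fin n → ℝ) (a : ℝ), shiftedJac f y *ᵥ r = a • L → l ⬝ᵥ r = 0 → r = 0 ∧ a = 0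
  reg_α : IsRegularAt ρ T α y
  γ_ge : γ₁ ≤ sg * fderiv ℝ α y (ρ y, 0)
  γ_le : sg * fderiv ℝ α y (ρ y, 0) ≤ γ₂
  β_ge : β₁ ≤ grad g y.1 ⬝ᵥ ρ y
  diff_f : DifferentiableAt ℝ f y.1
  diff_g : DifferentiableAt ℝ g y.1

variable {𝒰 : Set (Fin n → ℝ)} {f : (Fin n → ℝ) → (Fin n → ℝ)} {g : (Fin n → ℝ) → ℝ}
  {L l : Fin n → ℝ} {p : Fin n} {um up : Fin n → ℝ} {s : ℝ} {U : ℝ → Fin n → ℝ} {Q : ℝ → ℝ}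
  {A₀ Aw : (Fin n → ℝ) × ℝ → Matrix (Fin n) (Fin n) ℝ}
  {ρ : (Fin n → ℝ) × ℝ → Fin n → ℝ} {α : (Fin n → ℝ) × ℝ → ℝ} {sg : ℝ}
  {K : Matrix (Fin n) (Fin n) ℝ} {C C₁ c c₀ cH δ T γ₁ γ₂ β₁ κ m : ℝ}

/-- A small profile is monotone and slowly varying: it moves along the direction field with a
velocity of constant sign bounded by `m`. -/
theorem IsRadiativeShockProfile.velocity
    (hP : IsRadiativeShockProfile 𝒰 f g L p um up s U Q)
    (hG : ∀ x, GoodState f g L l A₀ Aw ρ α sg K C₁ c c₀ cH δ T γ₁ γ₂ β₁ (U x, s))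
    (hsg : sg = 1 ∨ sg = -1) (hQ : ∀ x, |Q x| ≤ κ) (hγ : 0 < γ₁) (hβ : 0 < β₁)
    (hm0 : 0 < m) (hm : κ + m ^ 2 * γ₂ < m * β₁) :
    ∃ z : ℝ → ℝ, Continuous z ∧ (∀ x, HasDerivAt U (z x • ρ (U x, s)) x) ∧
      (∀ x, |z x| ≤ m) ∧ ∀ x, sg * z x ≤ 0 := by
  have hdir := fun x => hP.eq_direction (hG x).diff_f (hG x).solves (hG x).unique
  set z : ℝ → ℝ := fun x => l ⬝ᵥ deriv U x with hz
  have hzc : Continuous z := by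
    have : Continuous (deriv U) := hP.contDiff_U.continuous_deriv le_rfl
    simp only [hz, dotProduct]
    fun_prop
  have hU : ∀ x, HasDerivAt U (z x • ρ (U x, s)) x := fun x => by
    rw [← (hdir x).1]
    exact (hP.contDiff_U.differentiable one_ne_zero x).hasDerivAt
  have hsg2 : sg * sg = 1 := by rcases hsg with rfl | rfl <;> norm_num
  have hsgabs : |sg| = 1 := by rcases hsg with rfl | rfl <;> norm_num
  have hQd : ∀ x, HasDerivAt Q (-(α (U x, s) * z x)) x := fun x => by
    rw [← (hdir x).2]
    exact (hP.contDiff_Q.differentiable two_ne_zero x).hasDerivAt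
  have hQ2 : ∀ x, HasDerivAt (fun y => -(α (U y, s) * z y))
      (Q x + z x * (grad g (U x) ⬝ᵥ ρ (U x, s))) x := fun x => by
    have e1 : (fun y => -(α (U y, s) * z y)) = deriv Q := funext fun y => (hdir y).2.symm
    have e2 : Differentiable ℝ (deriv Q) := by
      have : ContDiff ℝ (1 + 1) Q := hP.contDiff_Q
      exact (contDiff_succ_iff_deriv.1 this).2.2.differentiable one_ne_zero
    have e3 : HasDerivAt (fun y => g (U y)) (z x * (grad g (U x) ⬝ᵥ ρ (U x, s))) x := by
      have := (hG x).diff_g.hasFDerivAt.comp_hasDerivAt x (hU x)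
      refine this.congr_deriv ?_
      rw [map_smul, fderiv_eq_grad, smul_eq_mul]
    have e4 := hP.profile_q x
    rw [e3.deriv] at e4
    rw [e1]
    refine (e2 x).hasDerivAt.congr_deriv ?_
    linarith
  have hscal : IsScalarProfile (fun x => α (U x, s)) (fun x => sg * Q x) (fun x => sg * z x)
      (fun x => sg * fderiv ℝ α (U x, s) (ρ (U x, s), 0)) (fun x => grad g (U x) ⬝ᵥ ρ (U x, s))
      γ₁ γ₂ β₁ κ T :=
    { ha := fun x => by
        have h1 := ((hG x).reg_α.contDiffAt.differentiableAt one_ne_zero).hasFDerivAt.comp_hasDerivAt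
          x ((hU x).prodMk (hasDerivAt_const x s))
        refine h1.congr_deriv ?_
        have h2 : ((z x • ρ (U x, s), 0) : (Fin n → ℝ) × ℝ) = z x • (ρ (U x, s), 0) := by
          rw [Prod.smul_mk, smul_zero]
        rw [h2, map_smul, smul_eq_mul]
        linear_combination (-(z x * fderiv ℝ α (U x, s) (ρ (U x, s), 0))) * hsg2
      hQ := fun x => ((hQd x).const_mul sg).congr_deriv (by ring)
      hQ' := fun x => by
        have h1 := (hQ2 x).const_mul sg
        refine (h1.congr_deriv (by ring)).congr_of_eventuallyEq (Eventually.of_forall fun y => ?_)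
        ring
      hz := continuous_const.mul hzc
      γ₁_pos := hγ
      γ_ge := fun x => (hG x).γ_ge
      γ_le := fun x => (hG x).γ_le
      β₁_pos := hβ
      β_ge := fun x => (hG x).β_ge
      Q_le := fun x => by rw [abs_mul, hsgabs, one_mul]; exact hQ x
      a_le := fun x => (hG x).reg_α.bdd
      Q_bot := by simpa using hP.tendsto_Q_left.const_mul sg
      Q_top := by simpa using hP.tendsto_Q_right.const_mul sg }
  refine ⟨z, hzc, hU, fun x => ?_, hscal.z_nonpos⟩
  have h1 := hscal.z_nonpos x
  have h2 := hscal.neg_le_z hm0 hm x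
  rw [← one_mul |z x|, ← hsgabs, ← abs_mul, abs_le]
  exact ⟨h2, h1.trans hm0.le⟩

/-- Spectral stability of a profile that stays among the good states, with a velocity bound `m` that
is small enough for the energy estimates. -/
theorem IsRadiativeShockProfile.spectrallyStable
    (hP : IsRadiativeShockProfile 𝒰 f g L p um up s U Q)
    (hG : ∀ x, GoodState f g L l A₀ Aw ρ α sg K C₁ c c₀ cH δ T γ₁ γ₂ β₁ (U x, s))
    (hsg : sg = 1 ∨ sg = -1) (hQ : ∀ x, |Q x| ≤ κ) (hγ : 0 < γ₁) (hβ : 0 < β₁)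
    (hC₁ : 0 ≤ C₁) (hc : 0 < c) (hc₀ : 0 < c₀) (hcH : 0 < cH) (hδ : 0 ≤ δ)
    (hm0 : 0 < m) (hm1 : m ≤ 1) (hm : κ + m ^ 2 * γ₂ < m * β₁)
    (hmδ : m * (n ^ 2 * C₁ + n ^ 3 * C₁ ^ 2 + n * C₁ ^ 2) ≤ δ) (hmH : m * (2 * n * C₁ ^ 2) ≤ cH)
    (hK : Kᵀ = -K) (hC1 : 1 ≤ C) (hCL : (Kᵀ *ᵥ L) ⬝ᵥ (Kᵀ *ᵥ L) / (2 * c) ≤ C)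
    (hCK : ∑ i, ∑ j, |K i j| ≤ C) (hδC : δ * (44 * C + C / c₀ * (10 * n + 1)) < c / 2) :
    SpectrallyStable f g L s U := by
  obtain ⟨z, hz, hU, hzm, hz0⟩ := hP.velocity hG hsg hQ hγ hβ hm0 hm
  obtain ⟨N₀', Nw', B', D', hE⟩ := FrameBounds.energyData (fun x => (hG x).bounds) hU hz hzm hsg hz0
    hC₁ hc hc₀ hcH hδ hm1 hmδ hmH hK hC1 hCL hCK
  intro lam hre hlam u q hsol
  obtain ⟨W₁, W₂, v₁, v₂, q₁, q₂, e₁, e₂, m₁, m₂⟩ :=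
    hsol.exists_modes hlam hE.hA fun j => (hE.hB j).fst
  obtain ⟨⟨hu₁, hu₂⟩, hq₁, hq₂⟩ := hE.eq_zero hδC hre m₁ m₂
  constructor
  · filter_upwards [hu₁, hu₂] with x h1 h2
    funext i
    exact Complex.ext (congrFun h1 i) (congrFun h2 i)
  · filter_upwards [hq₁, hq₂, e₁, e₂] with x h1 h2 h3 h4
    exact Complex.ext (by rw [← h3, h1]; rfl) (by rw [← h4, h2]; rfl)

end Stability

end RadiativeShock

end

theorem theorem1p4 (n : ℕ) (p : Fin n) (𝒰 : Set (Fin n → ℝ))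
    (f : (Fin n → ℝ) → (Fin n → ℝ)) (g : (Fin n → ℝ) → ℝ) (L : Fin n → ℝ)
    (hS : RadiativeShock.StructuralAssumptions 𝒰 f g L p)
    (ustar : Fin n → ℝ) (hstar : ustar ∈ 𝒰) :
    ∃ N ∈ nhds ustar, ∃ ε₀ > (0 : ℝ),
      ∀ (um up : Fin n → ℝ) (s : ℝ) (U : ℝ → (Fin n → ℝ)) (Q : ℝ → ℝ),
        RadiativeShock.IsRadiativeShockProfile 𝒰 f g L p um up s U Q →
        (∀ x, U x ∈ N) → ‖up - um‖ < ε₀ →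
        RadiativeShock.SpectrallyStable f g L s U := by
  open RadiativeShock Matrix in
  obtain ⟨hcs, l, A₀, Aw, ρ, α, sg, hF⟩ := hS.exists_localFrame hstar
  set y₀ : (Fin n → ℝ) × ℝ := (ustar, charSpeed f p ustar) with hy₀
  obtain ⟨K, C₁, c, c₀, cH, hK, hC₁, hc, hc₀, hcH, hbounds⟩ := hF.exists_bounds
  obtain ⟨C, hC⟩ : ∃ C, C = max 1 (max ((Kᵀ *ᵥ L) ⬝ᵥ (Kᵀ *ᵥ L) / (2 * c)) (∑ i, ∑ j, |K i j|)) :=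
    ⟨_, rfl⟩
  have hC1 : 1 ≤ C := hC ▸ le_max_left _ _
  have hCL : (Kᵀ *ᵥ L) ⬝ᵥ (Kᵀ *ᵥ L) / (2 * c) ≤ C :=
    hC ▸ (le_max_left _ _).trans (le_max_right _ _)
  have hCK : ∑ i, ∑ j, |K i j| ≤ C := hC ▸ (le_max_right _ _).trans (le_max_right _ _)
  obtain ⟨S, hS0, hSdef⟩ : ∃ S, 0 ≤ S ∧ 44 * C + C / c₀ * (10 * n + 1) = S := ⟨_, by positivity, rfl⟩
  obtain ⟨δ, hδ, hδS⟩ : ∃ δ > 0, δ * S < c / 2 := by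
    refine ⟨c / (4 * (S + 1)), by positivity, ?_⟩
    rw [div_mul_eq_mul_div, div_lt_div_iff₀ (by positivity) two_pos]
    nlinarith
  have hβ := hF.β_pos
  have hγ := hF.γ_pos
  set β := grad g y₀.1 ⬝ᵥ ρ y₀ with hβdef
  set γ := sg * fderiv ℝ α y₀ (ρ y₀, 0) with hγdef
  -- the bound for the velocity of the profile
  obtain ⟨m, hm0, hm1, hmδ, hmH, hmβ⟩ : ∃ m > 0, m ≤ 1 ∧
      m * (n ^ 2 * C₁ + n ^ 3 * C₁ ^ 2 + n * C₁ ^ 2) ≤ δ ∧ m * (2 * n * C₁ ^ 2) ≤ cH ∧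
      m * (2 * γ) ≤ β / 8 := by
    have key : ∀ k b : ℝ, 0 < b → ∀ᶠ m in 𝓝[>] (0 : ℝ), m * k ≤ b := fun k b hb => by
      have : ContinuousAt (fun m : ℝ => m * k) 0 := by fun_prop
      exact ((this.eventually_lt continuousAt_const (by simpa using hb)).filter_mono
        nhdsWithin_le_nhds).mono fun _ h => h.le
    obtain ⟨m, h0, h1, h2, h3, h4⟩ := (eventually_mem_nhdsWithin.and ((key 1 1 one_pos).and
      ((key _ δ hδ).and ((key _ cH hcH).and (key (2 * γ) (β / 8) (by positivity)))))).exists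
    exact ⟨m, h0, by simpa using h1, h2, h3, h4⟩
  have hκ : m * β / 4 + m ^ 2 * (2 * γ) < m * (β / 2) := by nlinarith [mul_pos hm0 hβ]
  obtain ⟨T, hT⟩ := exists_isRegularAt (fun _ : Unit => hF.direction.smooth_α) hF.direction.smooth_ρ
  -- the flux `l · (f(u) - s u)`, whose increments along the profile are those of `-Q`
  set Ψ : (Fin n → ℝ) × ℝ → ℝ := fun y => l ⬝ᵥ (f y.1 - y.2 • y.1) with hΨ
  have hΨc : ContinuousAt Ψ y₀ := by
    have h1 : ContinuousAt (fun y : (Fin n → ℝ) × ℝ => f y.1) y₀ :=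
      ContinuousAt.comp (f := Prod.fst) hF.smooth_f.continuousAt continuousAt_fst
    have h2 : ContinuousAt (fun y : (Fin n → ℝ) × ℝ => f y.1 - y.2 • y.1) y₀ :=
      h1.sub (continuousAt_snd.smul continuousAt_fst)
    simp only [hΨ, dotProduct]
    exact tendsto_finsetSum _ fun i _ => continuousAt_const.mul (continuousAt_pi.1 h2 i)
  have hαd := continuousAt_fderiv_direction hF.direction.smooth_α
    hF.direction.smooth_ρ.continuousAt
  have hβc : ContinuousAt (fun y : (Fin n → ℝ) × ℝ => grad g y.1 ⬝ᵥ ρ y) y₀ := by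
    simp only [dotProduct]
    exact tendsto_finsetSum _ fun i _ => (((contDiffAt_grad hF.smooth_g i).comp y₀
      contDiffAt_fst).continuousAt).mul
        (continuousAt_pi.1 hF.direction.smooth_ρ.continuousAt i)
  have hgood : ∀ᶠ y in 𝓝 y₀, GoodState f g L l A₀ Aw ρ α sg K C₁ c c₀ cH δ T (γ / 2) (2 * γ) (β / 2) y
      ∧ |Ψ y - Ψ y₀| < m * β / 8 ∧ ContinuousAt f y.1 := by
    filter_upwards [hbounds δ hδ, hF.direction.solves, hF.direction.unique, hT,
      continuousAt_const.eventually_lt (continuousAt_const.mul hαd) (half_lt_self hγ),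
      (continuousAt_const.mul hαd).eventually_lt continuousAt_const
        (show γ < 2 * γ by linarith),
      continuousAt_const.eventually_lt hβc (half_lt_self hβ),
      (hΨc.sub continuousAt_const).abs.eventually_lt continuousAt_const
        (show |Ψ y₀ - Ψ y₀| < m * β / 8 by rw [sub_self, abs_zero]; positivity),
      continuous_fst.tendsto y₀ |>.eventually (hF.smooth_f.eventually (by simp)),
      continuous_fst.tendsto y₀ |>.eventually (hF.smooth_g.eventually (by simp))] with y
      h1 h2 h3 h4 h5 h6 h7 h8 h9 h10
    exact ⟨⟨h1, h2, h3, h4 (), h5.le, h6.le, h7.le, h9.differentiableAt two_ne_zero,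
      h10.differentiableAt two_ne_zero⟩, h8, h9.continuousAt⟩
  obtain ⟨r, hr, hball⟩ := Metric.eventually_nhds_iff.1 hgood
  obtain ⟨r', hr', hspeed⟩ := Metric.eventually_nhds_iff.1 (Metric.continuousAt_iff'.1 hcs r hr)
  -- a profile with values in a small ball has small amplitude, so the ball alone suffices
  refine ⟨Metric.ball ustar (min r r' / 2), Metric.ball_mem_nhds _ (by positivity), 1, one_pos, ?_⟩
  intro um up s U Q hP hUN _
  have hclosure : ∀ u, u ∈ closure (Metric.ball ustar (min r r' / 2)) →
      dist u ustar < r ∧ dist u ustar < r' := fun u hu => by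
    have h1 : dist u ustar ≤ min r r' / 2 := Metric.closure_ball_subset_closedBall hu
    have h2 : 0 < min r r' := lt_min hr hr'
    have h3 := min_le_left r r'
    have h4 := min_le_right r r'
    constructor <;> linarith
  have hum := hclosure um (mem_closure_of_tendsto hP.tendsto_U_left (Eventually.of_forall hUN))
  have hup := hclosure up (mem_closure_of_tendsto hP.tendsto_U_right (Eventually.of_forall hUN))
  -- by the entropy conditions the speed is close to `a_p(u_*)`
  have hs : dist s (charSpeed f p ustar) < r := by
    have h1 := hspeed hum.2
    have h2 := hspeed hup.2
    rw [Real.dist_eq, abs_lt] at h1 h2 ⊢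
    have h3 := hP.shock.lax_left
    have h4 := hP.shock.lax_right
    constructor <;> linarith [h1.1, h1.2, h2.1, h2.2]
  have hmem : ∀ u, dist u ustar < r → dist (u, s) y₀ < r := fun u hu => by
    rw [Prod.dist_eq]
    exact max_lt hu hs
  have hUG := fun x => hball (hmem (U x) (hclosure _ (subset_closure (hUN x))).1)
  have hupG := hball (hmem up hup.1)
  have hQ : ∀ x, |Q x| ≤ m * β / 4 := fun x => by
    have h1 := congrArg (fun y => l ⬝ᵥ y)
      (hP.integrated (fun x => (hUG x).1.diff_f) hupG.2.2 x)
    simp only [dotProduct_add, dotProduct_smul, hF.l_L, smul_eq_mul, mul_one] at h1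
    have h2 : Q x = (Ψ (up, s) - Ψ y₀) - (Ψ (U x, s) - Ψ y₀) := by
      simp only [hΨ]
      linarith
    have h3 := abs_lt.1 (hUG x).2.1
    have h4 := abs_lt.1 hupG.2.1
    rw [h2, abs_le]
    constructor <;> linarith [h3.1, h3.2, h4.1, h4.2]
  exact hP.spectrallyStable (fun x => (hUG x).1) hF.sg_eq hQ (half_pos hγ) (half_pos hβ) hC₁ hc hc₀
    hcH hδ.le hm0 hm1 hκ hmδ hmH hK hC1 hCL hCK (by rw [hSdef]; exact hδS)
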